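/- For $d\ge 0$ let $\mathbb{T}_d$ be the $d$-regular tree with root $\circ$. A factor of iid (FIID) percolation process on $\mathbb{T}_d$ is a random $\mathbf{Y}\in\{0,1\}^{V(\mathbb{T}_d)}$ of the form $\mathbf{Y}(v)=f(\gamma_{v\to\circ}\cdot\mathbf{X})$, where $\mathbf{X}=(X(v))_{v\in V(\mathbb{T}_d)}$ are independent random variables uniformly distributed on $[0,1]$, $\gamma_{v\to\circ}$ is an automorphism of $\mathbb{T}_d$ that maps $v$ to $\circ$, automorphisms act on labellings by $(\gamma\cdot\omega)(v)=\omega(\gamma^{-1}v)$, and $f:[0,1]^{V(\mathbb{T}_d)}\to\{0,1\}$ is measurable for the product Borel $\sigma$-algebra and satisfies $f(\gamma\cdot\omega)=f(\omega)$ for all $\omega$ and all automorphisms $\gamma$ with $\gamma(\circ)=\circ$. Its density is $\mathrm{den}(\mathbf{Y})=\mathbb{P}[\mathbf{Y}(\circ)=1]$. Let $\{\mathbf{Y}_d\}$ be a sequence of FIID percolation processes with $\mathbf{Y}_d$ defined on $\mathbb{T}_d$. Suppose that, for every $d$, the connected components of the subgraph of $\mathbb{T}_d$ induced by the vertices $\{v\in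 V(\mathbb{T}_d):\mathbf{Y}_d(v)=1\}$ are all finite with probability one. Then $$\limsup_{d\to\infty}\ \frac{\mathrm{den}(\mathbf{Y}_d)}{(\log d)/d}\ \le\ 1 .$$ -/

import Mathlib

open MeasureTheory ProbabilityTheory Filter
open scoped unitInterval

namespace FIID

/-! ## The `d`-regular tree -/

/-- The vertices of the `d`-regular tree: the elements of the free product of `d` groups of
order two. -/
abbrev Vert (d : ℕ) : Type := Monoid.CoprodI (fun _ : Fin d => Multiplicative (ZMod 2))

/-- The generator of the `i`-th factor of the free product. -/
def gen {d : ℕ} (i : Fin d) : Vert d :=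
  Monoid.CoprodI.of (M := fun _ : Fin d => Multiplicative (ZMod 2)) (i := i)
    (Multiplicative.ofAdd (1 : ZMod 2))

theorem gen_mul_gen {d : ℕ} (i : Fin d) : gen i * gen i = 1 := by
  unfold gen
  rw [← map_mul, ← ofAdd_add, show (1 : ZMod 2) + 1 = 0 by decide, ofAdd_zero, map_one]

theorem gen_mul_gen_mul {d : ℕ} (i : Fin d) (g : Vert d) : gen i * (gen i * g) = g := by
  rw [← mul_assoc, gen_mul_gen, one_mul]

theorem gen_ne_one {d : ℕ} (i : Fin d) : gen i ≠ 1 := by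
  intro h
  have h2 := Monoid.CoprodI.of_injective (M := fun _ : Fin d => Multiplicative (ZMod 2)) i
    (h.trans (map_one _).symm)
  exact absurd h2 (by decide)

/-- The `d`-regular tree, as the Cayley graph of the free product of `d` groups of order two with
respect to the `d` generators. See `tree_isTree` and `tree_degree`. -/
def tree (d : ℕ) : SimpleGraph (Vert d) where
  Adj g h := ∃ i : Fin d, h = gen i * g
  symm := ⟨by
    rintro g h ⟨i, rfl⟩
    exact ⟨i, (gen_mul_gen_mul i g).symm⟩⟩
  loopless := ⟨by
    rintro g ⟨i, h⟩
    exact gen_ne_one i (mul_eq_right.mp h.symm)⟩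

/-- The root of the `d`-regular tree. -/
def root (d : ℕ) : Vert d := 1

/-! The next facts show that `tree d` is a tree all of whose vertices have degree `d`. -/

/-- Lists without two equal consecutive entries. -/
abbrev Red (d : ℕ) : Type := {l : List (Fin d) // l.IsChain (· ≠ ·)}

/-- Multiplication of a reduced list by a letter on the left. -/
def letter {d : ℕ} (i : Fin d) : Red d → Red d
  | ⟨[], _⟩ => ⟨[i], by simp⟩
  | ⟨a :: l, h⟩ => if e : i = a then ⟨l, h.tail⟩ else ⟨i :: a :: l, by simp [e, h]⟩

theorem letter_letter {d : ℕ} (i : Fin d) (l : Red d) : letter i (letter i l) = l := by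
  obtain ⟨l, h⟩ := l
  match l, h with
  | [], _ => simp [letter]
  | [a], _ => by_cases e : i = a <;> simp [letter, e]
  | a :: b :: l, h =>
    have hab : a ≠ b := by simp at h; exact h.1
    by_cases e : i = a <;> simp [letter, e, hab]

/-- The letter `i` as a permutation of the reduced lists. -/
def letterPerm {d : ℕ} (i : Fin d) : Equiv.Perm (Red d) :=
  ⟨letter i, letter i, letter_letter i, letter_letter i⟩

theorem two_nsmul_letterPerm {d : ℕ} (i : Fin d) :
    zmultiplesHom (Additive (Equiv.Perm (Red d))) (Additive.ofMul (letterPerm i)) (2 : ℕ) = 0 := by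
  change ((2 : ℕ) : ℤ) • Additive.ofMul (letterPerm i) = 0
  rw [natCast_zsmul, two_nsmul]
  exact Equiv.ext (letter_letter i)

/-- The action of the free product on reduced lists. -/
noncomputable def act (d : ℕ) : Vert d →* Equiv.Perm (Red d) :=
  Monoid.CoprodI.lift fun i => AddMonoidHom.toMultiplicativeLeft
    (ZMod.lift 2 ⟨zmultiplesHom _ (Additive.ofMul (letterPerm i)), two_nsmul_letterPerm i⟩)

theorem act_gen {d : ℕ} (i : Fin d) : act d (gen i) = letterPerm i := by
  have := ZMod.lift_coe 2 (⟨zmultiplesHom _ (Additive.ofMul (letterPerm i)), two_nsmul_letterPerm i⟩ :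
        { f : ℤ →+ Additive (Equiv.Perm (Red d)) // f (2 : ℕ) = 0 }) 1
  simp at this
  simp [act, gen, this]

/-- The reduced list that represents a vertex. -/
noncomputable def word {d : ℕ} (g : Vert d) : Red d := act d g ⟨[], by simp⟩

theorem word_gen_mul {d : ℕ} (i : Fin d) (g : Vert d) :
    word (gen i * g) = letter i (word g) := by
  simp [word, act_gen, letterPerm]

theorem letter_length {d : ℕ} (i : Fin d) (l : Red d) :
    (letter i l).1.length = l.1.length + 1 ∨
      (l.1.head? = some i ∧ (letter i l).1.length + 1 = l.1.length) := by
  obtain ⟨l, h⟩ := l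
  match l, h with
  | [], _ => simp [letter]
  | a :: l, h => by_cases e : i = a <;> simp [letter, e]

theorem gen_injective {d : ℕ} : Function.Injective (gen (d := d)) := by
  intro i j h
  have h2 : word (gen i * 1) = word (gen j * 1) := by rw [h]
  rw [word_gen_mul, word_gen_mul] at h2
  simpa [word, letter] using h2

theorem tree_degree {d : ℕ} (g : Vert d) : ((tree d).neighborSet g).ncard = d := by
  have h : (tree d).neighborSet g = Set.range (fun i : Fin d => gen i * g) := by
    ext h
    simp [tree, SimpleGraph.mem_neighborSet, eq_comm]
  rw [h, Set.ncard_range_of_injective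
    (fun i j hij => gen_injective (mul_right_cancel hij))]
  simp

theorem tree_connected (d : ℕ) : (tree d).Connected := by
  have key : ∀ g : Vert d, (tree d).Reachable 1 g := by
    intro g
    induction g using Monoid.CoprodI.induction_left with
    | one => exact SimpleGraph.Reachable.refl _
    | mul m g ih =>
      rename_i i
      rcases (show ∀ m : Multiplicative (ZMod 2), m = 1 ∨ m = Multiplicative.ofAdd 1 by decide) m
        with rfl | rfl
      · simpa using ih
      · exact ih.trans (SimpleGraph.Adj.reachable ⟨i, rfl⟩)
  exact { preconnected := fun g h => (key g).symm.trans (key h), nonempty := ⟨1⟩ }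

theorem tree_acyclic (d : ℕ) : (tree d).IsAcyclic := by
  classical
  intro v p hp
  obtain ⟨m, hm, hmax⟩ := p.support.toFinset.exists_max_image
    (fun g => (word g).1.length) ⟨v, by simp⟩
  rw [List.mem_toFinset] at hm
  have hq := hp.rotate hm
  set q := p.rotate m hm with hqdef
  have hnil : ¬ q.Nil := hq.not_nil
  have hmem : ∀ g ∈ q.support, (word g).1.length ≤ (word m).1.length := by
    intro g hg
    refine hmax g ?_
    rw [List.mem_toFinset]
    exact (SimpleGraph.Walk.mem_support_rotate_iff p m hm).mp hg
  obtain ⟨i, hi⟩ := q.adj_snd hnil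
  obtain ⟨j, hj⟩ := (q.adj_penultimate hnil).symm
  have h1 := hmem _ (q.getVert_mem_support 1)
  have h2 := hmem _ (q.getVert_mem_support (q.length - 1))
  change (word q.snd).1.length ≤ _ at h1
  change (word q.penultimate).1.length ≤ _ at h2
  rw [hi, word_gen_mul] at h1
  rw [hj, word_gen_mul] at h2
  have e1 : (word m).1.head? = some i := by
    rcases letter_length i (word m) with h | h
    · omega
    · exact h.1
  have e2 : (word m).1.head? = some j := by
    rcases letter_length j (word m) with h | h
    · omega
    · exact h.1
  have hij : i = j := Option.some.inj (e1.symm.trans e2)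
  exact hq.snd_ne_penultimate (by rw [hi, hj, hij])

theorem tree_isTree (d : ℕ) : (tree d).IsTree := ⟨tree_connected d, tree_acyclic d⟩

/-! ## Factors of iid processes -/

/-- The action of an automorphism on labellings: `(γ · ω)(v) = ω (γ⁻¹ v)`. -/
def relabel {d : ℕ} (γ : tree d ≃g tree d) (ω : Vert d → I) : Vert d → I :=
  fun v => ω (γ.symm v)

/-- A factor: a measurable function of the labelling (for the product Borel σ-algebra) which is
invariant under all automorphisms of the tree that fix the root. -/
structure IsFactor {d : ℕ} {χ : Type*} [MeasurableSpace χ] (f : (Vert d → I) → χ) : Prop where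
  measurable : Measurable f
  invariant : ∀ γ : tree d ≃g tree d, γ (root d) = root d → ∀ ω, f (relabel γ ω) = f ω

/-- An automorphism of the tree that moves the vertex `v` to the root: right translation
by `v⁻¹`. -/
def toRoot {d : ℕ} (v : Vert d) : tree d ≃g tree d where
  toEquiv := Equiv.mulRight v⁻¹
  map_rel_iff' := by
    intro g h
    simp [tree, ← mul_assoc]

theorem toRoot_self {d : ℕ} (v : Vert d) : toRoot v v = root d :=
  mul_inv_cancel v

/-- The value of a factor at `v` does not depend on the automorphism that moves `v` to the
root. -/
theorem IsFactor.apply_relabel {d : ℕ} {χ : Type*} [MeasurableSpace χ] {f : (Vert d → I) → χ}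
    (hf : IsFactor f) (v : Vert d) (γ : tree d ≃g tree d) (hγ : γ v = root d) (ω : Vert d → I) :
    f (relabel γ ω) = f (relabel (toRoot v) ω) := by
  have h1 : (toRoot v).symm (root d) = v := by
    rw [← toRoot_self v]; exact (toRoot v).symm_apply_apply v
  have h := hf.invariant ((toRoot v).symm.trans γ) (by simp [h1, hγ]) (relabel (toRoot v) ω)
  rw [← h]
  congr 1
  funext w
  simp [relabel]

/-- A random labelling of the tree: independent labels, each uniform on `[0,1]`. -/
structure IsRandomLabelling {d : ℕ} {Ω : Type*} [MeasurableSpace Ω] (P : Measure Ω)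
    (X : Vert d → Ω → I) : Prop where
  measurable : ∀ v, Measurable (X v)
  indep : iIndepFun X P
  uniform : ∀ v, P.map (X v) = (volume : Measure I)

/-- `Φ` is a factor of iid process on the `d`-regular tree with values in `χ`: for some factor `f`
and some random labelling `X`, `Φ(v) = f (γ · X)` where `γ` moves `v` to the root. -/
def IsFIID {d : ℕ} {χ : Type*} [MeasurableSpace χ] {Ω : Type*} [MeasurableSpace Ω]
    (P : Measure Ω) (Φ : Vert d → Ω → χ) : Prop :=
  ∃ (f : (Vert d → I) → χ) (X : Vert d → Ω → I), IsFactor f ∧ IsRandomLabelling P X ∧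
    ∀ v ω, Φ v ω = f (relabel (toRoot v) (fun u => X u ω))

/-- The density of a percolation process: the probability that the root is open. -/
noncomputable def density {d : ℕ} {Ω : Type*} [MeasurableSpace Ω] (P : Measure Ω)
    (Y : Vert d → Ω → Fin 2) : ℝ :=
  P.real {ω | Y (root d) ω = 1}

/-- Almost surely, all connected components of the subgraph of the tree induced by the open
vertices are finite. -/
def HasFiniteClusters {d : ℕ} {Ω : Type*} [MeasurableSpace Ω] (P : Measure Ω)
    (Y : Vert d → Ω → Fin 2) : Prop :=
  ∀ᵐ ω ∂P, ∀ C : ((tree d).induce {v | Y v ω = 1}).ConnectedComponent, C.supp.Finite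

end FIID

set_option linter.unusedSectionVars false

/-! Write `x` for the density. A finite cluster in a tree is a finite tree, so its average degree is
at most two, and mass transport (`tsum_clusterProb_mul_degIn`) turns this into a statement about the
root: the probabilities that the root and a given neighbour are both open add up to at most `2 * x`
(`sum_neighbors_le`). Nothing else is used about finite clusters. With 3 in place of 2 the bound
survives approximation by a cylinder event (`neighbors_bound`), so the process may be taken of
finite range.

A finite-range process can be run on a large `d`-regular graph that looks like a tree around most
vertices. The model is a union of `d` independent uniform perfect matchings of `2 * n` points. At
least half of the models have boundedly many exceptional vertices, and on these a second moment
argument yields a colouring with nearly the right frequencies and nearly the right number of bad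
edges (`exists_typical`). Hence the expected number of such colourings cannot tend to zero. It is at
most the number of colourings with these frequencies times the probability that a fixed one has so
few bad edges; comparing exponents gives `entropy_bound`. Applied to the process itself it sets an
entropy `x * log d` against `d * x ^ 2 / 2`, which yields only `2 * log d / d`.

The factor two is removed by colouring with `K + 1` correlated copies at once: each label is shared
by all copies with probability `p` and is private otherwise. An edge is bad if its ends are open in
a common copy. If some copy is open at the root with probability `m * x`, the entropy is about `m *
x * log d`, while two independent patterns meet with probability at least `(2 * m - 1 - (m - 1) ^ 2
/ K) * x ^ 2` (`pairMass_coins_ge`). The parameter `p` is found by the intermediate value theorem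
(`coupled_bound`). Large `m` with `K ≥ m ^ 2` gives `x ≤ (1 + ε) * log d / d` (`finiteRange_bound`).
-/

namespace FIID

/-! ## Random permutation models of the tree -/

section Model

variable {d : ℕ} {V : Type*}

/-- The conjugate of the involution `τ` by `t`. -/
def conjInv (τ t : Equiv.Perm V) : Equiv.Perm V := t * τ * t⁻¹

theorem conjInv_apply (τ t : Equiv.Perm V) (x : V) : conjInv τ t x = t (τ (t⁻¹ x)) := rfl

theorem conjInv_conjInv {τ : Equiv.Perm V} (hτ : ∀ x, τ (τ x) = x) (t : Equiv.Perm V) (x : V) :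
    conjInv τ t (conjInv τ t x) = x := by
  simp [conjInv_apply, hτ]

theorem conjInv_ne {τ : Equiv.Perm V} (hτ : ∀ x, τ x ≠ x) (t : Equiv.Perm V) (x : V) :
    conjInv τ t x ≠ x := by
  intro h
  apply hτ (t⁻¹ x)
  rw [conjInv_apply] at h
  rw [Equiv.Perm.eq_inv_iff_eq, h]

/-- The endpoint of the walk from `x` with the steps in `l`, the last entry being the first
step. -/
def walkEnd (τ : Equiv.Perm V) (s : Fin d → Equiv.Perm V) (x : V) : List (Fin d) → V
  | [] => x
  | i :: l => conjInv τ (s i) (walkEnd τ s x l)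

/-- The vertices visited by the walk from `x` with steps in `l`, the endpoint first. -/
def visits (τ : Equiv.Perm V) (s : Fin d → Equiv.Perm V) (x : V) : List (Fin d) → List V
  | [] => [x]
  | i :: l => walkEnd τ s x (i :: l) :: visits τ s x l

theorem visits_eq_cons (τ : Equiv.Perm V) (s : Fin d → Equiv.Perm V) (x : V) (l : List (Fin d)) :
    ∃ t, visits τ s x l = walkEnd τ s x l :: t := by
  cases l <;> exact ⟨_, rfl⟩

theorem walkEnd_mem_visits (τ : Equiv.Perm V) (s : Fin d → Equiv.Perm V) (x : V)
    (l : List (Fin d)) : walkEnd τ s x l ∈ visits τ s x l := by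
  obtain ⟨t, ht⟩ := visits_eq_cons τ s x l
  simp [ht]

theorem start_mem_visits (τ : Equiv.Perm V) (s : Fin d → Equiv.Perm V) (x : V)
    (l : List (Fin d)) : x ∈ visits τ s x l := by
  induction l with
  | nil => simp [visits]
  | cons i l ih => simp [visits, ih]

theorem length_visits (τ : Equiv.Perm V) (s : Fin d → Equiv.Perm V) (x : V) (l : List (Fin d)) :
    (visits τ s x l).length = l.length + 1 := by
  induction l with
  | nil => rfl
  | cons i l ih => simp [visits, ih]

theorem visits_suffix (τ : Equiv.Perm V) (s : Fin d → Equiv.Perm V) (x : V) {l l' : List (Fin d)}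
    (h : l' <:+ l) : visits τ s x l' <:+ visits τ s x l := by
  induction l with
  | nil => rw [List.suffix_nil.mp h]
  | cons i l ih =>
    rcases List.suffix_cons_iff.mp h with rfl | h
    · exact List.suffix_rfl
    · exact (ih h).trans (List.suffix_cons _ _)

theorem walkEnd_notMem_of_suffix {τ : Equiv.Perm V} {s : Fin d → Equiv.Perm V} {x : V}
    {l l' : List (Fin d)} (hn : (visits τ s x l).Nodup) (h : l' <:+ l) (hne : l' ≠ l) :
    walkEnd τ s x l ∉ visits τ s x l' := by
  cases l with
  | nil => exact absurd (List.suffix_nil.mp h) hne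
  | cons i l =>
    rcases List.suffix_cons_iff.mp h with h | h
    · exact absurd h hne
    · intro hm
      exact (List.nodup_cons.mp hn).1 ((visits_suffix τ s x h).subset hm)

theorem visits_congr {τ : Equiv.Perm V} {s s' : Fin d → Equiv.Perm V} {x : V} {l : List (Fin d)}
    (h : ∀ j l', (j :: l') <:+ l →
      conjInv τ (s' j) (walkEnd τ s x l') = conjInv τ (s j) (walkEnd τ s x l')) :
    visits τ s' x l = visits τ s x l ∧ walkEnd τ s' x l = walkEnd τ s x l := by
  induction l with
  | nil => exact ⟨rfl, rfl⟩
  | cons i l ih =>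
    obtain ⟨h1, h2⟩ := ih fun j l' hs => h j l' (hs.trans (List.suffix_cons _ _))
    have h3 : walkEnd τ s' x (i :: l) = walkEnd τ s x (i :: l) := by
      simp only [walkEnd, h2]
      exact h i l List.suffix_rfl
    exact ⟨by simp only [visits, h1, h3], h3⟩

variable [DecidableEq V]

theorem conjInv_swap_mul (τ t : Equiv.Perm V) (a b x : V) :
    conjInv τ (Equiv.swap a b * t) x =
      Equiv.swap a b (conjInv τ t (Equiv.swap a b x)) := by
  simp [conjInv_apply]

/-- Redirecting the last step of a self-avoiding walk from an already visited vertex `w` to a fresh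
vertex `w'` does not change the earlier part of the walk. -/
theorem visits_update_swap {τ : Equiv.Perm V} (h2 : ∀ x, τ (τ x) = x) (h1 : ∀ x, τ x ≠ x)
    {s : Fin d → Equiv.Perm V} {x : V} {i : Fin d} {l : List (Fin d)}
    (hl : (i :: l).IsChain (· ≠ ·)) (hn : (visits τ s x l).Nodup) {w' : V}
    (hw' : w' ∉ visits τ s x l) :
    let s' := Function.update s i (Equiv.swap (walkEnd τ s x (i :: l)) w' * s i)
    visits τ s' x l = visits τ s x l ∧ walkEnd τ s' x (i :: l) = w' := by
  intro s'
  set w := walkEnd τ s x (i :: l) with hw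
  set e := walkEnd τ s x l with he
  have hwe : conjInv τ (s i) e = w := rfl
  have hew : conjInv τ (s i) w = e := by rw [← hwe, conjInv_conjInv h2]
  have key : visits τ s' x l = visits τ s x l ∧ walkEnd τ s' x l = walkEnd τ s x l := by
    -- Only earlier steps with the letter `i` can change, and the swap moves only `w` and `w'`. So
    -- it suffices that no such step starts or ends at either of them.
    refine visits_congr fun j l' hs => ?_
    by_cases hj : j = i
    swap
    · simp [s', Function.update_of_ne hj]
    subst hj
    have hs' : l' <:+ l := (List.suffix_cons _ _).trans hs
    have hne' : l' ≠ l := by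
      rintro rfl
      have := hs.length_le
      simp at this
    set y := walkEnd τ s x l' with hy
    have hym : y ∈ visits τ s x l' := walkEnd_mem_visits ..
    have hy'm : conjInv τ (s j) y ∈ visits τ s x (j :: l') := walkEnd_mem_visits τ s x (j :: l')
    have hye : y ≠ e := fun h =>
      walkEnd_notMem_of_suffix hn hs' hne' (by rw [← he, ← h]; exact hym)
    have hy'w : conjInv τ (s j) y ≠ w := fun h => hye ((conjInv τ (s j)).injective (h.trans hwe.symm))
    have hyw : y ≠ w := by
      intro h
      have h3 : conjInv τ (s j) y = e := by rw [h, hew]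
      -- From `w` the same letter leads back to `e`. So the walk would reach `e` too early, or its
      -- last step would repeat the letter, against reducedness.
      by_cases hq : j :: l' = l
      · rw [← hq] at hl
        simp at hl
      · exact walkEnd_notMem_of_suffix hn hs hq (by rw [← he, ← h3]; exact hy'm)
    have hyw' : y ≠ w' := fun h => hw' (h ▸ (visits_suffix τ s x hs').subset hym)
    have hy'w' : conjInv τ (s j) y ≠ w' := fun h =>
      hw' (h ▸ (visits_suffix τ s x hs).subset hy'm)
    simp only [s', Function.update_self]
    rw [conjInv_swap_mul, Equiv.swap_apply_of_ne_of_ne hyw hyw',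
      Equiv.swap_apply_of_ne_of_ne hy'w hy'w']
  refine ⟨key.1, ?_⟩
  have hne : e ≠ w := fun h => conjInv_ne h1 (s i) e (hwe.trans h.symm)
  have hnw' : e ≠ w' := fun h => hw' (h ▸ walkEnd_mem_visits τ s x l)
  change conjInv τ (s' i) (walkEnd τ s' x l) = w'
  rw [key.2, show s' i = Equiv.swap w w' * s i from Function.update_self .., conjInv_swap_mul, ← he,
    Equiv.swap_apply_of_ne_of_ne hne hnw', hwe, Equiv.swap_apply_left]

variable [Fintype V]

/-- Double counting by switching: redirect the returning step to a fresh vertex. The new walk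
displays that vertex, and the position of the old endpoint among the visited vertices recovers the
old model, so the switching is injective. -/
theorem card_return_mul_le {τ : Equiv.Perm V} (h2 : ∀ x, τ (τ x) = x) (h1 : ∀ x, τ x ≠ x)
    (x : V) {i : Fin d} {l : List (Fin d)} (hl : (i :: l).IsChain (· ≠ ·)) :
    {s : Fin d → Equiv.Perm V | (visits τ s x l).Nodup ∧
      walkEnd τ s x (i :: l) ∈ visits τ s x l}.ncard * (Fintype.card V - (l.length + 1)) ≤
      (l.length + 1) * Fintype.card (Fin d → Equiv.Perm V) := by
  classical
  set E : Finset (Fin d → Equiv.Perm V) := Finset.univ.filter fun s =>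
    (visits τ s x l).Nodup ∧ walkEnd τ s x (i :: l) ∈ visits τ s x l with hE
  have hEc : {s : Fin d → Equiv.Perm V | (visits τ s x l).Nodup ∧
      walkEnd τ s x (i :: l) ∈ visits τ s x l}.ncard = E.card := by
    rw [← Set.ncard_coe_finset]; congr 1; ext; simp [hE]
  rw [hEc]
  let fresh : (Fin d → Equiv.Perm V) → Finset V := fun s => (visits τ s x l).toFinsetᶜ
  let D : Finset (Σ _ : Fin d → Equiv.Perm V, V) := E.sigma fresh
  have hD : E.card * (Fintype.card V - (l.length + 1)) ≤ D.card := by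
    rw [Finset.card_sigma, ← smul_eq_mul]
    refine Finset.card_nsmul_le_sum _ _ _ fun s hs => ?_
    have hs' := (Finset.mem_filter.mp hs).2
    rw [Finset.card_compl, List.toFinset_card_of_nodup hs'.1, length_visits]
  refine hD.trans ?_
  let T : Finset (ℕ × (Fin d → Equiv.Perm V)) := Finset.range (l.length + 1) ×ˢ Finset.univ
  have hT : T.card = (l.length + 1) * Fintype.card (Fin d → Equiv.Perm V) := by
    simp only [T, Finset.card_product, Finset.card_range, Finset.card_univ]
  rw [← hT]
  let φ : (Σ _ : Fin d → Equiv.Perm V, V) → ℕ × (Fin d → Equiv.Perm V) := fun p =>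
    ((visits τ p.1 x l).idxOf (walkEnd τ p.1 x (i :: l)),
      Function.update p.1 i (Equiv.swap (walkEnd τ p.1 x (i :: l)) p.2 * p.1 i))
  have hmem : ∀ p ∈ D, (visits τ p.1 x l).Nodup ∧
      walkEnd τ p.1 x (i :: l) ∈ visits τ p.1 x l ∧ p.2 ∉ visits τ p.1 x l := by
    intro p hp
    obtain ⟨hp1, hp2⟩ := Finset.mem_sigma.mp hp
    have := (Finset.mem_filter.mp hp1).2
    simp only [fresh, Finset.mem_compl, List.mem_toFinset] at hp2
    exact ⟨this.1, this.2, hp2⟩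
  refine Finset.card_le_card_of_injOn φ (fun p hp => ?_) (fun p hp q hq hpq => ?_)
  · obtain ⟨-, hp2, -⟩ := hmem p hp
    simp only [T, Finset.coe_product, Set.mem_prod, φ, Finset.coe_range, Set.mem_Iio,
      Finset.coe_univ, Set.mem_univ, and_true]
    have := List.idxOf_lt_length_iff.mpr hp2
    rwa [length_visits] at this
  · obtain ⟨hp1, hp2, hp3⟩ := hmem p hp
    obtain ⟨hq1, hq2, hq3⟩ := hmem q hq
    obtain ⟨p1, p2⟩ := visits_update_swap h2 h1 hl hp1 hp3
    obtain ⟨q1, q2⟩ := visits_update_swap h2 h1 hl hq1 hq3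
    obtain ⟨e1, e2⟩ := Prod.ext_iff.mp hpq
    simp only [φ] at e1 e2
    rw [e2] at p1 p2
    have hv : visits τ p.1 x l = visits τ q.1 x l := p1.symm.trans q1
    have hw : p.2 = q.2 := p2.symm.trans q2
    have hww : walkEnd τ p.1 x (i :: l) = walkEnd τ q.1 x (i :: l) := by
      rw [hv] at e1 hp2
      exact (List.idxOf_inj hp2).mp e1
    rw [hww, hw] at e2
    have hs : p.1 = q.1 := by
      funext j
      by_cases hj : j = i
      · subst hj
        have := congrFun e2 j
        simpa using this
      · have := congrFun e2 j
        simpa [Function.update_of_ne hj] using this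
    exact Sigma.ext hs (heq_of_eq hw)

/-- Split according to the step of the first return; the bounds of `card_return_mul_le` for the
single steps add up to at most the square of the length. -/
theorem card_not_nodup_mul_le {τ : Equiv.Perm V} (h2 : ∀ x, τ (τ x) = x) (h1 : ∀ x, τ x ≠ x)
    (x : V) {l : List (Fin d)} (hl : l.IsChain (· ≠ ·)) :
    {s : Fin d → Equiv.Perm V | ¬ (visits τ s x l).Nodup}.ncard *
      (Fintype.card V - l.length) ≤ l.length ^ 2 * Fintype.card (Fin d → Equiv.Perm V) := by
  induction l with
  | nil => simp [visits]
  | cons i l ih =>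
    have ih := ih hl.tail
    have hr := card_return_mul_le h2 h1 x hl
    set A := {s : Fin d → Equiv.Perm V | ¬ (visits τ s x (i :: l)).Nodup}
    set B := {s : Fin d → Equiv.Perm V | ¬ (visits τ s x l).Nodup}
    set E := {s : Fin d → Equiv.Perm V | (visits τ s x l).Nodup ∧
      walkEnd τ s x (i :: l) ∈ visits τ s x l}
    have hAB : A ⊆ B ∪ E := by
      intro s hs
      by_cases hb : (visits τ s x l).Nodup
      · refine Or.inr ⟨hb, ?_⟩
        by_contra hc
        exact hs (List.nodup_cons.mpr ⟨hc, hb⟩)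
      · exact Or.inl hb
    have hA : A.ncard ≤ B.ncard + E.ncard :=
      (Set.ncard_le_ncard hAB (Set.toFinite _)).trans (Set.ncard_union_le _ _)
    simp only [List.length_cons]
    set M := Fintype.card (Fin d → Equiv.Perm V)
    calc A.ncard * (Fintype.card V - (l.length + 1))
        ≤ (B.ncard + E.ncard) * (Fintype.card V - (l.length + 1)) := Nat.mul_le_mul_right _ hA
      _ = B.ncard * (Fintype.card V - (l.length + 1)) +
          E.ncard * (Fintype.card V - (l.length + 1)) := add_mul ..
      _ ≤ l.length ^ 2 * M + (l.length + 1) * M := by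
          refine add_le_add (le_trans (Nat.mul_le_mul_left _ (by omega)) ih) hr
      _ ≤ (l.length + 1) ^ 2 * M := by nlinarith

end Model

/-! ## The action of the free product -/

section Action

variable {d : ℕ} {V : Type*}

theorem two_nsmul_conjInv {τ : Equiv.Perm V} (h2 : ∀ x, τ (τ x) = x) (t : Equiv.Perm V) :
    zmultiplesHom (Additive (Equiv.Perm V)) (Additive.ofMul (conjInv τ t)) (2 : ℕ) = 0 := by
  change ((2 : ℕ) : ℤ) • Additive.ofMul (conjInv τ t) = 0
  rw [natCast_zsmul, two_nsmul]
  exact Equiv.ext (conjInv_conjInv h2 t)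

/-- The action of the free product on `V` in which the `i`-th generator acts as the conjugate of
the involution `τ` by `s i`. -/
noncomputable def modelAct {τ : Equiv.Perm V} (h2 : ∀ x, τ (τ x) = x) (s : Fin d → Equiv.Perm V) :
    Vert d →* Equiv.Perm V :=
  Monoid.CoprodI.lift fun i => AddMonoidHom.toMultiplicativeLeft
    (ZMod.lift 2 ⟨zmultiplesHom _ (Additive.ofMul (conjInv τ (s i))), two_nsmul_conjInv h2 (s i)⟩)

theorem modelAct_gen {τ : Equiv.Perm V} (h2 : ∀ x, τ (τ x) = x) (s : Fin d → Equiv.Perm V)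
    (i : Fin d) : modelAct h2 s (gen i) = conjInv τ (s i) := by
  have := ZMod.lift_coe 2 (⟨zmultiplesHom _ (Additive.ofMul (conjInv τ (s i))),
    two_nsmul_conjInv h2 (s i)⟩ : { f : ℤ →+ Additive (Equiv.Perm V) // f (2 : ℕ) = 0 }) 1
  simp at this
  simp [modelAct, gen, this]

theorem modelAct_prod {τ : Equiv.Perm V} (h2 : ∀ x, τ (τ x) = x) (s : Fin d → Equiv.Perm V)
    (l : List (Fin d)) (x : V) : modelAct h2 s (l.map gen).prod x = walkEnd τ s x l := by
  induction l with
  | nil => simp [walkEnd]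
  | cons i l ih => simp [walkEnd, modelAct_gen, ih]

theorem prod_letter (i : Fin d) (l : Red d) :
    ((letter i l).1.map gen).prod = gen i * (l.1.map gen).prod := by
  obtain ⟨l, h⟩ := l
  match l, h with
  | [], _ => simp [letter]
  | a :: l, h =>
    by_cases e : i = a
    · subst e
      simp [letter, gen_mul_gen_mul]
    · simp [letter, e]

theorem vert_induction {p : Vert d → Prop} (h1 : p 1) (hg : ∀ i g, p g → p (gen i * g))
    (g : Vert d) : p g := by
  induction g using Monoid.CoprodI.induction_left with
  | one => exact h1
  | mul m g ih =>
    rename_i i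
    rcases (show ∀ m : Multiplicative (ZMod 2), m = 1 ∨ m = Multiplicative.ofAdd 1 by decide) m
      with rfl | rfl
    · simpa using ih
    · exact hg i g ih

theorem prod_word (g : Vert d) : ((word g).1.map gen).prod = g := by
  induction g using vert_induction with
  | h1 => simp [word]
  | hg i g ih => rw [word_gen_mul, prod_letter, ih]

theorem word_ne_nil {g : Vert d} (hg : g ≠ 1) : (word g).1 ≠ [] := by
  intro h
  have := prod_word g
  rw [h] at this
  exact hg (by simpa using this.symm)

variable [DecidableEq V] [Fintype V]

/-- In the random permutation model, a nontrivial element has few fixed points. -/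
theorem card_fixed_mul_le {τ : Equiv.Perm V} (h2 : ∀ x, τ (τ x) = x) (h1 : ∀ x, τ x ≠ x)
    (x : V) {g : Vert d} (hg : g ≠ 1) :
    {s : Fin d → Equiv.Perm V | modelAct h2 s g x = x}.ncard *
      (Fintype.card V - (word g).1.length) ≤
      (word g).1.length ^ 2 * Fintype.card (Fin d → Equiv.Perm V) := by
  refine le_trans (Nat.mul_le_mul_right _ (Set.ncard_le_ncard ?_ (Set.toFinite _)))
    (card_not_nodup_mul_le h2 h1 x (word g).2)
  intro s hs
  have hs : modelAct h2 s g x = x := hs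
  obtain ⟨i, l, hl⟩ := List.exists_cons_of_ne_nil (word_ne_nil hg)
  rw [← prod_word g, modelAct_prod] at hs
  change ¬ (visits τ s x (word g).1).Nodup
  rw [hl] at hs ⊢
  -- The walk spelled by a nontrivial word is nonempty and would end at its start, which it has
  -- already visited.
  intro hn
  apply (List.nodup_cons.mp hn).1
  rw [hs]
  exact start_mem_visits τ s x l

end Action

/-! ## Exponential moments in the random permutation model -/

/-! ### Stirling bounds up to a polynomial factor. -/

section Factorial

open Nat in
theorem pow_div_exp_le_factorial (n : ℕ) : (n : ℝ) ^ n * Real.exp (-n) ≤ (n ! : ℝ) := by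
  have h := Real.pow_div_factorial_le_exp (n : ℝ) (by positivity) n
  rw [div_le_iff₀ (by positivity)] at h
  rw [Real.exp_neg, ← div_eq_mul_inv, div_le_iff₀ (Real.exp_pos _)]
  linarith

-- Induction with `(n / (n + 1)) ^ (n + 1) ≤ exp (-1)`. The factor `n + 1` instead of `n` only
-- serves to include `n = 0`.
open Nat in
theorem factorial_le_mul_pow (n : ℕ) :
    (n ! : ℝ) ≤ Real.exp 1 * (n + 1) * ((n : ℝ) ^ n * Real.exp (-n)) := by
  suffices h : ∀ n : ℕ, 1 ≤ n → (n ! : ℝ) ≤ Real.exp 1 * n * ((n : ℝ) ^ n * Real.exp (-n)) by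
    rcases Nat.eq_zero_or_pos n with rfl | hn
    · simp
    · refine (h n hn).trans ?_
      gcongr
      linarith
  intro n hn
  induction n, hn using Nat.le_induction with
  | base => simp [← Real.exp_add]
  | succ n hn ih =>
    have hn0 : (0 : ℝ) < n := by exact_mod_cast hn
    have h1 : ((n : ℝ) / (n + 1)) ^ (n + 1) ≤ Real.exp (-1) := by
      have h2 : (n : ℝ) / (n + 1) ≤ Real.exp (-(1 / (n + 1))) := by
        have := Real.add_one_le_exp (-(1 / ((n : ℝ) + 1)))
        refine le_trans (le_of_eq ?_) this
        field_simp
        ring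
      calc ((n : ℝ) / (n + 1)) ^ (n + 1) ≤ (Real.exp (-(1 / (n + 1)))) ^ (n + 1) := by gcongr
        _ = Real.exp (-1) := by
          rw [← Real.exp_nat_mul]
          congr 1
          push_cast
          field_simp
    have h3 : (n : ℝ) ^ (n + 1) ≤ Real.exp (-1) * (n + 1) ^ (n + 1) := by
      rwa [div_pow, div_le_iff₀ (by positivity)] at h1
    rw [Nat.factorial_succ]
    push_cast
    calc ((n : ℝ) + 1) * n ! ≤ (n + 1) * (Real.exp 1 * n * ((n : ℝ) ^ n * Real.exp (-n))) := by
          gcongr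
      _ = Real.exp 1 * (n + 1) * Real.exp (-n) * (n : ℝ) ^ (n + 1) := by ring
      _ ≤ Real.exp 1 * (n + 1) * Real.exp (-n) * (Real.exp (-1) * (n + 1) ^ (n + 1)) := by gcongr
      _ = Real.exp 1 * (n + 1) * ((n + 1) ^ (n + 1) * Real.exp (-(n + 1))) := by
          rw [neg_add, Real.exp_add]; ring

end Factorial

/-! ### Rearrangements and counts of colourings. -/

section Types

variable {V A : Type*} [Fintype V] [DecidableEq V] [Fintype A] [DecidableEq A]

/-- The proportion of the vertices of type `a`. -/
noncomputable def freq (y : V → A) (a : A) : ℝ :=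
  ((Finset.univ.filter fun x => y x = a).card : ℝ) / Fintype.card V

theorem freq_nonneg (y : V → A) (a : A) : 0 ≤ freq y a := by
  unfold freq; positivity

theorem sum_card_fiber (y : V → A) :
    ∑ a, (Finset.univ.filter fun x => y x = a).card = Fintype.card V := by
  rw [← Finset.card_univ]
  exact (Finset.card_eq_sum_card_fiberwise fun x _ => Finset.mem_univ (y x)).symm

theorem sum_freq [Nonempty V] (y : V → A) : ∑ a, freq y a = 1 := by
  unfold freq
  rw [← Finset.sum_div, ← Nat.cast_sum, sum_card_fiber, div_self]
  exact_mod_cast Fintype.card_ne_zero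

-- The entropy form of the multinomial coefficient: by Stirling each factorial `m !` is `m ^ m * exp
-- (-m)` up to a polynomial factor, and the exponentials combine to the one in the factorial of the
-- total.
open Nat in
theorem prod_factorial_le [Nonempty V] (y : V → A) :
    (∏ a, ((Finset.univ.filter fun x => y x = a).card ! : ℝ)) ≤
      (Fintype.card V)! * (Real.exp 1 * (Fintype.card V + 1)) ^ Fintype.card A *
        ∏ x, freq y (y x) := by
  set N := Fintype.card V with hN
  have hN0 : (0 : ℝ) < N := by exact_mod_cast Fintype.card_pos
  set m : A → ℕ := fun a => (Finset.univ.filter fun x => y x = a).card with hm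
  have hmN : ∀ a, m a ≤ N := fun a => Finset.card_le_univ _
  have hsum : ∑ a, m a = N := sum_card_fiber y
  have hprod : ∏ x, freq y (y x) = ∏ a, ((m a : ℝ) / N) ^ m a := by
    rw [← Finset.prod_fiberwise Finset.univ y]
    refine Finset.prod_congr rfl fun a _ => ?_
    rw [Finset.prod_congr rfl (g := fun _ => (m a : ℝ) / N), Finset.prod_const]
    intro x hx
    rw [(Finset.mem_filter.mp hx).2]
    rfl
  have hsplit : ∏ a, ((m a : ℝ) / N) ^ m a = (∏ a, (m a : ℝ) ^ m a) / (N : ℝ) ^ N := by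
    simp_rw [div_pow]
    rw [Finset.prod_div_distrib, Finset.prod_pow_eq_pow_sum, hsum]
  have hexp : ∏ a, Real.exp (-(m a : ℝ)) = Real.exp (-N) := by
    rw [← Real.exp_sum, Finset.sum_neg_distrib, ← Nat.cast_sum, hsum]
  calc (∏ a, ((m a)! : ℝ))
      ≤ ∏ a, (Real.exp 1 * (N + 1)) * ((m a : ℝ) ^ m a * Real.exp (-(m a : ℝ))) := by
        refine Finset.prod_le_prod (fun a _ => by positivity) fun a _ => ?_
        refine (factorial_le_mul_pow (m a)).trans ?_
        have : (m a : ℝ) ≤ N := by exact_mod_cast hmN a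
        gcongr
    _ = (Real.exp 1 * (N + 1)) ^ Fintype.card A * ((∏ a, (m a : ℝ) ^ m a) * Real.exp (-N)) := by
        rw [Finset.prod_mul_distrib, Finset.prod_const, Finset.card_univ, Finset.prod_mul_distrib,
          hexp]
    _ = ((N : ℝ) ^ N * Real.exp (-N)) * (Real.exp 1 * (N + 1)) ^ Fintype.card A *
          ∏ x, freq y (y x) := by
        rw [hprod, hsplit]
        field_simp
    _ ≤ _ := by
        have := pow_div_exp_le_factorial N
        have h0 : 0 ≤ ∏ x, freq y (y x) := Finset.prod_nonneg fun x _ => freq_nonneg _ _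
        gcongr

-- The permutations that carry `y` to a given rearrangement form a coset of the stabiliser of `y`,
-- whose order is the product of the factorials of the class sizes.
open Nat in
theorem card_comp_eq_le [Nonempty V] (y z : V → A) :
    (((Finset.univ : Finset (Equiv.Perm V)).filter fun s : Equiv.Perm V => y ∘ s = z).card : ℝ) ≤
      (Fintype.card V)! * (Real.exp 1 * (Fintype.card V + 1)) ^ Fintype.card A *
        ∏ x, freq y (z x) := by
  by_cases h : ∃ s0 : Equiv.Perm V, y ∘ s0 = z
  · obtain ⟨s0, rfl⟩ := h
    have h1 : ((Finset.univ : Finset (Equiv.Perm V)).filter fun s : Equiv.Perm V => y ∘ s = y ∘ s0).card =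
        Fintype.card {g : Equiv.Perm V // y ∘ g = y} := by
      rw [Fintype.card_subtype]
      refine Finset.card_bij (fun s _ => s * s0⁻¹) ?_ ?_ ?_
      · intro s hs
        simp only [Finset.mem_filter, Finset.mem_univ, true_and] at hs ⊢
        funext x
        have := congrFun hs (s0⁻¹ x)
        simpa using this
      · intro s _ s' _ h
        exact mul_right_cancel h
      · intro g hg
        simp only [Finset.mem_filter, Finset.mem_univ, true_and] at hg
        refine ⟨g * s0, ?_, by simp⟩
        simp only [Finset.mem_filter, Finset.mem_univ, true_and]
        funext x
        exact congrFun hg (s0 x)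
    rw [h1, DomMulAct.stabilizer_card, Nat.cast_prod]
    have h2 : ∏ x, freq y ((y ∘ s0) x) = ∏ x, freq y (y x) :=
      Equiv.prod_comp s0 fun x => freq y (y x)
    rw [h2]
    simp_rw [Fintype.card_subtype]
    exact prod_factorial_le y
  · have : ((Finset.univ : Finset (Equiv.Perm V)).filter fun s : Equiv.Perm V => y ∘ s = z) = ∅ := by
      rw [Finset.filter_eq_empty_iff]
      exact fun s _ hs => h ⟨s, hs⟩
    rw [this, Finset.card_empty, Nat.cast_zero]
    have h0 : 0 ≤ ∏ x, freq y (z x) := Finset.prod_nonneg fun x _ => freq_nonneg _ _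
    positivity

open Nat in
/-- A uniformly random rearrangement of `y` is dominated, up to a polynomial factor, by independent
entries. -/
theorem sum_perm_le [Nonempty V] (y : V → A) (F : (V → A) → ℝ) (hF : ∀ z, 0 ≤ F z) :
    ∑ s : Equiv.Perm V, F (y ∘ s) ≤
      (Fintype.card V)! * (Real.exp 1 * (Fintype.card V + 1)) ^ Fintype.card A *
        ∑ z : V → A, (∏ x, freq y (z x)) * F z := by
  rw [← Finset.sum_fiberwise Finset.univ (fun s : Equiv.Perm V => y ∘ s), Finset.mul_sum]
  refine Finset.sum_le_sum fun z _ => ?_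
  rw [Finset.sum_congr rfl (g := fun _ => F z), Finset.sum_const, nsmul_eq_mul, ← mul_assoc]
  · exact mul_le_mul_of_nonneg_right (card_comp_eq_le y z) (hF z)
  · intro s hs
    rw [(Finset.mem_filter.mp hs).2]

/-- A Chernoff bound: every entry other than `a₀` gets weight `exp (-L)`. For `L = log d` the first
term is the entropy and the second is of order `1 / d` per vertex. -/
theorem card_few_le (a₀ : A) {L : ℝ} (hL : 0 ≤ L) (r : ℝ) :
    (((Finset.univ : Finset (V → A)).filter fun y =>
        ((Finset.univ.filter fun x => y x ≠ a₀).card : ℝ) ≤ r).card : ℝ) ≤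
      Real.exp (L * r + Real.exp (-L) * Fintype.card A * Fintype.card V) := by
  have h1 : ∑ y : V → A, ∏ x, (if y x = a₀ then 1 else Real.exp (-L)) =
      ∏ _x : V, ∑ a : A, (if a = a₀ then 1 else Real.exp (-L)) := by
    rw [Finset.prod_univ_sum, Fintype.piFinset_univ]
  have h2 : ∑ a : A, (if a = a₀ then 1 else Real.exp (-L)) ≤
      Real.exp (Real.exp (-L) * Fintype.card A) := by
    calc ∑ a : A, (if a = a₀ then 1 else Real.exp (-L))
        ≤ ∑ a : A, ((if a = a₀ then 1 else 0) + Real.exp (-L)) := by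
          refine Finset.sum_le_sum fun a _ => ?_
          have := Real.exp_pos (-L)
          split_ifs <;> linarith
      _ = Real.exp (-L) * Fintype.card A + 1 := by
          rw [Finset.sum_add_distrib]
          simp [mul_comm, add_comm]
      _ ≤ _ := Real.add_one_le_exp _
  have h3 : ∑ y : V → A, ∏ x, (if y x = a₀ then 1 else Real.exp (-L)) ≤
      Real.exp (Real.exp (-L) * Fintype.card A * Fintype.card V) := by
    rw [h1, Finset.prod_const, Finset.card_univ, mul_comm _ (Fintype.card V : ℝ), Real.exp_nat_mul]
    refine pow_le_pow_left₀ (Finset.sum_nonneg fun a _ => ?_) h2 _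
    split_ifs <;> positivity
  rw [Real.exp_add, ← div_le_iff₀' (Real.exp_pos _), div_eq_mul_inv, ← Real.exp_neg]
  refine le_trans ?_ h3
  rw [← nsmul_eq_mul, ← Finset.sum_const]
  refine le_trans (Finset.sum_le_sum fun y hy => ?_) (Finset.sum_le_sum_of_subset_of_nonneg
    (Finset.filter_subset _ _) fun y _ _ => Finset.prod_nonneg fun x _ => by
      split_ifs <;> positivity)
  have hy := (Finset.mem_filter.mp hy).2
  rw [Finset.prod_ite, Finset.prod_const_one, one_mul, Finset.prod_const, ← Real.exp_nat_mul]
  refine Real.exp_le_exp.mpr ?_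
  nlinarith

end Types

/-! ### Bad edges in random perfect matchings. -/

section Matching

variable {A : Type*} [Fintype A] [DecidableEq A] {n : ℕ}

/-- The involution that exchanges the two ends of every pair. -/
def flip (n : ℕ) : Equiv.Perm (Fin n × Bool) :=
  ⟨fun x => (x.1, !x.2), fun x => (x.1, !x.2), fun x => by simp, fun x => by simp⟩

theorem flip_flip (x : Fin n × Bool) : flip n (flip n x) = x := (flip n).left_inv x

theorem flip_ne (x : Fin n × Bool) : flip n x ≠ x := by
  intro h
  have : (!x.2) = x.2 := congrArg Prod.snd h
  simp at this

theorem sum_prod_pairs (p : A → ℝ) (w : A → A → ℝ) :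
    ∑ z : Fin n × Bool → A, (∏ x, p (z x)) * ∏ j, w (z (j, false)) (z (j, true)) =
      (∑ a, ∑ b, p a * p b * w a b) ^ n := by
  have h1 : (∑ a, ∑ b, p a * p b * w a b) ^ n =
      ∑ q : Fin n → A × A, ∏ j, p (q j).1 * p (q j).2 * w (q j).1 (q j).2 := by
    rw [← Fintype.sum_prod_type', Fintype.sum_pow]
  rw [h1]
  let e : (Fin n × Bool → A) ≃ (Fin n → A × A) :=
    ⟨fun z j => (z (j, false), z (j, true)), fun q x => if x.2 then (q x.1).2 else (q x.1).1,
      fun z => by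
        funext ⟨j, b⟩
        cases b <;> rfl, fun q => rfl⟩
  refine Fintype.sum_equiv e _ _ fun z => ?_
  rw [Fintype.prod_prod_type, ← Finset.prod_mul_distrib]
  refine Finset.prod_congr rfl fun j _ => ?_
  simp [e, mul_comm]

/-- The number of ordered pairs of neighbours whose types are related by `R`. -/
def badCount {d : ℕ} (R : A → A → Prop) [DecidableRel R] (s : Fin d → Equiv.Perm (Fin n × Bool))
    (y : Fin n × Bool → A) : ℕ :=
  ∑ i, (Finset.univ.filter fun x => R (y x) (y (conjInv (flip n) (s i) x))).card

/-- The probability that two independent types with law `p` are related by `R`. -/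
def pairMass (R : A → A → Prop) [DecidableRel R] (p : A → ℝ) : ℝ :=
  ∑ a, ∑ b, if R a b then p a * p b else 0

-- After the comparison `sum_perm_le` the types are independent and the `n` pairs contribute
-- independent factors. A bad pair is counted from both of its ends, hence `exp (-2 * θ)`.
open Nat in
theorem sum_exp_bad_le [NeZero n] (R : A → A → Prop) [DecidableRel R] (hR : ∀ a b, R a b → R b a)
    (y : Fin n × Bool → A) (θ : ℝ) :
    ∑ s : Equiv.Perm (Fin n × Bool), Real.exp (-θ *
        (Finset.univ.filter fun x => R (y x) (y (conjInv (flip n) s x))).card) ≤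
      (2 * n)! * (Real.exp 1 * (2 * n + 1)) ^ Fintype.card A *
        Real.exp (-(n * (1 - Real.exp (-2 * θ)) * pairMass R (freq y))) := by
  have hcard : Fintype.card (Fin n × Bool) = 2 * n := by simp [mul_comm]
  have : Nonempty (Fin n × Bool) := ⟨(0, true)⟩
  let w : A → A → ℝ := fun a b => if R a b then Real.exp (-2 * θ) else 1
  have h1 : ∀ s : Equiv.Perm (Fin n × Bool), Real.exp (-θ *
        (Finset.univ.filter fun x => R (y x) (y (conjInv (flip n) s x))).card) =
      ∏ j, w ((y ∘ s) (j, false)) ((y ∘ s) (j, true)) := by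
    intro s
    rw [mul_comm, Real.exp_nat_mul, ← Finset.prod_const, Finset.prod_filter,
      ← Equiv.prod_comp s, Fintype.prod_prod_type]
    refine Finset.prod_congr rfl fun j _ => ?_
    have e1 : conjInv (flip n) s (s (j, true)) = s (j, false) := by simp [conjInv_apply, flip]
    have e2 : conjInv (flip n) s (s (j, false)) = s (j, true) := by simp [conjInv_apply, flip]
    simp only [Fintype.prod_bool, w, Function.comp]
    rw [e1, e2]
    by_cases hr : R (y (s (j, false))) (y (s (j, true)))
    · rw [if_pos hr, if_pos hr, if_pos (hR _ _ hr), ← Real.exp_add]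
      congr 1
      ring
    · rw [if_neg hr, if_neg hr, if_neg fun h => hr (hR _ _ h), one_mul]
  simp_rw [h1]
  refine (sum_perm_le y (fun z => ∏ j, w (z (j, false)) (z (j, true))) fun z =>
    Finset.prod_nonneg fun j _ => by simp only [w]; split_ifs <;> positivity).trans ?_
  rw [sum_prod_pairs, hcard]
  push_cast
  refine mul_le_mul_of_nonneg_left ?_ (by positivity)
  have h2 : ∑ a, ∑ b, freq y a * freq y b * w a b =
      1 - (1 - Real.exp (-2 * θ)) * pairMass R (freq y) := by
    have h3 : (1 : ℝ) = ∑ a, ∑ b, freq y a * freq y b := by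
      rw [← Finset.sum_mul_sum, sum_freq, one_mul]
    rw [pairMass, Finset.mul_sum]
    nth_rewrite 1 [h3]
    rw [← Finset.sum_sub_distrib]
    refine Finset.sum_congr rfl fun a _ => ?_
    rw [Finset.mul_sum, ← Finset.sum_sub_distrib]
    refine Finset.sum_congr rfl fun b _ => ?_
    simp only [w]
    split_ifs <;> ring
  have h4 : 0 ≤ ∑ a, ∑ b, freq y a * freq y b * w a b :=
    Finset.sum_nonneg fun a _ => Finset.sum_nonneg fun b _ =>
      mul_nonneg (mul_nonneg (freq_nonneg _ _) (freq_nonneg _ _)) (by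
        simp only [w]; split_ifs <;> positivity)
  calc (∑ a, ∑ b, freq y a * freq y b * w a b) ^ n
      ≤ Real.exp (-((1 - Real.exp (-2 * θ)) * pairMass R (freq y))) ^ n := by
        refine pow_le_pow_left₀ h4 ?_ n
        rw [h2]
        have := Real.add_one_le_exp (-((1 - Real.exp (-2 * θ)) * pairMass R (freq y)))
        linarith
    _ = _ := by
        rw [← Real.exp_nat_mul]
        congr 1
        ring

-- Markov's inequality for `exp (-θ * badCount)`. The `d` matchings are independent, so the
-- exponential moment is a `d`-th power.
open Nat in
theorem card_badCount_le [NeZero n] {d : ℕ} (R : A → A → Prop) [DecidableRel R]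
    (hR : ∀ a b, R a b → R b a) (y : Fin n × Bool → A) {θ : ℝ} (hθ : 0 ≤ θ) (t : ℝ) :
    (((Finset.univ : Finset (Fin d → Equiv.Perm (Fin n × Bool))).filter fun s =>
        (badCount R s y : ℝ) ≤ t).card : ℝ) ≤
      Fintype.card (Fin d → Equiv.Perm (Fin n × Bool)) *
        (Real.exp 1 * (2 * n + 1)) ^ (Fintype.card A * d) *
        Real.exp (θ * t - d * n * (1 - Real.exp (-2 * θ)) * pairMass R (freq y)) := by
  have h1 : ∑ s : Fin d → Equiv.Perm (Fin n × Bool), Real.exp (-θ * badCount R s y) =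
      (∑ s : Equiv.Perm (Fin n × Bool), Real.exp (-θ *
        (Finset.univ.filter fun x => R (y x) (y (conjInv (flip n) s x))).card)) ^ d := by
    rw [Fintype.sum_pow]
    refine Finset.sum_congr rfl fun s _ => ?_
    rw [← Real.exp_sum, badCount]
    push_cast
    rw [Finset.mul_sum]
  have h2 : ∑ s : Fin d → Equiv.Perm (Fin n × Bool), Real.exp (-θ * badCount R s y) ≤
      Fintype.card (Fin d → Equiv.Perm (Fin n × Bool)) *
        (Real.exp 1 * (2 * n + 1)) ^ (Fintype.card A * d) *
        Real.exp (-(d * n * (1 - Real.exp (-2 * θ)) * pairMass R (freq y))) := by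
    rw [h1]
    refine (pow_le_pow_left₀ (Finset.sum_nonneg fun s _ => (Real.exp_pos _).le)
      (sum_exp_bad_le R hR y θ) d).trans (le_of_eq ?_)
    have hc : Fintype.card (Fin d → Equiv.Perm (Fin n × Bool)) = ((2 * n)!) ^ d := by
      rw [Fintype.card_fun, Fintype.card_perm, Fintype.card_fin, Fintype.card_prod,
        Fintype.card_fin, Fintype.card_bool, mul_comm]
    rw [hc, mul_pow, mul_pow, ← pow_mul, ← Real.exp_nat_mul]
    push_cast
    congr 2
    ring
  rw [sub_eq_add_neg, Real.exp_add, mul_left_comm, ← div_le_iff₀' (Real.exp_pos _), div_eq_mul_inv,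
    ← Real.exp_neg]
  refine le_trans ?_ h2
  rw [← nsmul_eq_mul, ← Finset.sum_const]
  refine le_trans (Finset.sum_le_sum fun s hs => ?_) (Finset.sum_le_sum_of_subset_of_nonneg
    (Finset.filter_subset _ _) fun y _ _ => (Real.exp_pos _).le)
  have hs := (Finset.mem_filter.mp hs).2
  refine Real.exp_le_exp.mpr ?_
  nlinarith

end Matching

/-! ## Finite-range observables of independent labels -/

section Local

variable {U W L : Type*} [MeasurableSpace L] (μ : Measure L) [IsProbabilityMeasure μ]

/-- The law of a family of independent labels with law `μ`. -/
noncomputable def iidLaw (U : Type*) {L : Type*} [MeasurableSpace L] (μ : Measure L)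
    [IsProbabilityMeasure μ] : Measure (U → L) :=
  Measure.infinitePi fun _ => μ

instance : IsProbabilityMeasure (iidLaw U μ) := by unfold iidLaw; infer_instance

/-- A set of labellings is local if membership is decided by the labels in the finite set `F`. -/
def IsLocal (F : Finset U) (S : Set (U → L)) : Prop :=
  ∀ X X' : U → L, (∀ u ∈ F, X u = X' u) → (X ∈ S ↔ X' ∈ S)

theorem IsLocal.comp [DecidableEq W] {F : Finset U} {S : Set (U → L)} (h : IsLocal F S)
    (a : U → W) : IsLocal (F.image a) {X : W → L | X ∘ a ∈ S} := fun X X' hX =>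
  h (X ∘ a) (X' ∘ a) fun u hu => hX (a u) (Finset.mem_image_of_mem a hu)

theorem measurable_comp_index (a : U → W) : Measurable fun X : W → L => X ∘ a :=
  measurable_pi_lambda _ fun u => measurable_pi_apply (a u)

-- Labels outside `F` are filled in with a fixed value. The measure only guarantees that such a
-- value exists.
include μ in
theorem IsLocal.exists_restrict {F : Finset U} {S : Set (U → L)} (h : IsLocal F S)
    (hS : MeasurableSet S) :
    ∃ S' : Set (F → L), MeasurableSet S' ∧ S = {X | (fun u : F => X u) ∈ S'} := by
  classical
  have hne : Nonempty L := nonempty_of_isProbabilityMeasure μ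
  let l₀ : L := hne.some
  let ext : (F → L) → U → L := fun z u => if hu : u ∈ F then z ⟨u, hu⟩ else l₀
  have hext : Measurable ext := by
    refine measurable_pi_lambda _ fun u => ?_
    by_cases hu : u ∈ F
    · simpa [ext, hu] using measurable_pi_apply _
    · simp [ext, hu]
  refine ⟨ext ⁻¹' S, hext hS, ?_⟩
  ext X
  refine h X _ fun u hu => ?_
  simp [ext, hu]

/-- The law of a local observable does not change when the labels are read along a map that is
injective on the relevant set. -/
theorem iidLaw_comp {F : Finset U} {S : Set (U → L)} (h : IsLocal F S) (hS : MeasurableSet S)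
    {a : U → W} (ha : Set.InjOn a F) :
    iidLaw W μ {X | X ∘ a ∈ S} = iidLaw U μ S := by
  obtain ⟨S', hS', rfl⟩ := h.exists_restrict μ hS
  have h1 : (iidLaw W μ).map (fun X (u : F) => X (a u)) = Measure.infinitePi fun _ : F => μ :=
    Measure.map_infinitePi_infinitePi_of_inj (f := fun u : F => a u) (P := fun _ : W => μ)
      fun u v huv => Subtype.ext (ha u.2 v.2 huv)
  have h2 : (iidLaw U μ).map (fun X (u : F) => X u) = Measure.infinitePi fun _ : F => μ :=
    Measure.map_infinitePi_infinitePi_of_inj (f := fun u : F => (u : U)) (P := fun _ : U => μ)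
      Subtype.val_injective
  have h3 := h1.trans h2.symm
  have m1 : Measurable fun (X : W → L) (u : F) => X (a u) := by fun_prop
  have m2 : Measurable fun (X : U → L) (u : F) => X u := by fun_prop
  have h4 := congrArg (fun ν => ν S') h3
  simp only [Measure.map_apply m1 hS', Measure.map_apply m2 hS'] at h4
  exact h4

/-- Local observables read along maps with disjoint images are independent. -/
theorem iidLaw_comp_inter {F : Finset U} {S S' : Set (U → L)} (h : IsLocal F S)
    (hS : MeasurableSet S) (h' : IsLocal F S') (hS' : MeasurableSet S')
    {a a' : U → W} (ha : Set.InjOn a F) (ha' : Set.InjOn a' F)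
    (hd : ∀ u ∈ F, ∀ v ∈ F, a u ≠ a' v) :
    iidLaw W μ ({X | X ∘ a ∈ S} ∩ {X | X ∘ a' ∈ S'}) = iidLaw U μ S * iidLaw U μ S' := by
  classical
  rw [← iidLaw_comp μ h hS ha, ← iidLaw_comp μ h' hS' ha']
  obtain ⟨Q, hQ, hQ'⟩ := (h.comp a).exists_restrict μ (measurable_comp_index a hS)
  obtain ⟨R, hR, hR'⟩ := (h'.comp a').exists_restrict μ (measurable_comp_index a' hS')
  have hdisj : Disjoint (F.image a) (F.image a') := by
    rw [Finset.disjoint_left]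
    intro w hw hw'
    obtain ⟨u, hu, rfl⟩ := Finset.mem_image.mp hw
    obtain ⟨v, hv, hvu⟩ := Finset.mem_image.mp hw'
    exact hd u hu v hv hvu.symm
  have hind : iIndepFun (fun (w : W) (X : W → L) => X w) (iidLaw W μ) :=
    iIndepFun_infinitePi (X := fun _ x => x) fun _ => measurable_id
  have h2 := hind.indepFun_finset (F.image a) (F.image a') hdisj fun w => measurable_pi_apply w
  have := h2.measure_inter_preimage_eq_mul Q R hQ hR
  rw [hQ', hR']
  exact this

end Local

/-! ## Observables on the random permutation model -/

section Observable

variable {d : ℕ} {L : Type*} [MeasurableSpace L] (μ : Measure L) [IsProbabilityMeasure μ]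
  {A : Type*} [Fintype A] [DecidableEq A]

/-- An observable of labellings of the tree with finitely many values that depends on finitely
many labels only. -/
structure IsObservable (F : Finset (Vert d)) (T : (Vert d → L) → A) : Prop where
  measurable : ∀ a, MeasurableSet {X | T X = a}
  dependsOn : ∀ X X' : Vert d → L, (∀ u ∈ F, X u = X' u) → T X = T X'

/-- The law of an observable of independent labels. -/
noncomputable def typeLaw (T : (Vert d → L) → A) (a : A) : ℝ :=
  (iidLaw (Vert d) μ).real {X | T X = a}

/-- The labelling seen from the vertex `g`. -/
def shift (g : Vert d) (X : Vert d → L) : Vert d → L := fun u => X (u * g)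

/-- The expected number of neighbours of the root whose type is related to that of the root. -/
noncomputable def edgeMass (R : A → A → Prop) (T : (Vert d → L) → A) : ℝ :=
  ∑ i : Fin d, (iidLaw (Vert d) μ).real {X | R (T X) (T (shift (gen i) X))}

theorem typeLaw_nonneg (T : (Vert d → L) → A) (a : A) : 0 ≤ typeLaw μ T a := measureReal_nonneg

theorem typeLaw_le_one (T : (Vert d → L) → A) (a : A) : typeLaw μ T a ≤ 1 := measureReal_le_one

theorem IsObservable.measurableSet_rel {F : Finset (Vert d)} {T : (Vert d → L) → A}
    (hT : IsObservable F T) (R : A → A → Prop) {Ω : Type*} [MeasurableSpace Ω]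
    {f g : Ω → Vert d → L} (hf : Measurable f) (hg : Measurable g) :
    MeasurableSet {ω | R (T (f ω)) (T (g ω))} := by
  classical
  have : {ω | R (T (f ω)) (T (g ω))} =
      ⋃ p ∈ {p : A × A | R p.1 p.2}, (f ⁻¹' {X | T X = p.1}) ∩ (g ⁻¹' {X | T X = p.2}) := by
    ext ω
    simp
  rw [this]
  exact MeasurableSet.biUnion (Set.to_countable _) fun p _ =>
    (hf (hT.measurable _)).inter (hg (hT.measurable _))

theorem measurable_shift (g : Vert d) : Measurable (shift (L := L) g) :=
  measurable_comp_index fun u => u * g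

variable {V : Type*} [Fintype V] [DecidableEq V] {τ : Equiv.Perm V} (h2 : ∀ x, τ (τ x) = x)
  (s : Fin d → Equiv.Perm V)

/-- The type of a vertex of the model. -/
noncomputable def typeAt (T : (Vert d → L) → A) (X : V → L) (x : V) : A :=
  T fun u => X (modelAct h2 s u x)

/-- The labels that matter for the types of the root and of its neighbours. -/
noncomputable def enlarge (F : Finset (Vert d)) : Finset (Vert d) := by
  classical
  exact F ∪ (Finset.univ : Finset (Fin d)).biUnion fun i => F.image (· * gen i)

theorem subset_enlarge (F : Finset (Vert d)) : F ⊆ enlarge F := by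
  unfold enlarge; exact Finset.subset_union_left

theorem mul_gen_mem_enlarge {F : Finset (Vert d)} {u : Vert d} (hu : u ∈ F) (i : Fin d) :
    u * gen i ∈ enlarge F := by
  classical
  unfold enlarge
  refine Finset.mem_union_right _ (Finset.mem_biUnion.mpr ⟨i, Finset.mem_univ _, ?_⟩)
  exact Finset.mem_image_of_mem _ hu

/-- The vertex `x` has a tree-like neighbourhood. -/
def TreeLike (F : Finset (Vert d)) (x : V) : Prop :=
  Set.InjOn (fun u => modelAct h2 s u x) (enlarge F)

open Classical in
/-- The number of vertices without a tree-like neighbourhood. -/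
noncomputable def defect (F : Finset (Vert d)) : ℕ :=
  (Finset.univ.filter fun x : V => ¬ TreeLike h2 s F x).card

variable {F : Finset (Vert d)} {T : (Vert d → L) → A}

theorem IsObservable.isLocal (hT : IsObservable F T) (a : A) : IsLocal F {X | T X = a} :=
  fun X X' h => by simp [hT.dependsOn X X' h]

theorem measurableSet_typeAt (hT : IsObservable F T) (a : A) (x : V) :
    MeasurableSet {X : V → L | typeAt h2 s T X x = a} :=
  measurable_comp_index (fun u => modelAct h2 s u x) (hT.measurable a)

/-- Around a tree-like vertex distinct words lead to distinct vertices, so the labels that are read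
are independent, as in the tree. -/
theorem prob_typeAt (hT : IsObservable F T) (a : A) {x : V} (hx : TreeLike h2 s F x) :
    (iidLaw V μ).real {X | typeAt h2 s T X x = a} = typeLaw μ T a := by
  unfold typeLaw Measure.real
  rw [← iidLaw_comp μ (hT.isLocal a) (hT.measurable a) (hx.mono (subset_enlarge F))]
  rfl

theorem prob_typeAt_inter (hT : IsObservable F T) (a : A) {x x' : V} (hx : TreeLike h2 s F x)
    (hx' : TreeLike h2 s F x')
    (hd : ∀ u ∈ F, ∀ v ∈ F, modelAct h2 s u x ≠ modelAct h2 s v x') :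
    (iidLaw V μ).real ({X | typeAt h2 s T X x = a} ∩ {X | typeAt h2 s T X x' = a}) =
      typeLaw μ T a ^ 2 := by
  have := iidLaw_comp_inter μ (hT.isLocal a) (hT.measurable a) (hT.isLocal a) (hT.measurable a)
    (hx.mono (subset_enlarge F)) (hx'.mono (subset_enlarge F)) hd
  unfold typeLaw Measure.real
  rw [sq, ← ENNReal.toReal_mul, ← this]
  rfl

/-- The type of the `i`-th neighbour is read at the words `u * gen i`; this is why `TreeLike` asks
for injectivity on `enlarge F` and not only on `F`. -/
theorem prob_edge (hT : IsObservable F T) (R : A → A → Prop) (i : Fin d) {x : V}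
    (hx : TreeLike h2 s F x) :
    (iidLaw V μ).real {X | R (typeAt h2 s T X x) (typeAt h2 s T X (conjInv τ (s i) x))} =
      (iidLaw (Vert d) μ).real {X | R (T X) (T (shift (gen i) X))} := by
  have hloc : IsLocal (enlarge F) {X : Vert d → L | R (T X) (T (shift (gen i) X))} := by
    intro X X' h
    have e1 := hT.dependsOn X X' fun u hu => h u (subset_enlarge F hu)
    have e2 := hT.dependsOn (shift (gen i) X) (shift (gen i) X') fun u hu =>
      h _ (mul_gen_mem_enlarge hu i)
    simp [e1, e2]
  unfold Measure.real
  rw [← iidLaw_comp μ hloc (hT.measurableSet_rel R measurable_id (measurable_shift _)) hx]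
  congr 2
  ext X
  have : (fun u => X (modelAct h2 s u (conjInv τ (s i) x))) =
      shift (gen i) (X ∘ fun u => modelAct h2 s u x) := by
    funext u
    simp [shift, modelAct_gen]
  change R (typeAt h2 s T X x) (T fun u => X (modelAct h2 s u (conjInv τ (s i) x))) ↔ _
  rw [this]
  rfl

/-- The number of pairs of vertices with dependent types. -/
theorem card_dependent_le [DecidableEq (Vert d)] :
    ((Finset.univ : Finset (V × V)).filter fun p => ∃ u ∈ F, ∃ v ∈ F,
      modelAct h2 s u p.1 = modelAct h2 s v p.2).card ≤ Fintype.card V * F.card ^ 2 := by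
  -- Such a pair is determined by its first vertex and the two words.
  have : ((Finset.univ : Finset (V × V)).filter fun p => ∃ u ∈ F, ∃ v ∈ F,
      modelAct h2 s u p.1 = modelAct h2 s v p.2) ⊆
      ((Finset.univ : Finset V) ×ˢ (F ×ˢ F)).image
        fun q => (q.1, (modelAct h2 s q.2.2)⁻¹ (modelAct h2 s q.2.1 q.1)) := by
    intro p hp
    obtain ⟨u, hu, v, hv, h⟩ := (Finset.mem_filter.mp hp).2
    refine Finset.mem_image.mpr ⟨(p.1, u, v), by simp [hu, hv], ?_⟩
    simp [h]
  refine (Finset.card_le_card this).trans (Finset.card_image_le.trans ?_)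
  rw [Finset.card_product, Finset.card_product, Finset.card_univ, sq]

open Classical in
/-- The second moment bound for the number of vertices of a given type. -/
theorem integral_sq_count_le (hT : IsObservable F T) (a : A) :
    ∫ X, (∑ x : V, ((if typeAt h2 s T X x = a then 1 else 0) - typeLaw μ T a)) ^ 2 ∂(iidLaw V μ) ≤
      Fintype.card V * (F.card ^ 2 + 2 * defect h2 s F : ℝ) := by
  set P := iidLaw V μ
  set p := typeLaw μ T a with hp
  have hp0 : 0 ≤ p := typeLaw_nonneg μ T a
  have hp1 : p ≤ 1 := typeLaw_le_one μ T a
  let J : V → (V → L) → ℝ := fun x X => if typeAt h2 s T X x = a then 1 else 0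
  have hJm : ∀ x, Measurable (J x) := fun x =>
    Measurable.ite (measurableSet_typeAt h2 s hT a x) measurable_const measurable_const
  have hI01 : ∀ x X, 0 ≤ J x X ∧ J x X ≤ 1 := by
    intro x X
    simp only [J]
    split_ifs <;> simp
  have hJint : ∀ x, Integrable (J x) P := fun x =>
    Integrable.of_bound (hJm x).aestronglyMeasurable 1 (ae_of_all _ fun X => by
      rw [Real.norm_eq_abs, abs_of_nonneg (hI01 x X).1]; exact (hI01 x X).2)
  have hIIint : ∀ x x', Integrable (fun X => J x X * J x' X) P := fun x x' =>
    Integrable.of_bound ((hJm x).mul (hJm x')).aestronglyMeasurable 1 (ae_of_all _ fun X => by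
      rw [Real.norm_eq_abs, abs_of_nonneg (mul_nonneg (hI01 x X).1 (hI01 x' X).1)]
      exact mul_le_one₀ (hI01 x X).2 (hI01 x' X).1 (hI01 x' X).2)
  have hprod : ∀ x x', Integrable (fun X => (J x X - p) * (J x' X - p)) P := by
    intro x x'
    have : (fun X => (J x X - p) * (J x' X - p)) =
        fun X => J x X * J x' X - p * J x X - p * J x' X + p * p := by
      funext X; ring
    rw [this]
    exact (((hIIint x x').sub ((hJint x).const_mul p)).sub ((hJint x').const_mul p)).add
      (integrable_const _)
  have hEI : ∀ x, TreeLike h2 s F x → ∫ X, J x X ∂P = p := by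
    intro x hx
    have h1 : J x = Set.indicator {X | typeAt h2 s T X x = a} 1 := by
      funext X; simp [J, Set.indicator_apply]
    rw [h1, integral_indicator_one (measurableSet_typeAt h2 s hT a x)]
    exact prob_typeAt μ h2 s hT a hx
  let dep : V × V → Prop := fun q => ∃ u ∈ F, ∃ v ∈ F, modelAct h2 s u q.1 = modelAct h2 s v q.2
  -- Tree-like vertices that read disjoint sets of labels have covariance zero; every other pair is
  -- charged the trivial bound 1.
  have hpair : ∀ x x', ∫ X, (J x X - p) * (J x' X - p) ∂P ≤
      (if ¬ TreeLike h2 s F x then 1 else 0) + (if ¬ TreeLike h2 s F x' then 1 else 0) +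
        (if dep (x, x') then 1 else 0) := by
    intro x x'
    have hle1 : ∫ X, (J x X - p) * (J x' X - p) ∂P ≤ 1 := by
      calc ∫ X, (J x X - p) * (J x' X - p) ∂P ≤ ∫ X, (1 : ℝ) ∂P := by
            refine integral_mono (hprod x x') (integrable_const _) fun X => ?_
            have a1 := hI01 x X
            have a2 := hI01 x' X
            have b1 : |J x X - p| ≤ 1 := by rw [abs_le]; constructor <;> linarith
            have b2 : |J x' X - p| ≤ 1 := by rw [abs_le]; constructor <;> linarith
            calc (J x X - p) * (J x' X - p) ≤ |(J x X - p) * (J x' X - p)| := le_abs_self _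
              _ = |J x X - p| * |J x' X - p| := abs_mul _ _
              _ ≤ 1 := mul_le_one₀ b1 (abs_nonneg _) b2
        _ = 1 := by simp
    by_cases c1 : TreeLike h2 s F x
    swap
    · rw [if_pos c1]
      refine hle1.trans ?_
      split_ifs <;> norm_num
    by_cases c2 : TreeLike h2 s F x'
    swap
    · rw [if_pos c2]
      refine hle1.trans ?_
      split_ifs <;> norm_num
    by_cases c3 : dep (x, x')
    · rw [if_pos c3]
      refine hle1.trans ?_
      split_ifs <;> norm_num
    rw [if_neg (not_not.mpr c1), if_neg (not_not.mpr c2), if_neg c3]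
    have hII : ∫ X, J x X * J x' X ∂P = p ^ 2 := by
      have h1 : (fun X => J x X * J x' X) = Set.indicator
          ({X | typeAt h2 s T X x = a} ∩ {X | typeAt h2 s T X x' = a}) 1 := by
        funext X
        by_cases e1 : typeAt h2 s T X x = a <;> by_cases e2 : typeAt h2 s T X x' = a <;>
          simp [J, e1, e2]
      rw [h1, integral_indicator_one ((measurableSet_typeAt h2 s hT a x).inter
        (measurableSet_typeAt h2 s hT a x'))]
      refine prob_typeAt_inter μ h2 s hT a c1 c2 fun u hu v hv h => c3 ⟨u, hu, v, hv, h⟩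
    have hexp : (fun X => (J x X - p) * (J x' X - p)) =
        fun X => J x X * J x' X - p * J x X - p * J x' X + p * p := by
      funext X; ring
    rw [hexp, integral_add, integral_sub, integral_sub, integral_const_mul, integral_const_mul,
      hII, hEI x c1, hEI x' c2]
    · simp
      ring_nf
      rfl
    · exact hIIint x x'
    · exact (hJint x).const_mul p
    · exact (hIIint x x').sub ((hJint x).const_mul p)
    · exact (hJint x').const_mul p
    · exact ((hIIint x x').sub ((hJint x).const_mul p)).sub ((hJint x').const_mul p)
    · exact integrable_const _
  have hexpand : ∀ X, (∑ x : V, (J x X - p)) ^ 2 = ∑ x, ∑ x', (J x X - p) * (J x' X - p) := by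
    intro X
    rw [sq, Finset.sum_mul_sum]
  change ∫ X, (∑ x : V, (J x X - p)) ^ 2 ∂P ≤ _
  simp_rw [hexpand]
  rw [integral_finsetSum _ fun x _ => integrable_finsetSum _ fun x' _ => hprod x x']
  simp_rw [fun x => integral_finsetSum (μ := P) Finset.univ fun x' _ => hprod x x']
  have hdef : ∑ x : V, (if ¬ TreeLike h2 s F x then (1 : ℝ) else 0) = defect h2 s F := by
    rw [Finset.sum_boole]
    rfl
  have hdep : ∑ x : V, ∑ x' : V, (if dep (x, x') then (1 : ℝ) else 0) ≤
      Fintype.card V * F.card ^ 2 := by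
    rw [← Fintype.sum_prod_type (f := fun q : V × V => if dep q then (1 : ℝ) else 0),
      Finset.sum_boole]
    exact_mod_cast card_dependent_le h2 s
  calc ∑ x, ∑ x', ∫ X, (J x X - p) * (J x' X - p) ∂P
      ≤ ∑ x : V, ∑ x' : V, ((if ¬ TreeLike h2 s F x then (1 : ℝ) else 0) +
          (if ¬ TreeLike h2 s F x' then 1 else 0) + (if dep (x, x') then 1 else 0)) :=
        Finset.sum_le_sum fun x _ => Finset.sum_le_sum fun x' _ => hpair x x'
    _ = Fintype.card V * defect h2 s F + Fintype.card V * defect h2 s F +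
          ∑ x : V, ∑ x' : V, (if dep (x, x') then (1 : ℝ) else 0) := by
        simp_rw [Finset.sum_add_distrib]
        rw [Finset.sum_const, hdef]
        simp only [Finset.sum_const, Finset.card_univ, nsmul_eq_mul]
        rw [← Finset.mul_sum, hdef]
    _ ≤ _ := by linarith

end Observable

/-! ## The entropy bound -/

section Entropy

variable {d : ℕ} {L : Type*} [MeasurableSpace L] (μ : Measure L) [IsProbabilityMeasure μ]
  {A : Type*} [Fintype A] [DecidableEq A] {F : Finset (Vert d)} {T : (Vert d → L) → A}

-- Tree-like vertices see the same edge probabilities as the root of the tree; every other vertex is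
-- charged 1 in each of the `d` directions.
open Classical in
theorem integral_badCount_le {n : ℕ} (hT : IsObservable F T) (R : A → A → Prop) [DecidableRel R]
    (s : Fin d → Equiv.Perm (Fin n × Bool)) :
    Integrable (fun X => (badCount R s fun x => typeAt flip_flip s T X x : ℝ))
      (iidLaw (Fin n × Bool) μ) ∧
    ∫ X, (badCount R s fun x => typeAt flip_flip s T X x : ℝ) ∂(iidLaw (Fin n × Bool) μ) ≤
      2 * n * edgeMass μ R T + d * defect flip_flip s F := by
  let B : Fin d → Fin n × Bool → Set (Fin n × Bool → L) := fun i x =>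
    {X | R (typeAt flip_flip s T X x) (typeAt flip_flip s T X (conjInv (flip n) (s i) x))}
  have hB : ∀ i x, MeasurableSet (B i x) := fun i x =>
    hT.measurableSet_rel R (measurable_comp_index _) (measurable_comp_index _)
  have hrw : ∀ X, (badCount R s fun x => typeAt flip_flip s T X x : ℝ) =
      ∑ i, ∑ x, (B i x).indicator 1 X := by
    intro X
    unfold badCount
    push_cast
    refine Finset.sum_congr rfl fun i _ => ?_
    rw [← Finset.sum_boole]
    refine Finset.sum_congr rfl fun x _ => ?_
    simp only [Set.indicator_apply, Pi.one_apply]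
    rfl
  have hint : ∀ i x, Integrable ((B i x).indicator (1 : (Fin n × Bool → L) → ℝ)) (iidLaw (Fin n × Bool) μ) :=
    fun i x => (integrable_const (1 : ℝ)).indicator (hB i x)
  simp_rw [hrw]
  refine ⟨integrable_finsetSum _ fun i _ => integrable_finsetSum _ fun x _ => hint i x, ?_⟩
  rw [integral_finsetSum _ fun i _ => integrable_finsetSum _ fun x _ => hint i x]
  simp_rw [fun i => integral_finsetSum (μ := iidLaw (Fin n × Bool) μ) Finset.univ
    fun x _ => hint i x, fun i x => integral_indicator_one (μ := iidLaw (Fin n × Bool) μ) (hB i x)]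
  have hle : ∀ i x, (iidLaw (Fin n × Bool) μ).real (B i x) ≤
      (iidLaw (Vert d) μ).real {X | R (T X) (T (shift (gen i) X))} +
        if ¬ TreeLike flip_flip s F x then 1 else 0 := by
    intro i x
    by_cases hx : TreeLike flip_flip s F x
    · rw [if_neg (not_not.mpr hx), add_zero]
      exact (prob_edge μ flip_flip s hT R i hx).le
    · rw [if_pos hx]
      exact measureReal_le_one.trans (le_add_of_nonneg_left measureReal_nonneg)
  refine (Finset.sum_le_sum fun i _ => Finset.sum_le_sum fun x _ => hle i x).trans (le_of_eq ?_)
  simp_rw [Finset.sum_add_distrib]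
  rw [edgeMass, Finset.mul_sum]
  congr 1
  · refine Finset.sum_congr rfl fun i _ => ?_
    simp [mul_comm]
  · rw [Finset.sum_const, Finset.sum_boole]
    simp only [Finset.card_univ, Fintype.card_fin, nsmul_eq_mul]
    rfl

/-- Chebyshev for the frequencies and Markov for the bad count, combined in one nonnegative variable
`Z` with mean below 1: where `Z < 1`, all its terms are below 1. -/
theorem exists_typical {n : ℕ} [NeZero n] (hT : IsObservable F T) (R : A → A → Prop)
    [DecidableRel R] (s : Fin d → Equiv.Perm (Fin n × Bool)) {δ t : ℝ} (hδ : 0 < δ) (ht : 0 < t)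
    (h : Fintype.card A * ((F.card ^ 2 + 2 * defect flip_flip s F : ℝ) / (2 * n * δ ^ 2)) +
      (edgeMass μ R T + d * defect flip_flip s F / (2 * n)) / t < 1) :
    ∃ y : Fin n × Bool → A, (∀ a, |freq y a - typeLaw μ T a| ≤ δ) ∧
      (badCount R s y : ℝ) ≤ t * (2 * n) := by
  classical
  have hn : (0 : ℝ) < n := by exact_mod_cast Nat.pos_of_ne_zero (NeZero.ne n)
  have hcard : (Fintype.card (Fin n × Bool) : ℝ) = 2 * n := by simp [mul_comm]
  set P := iidLaw (Fin n × Bool) μ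
  let Q : A → (Fin n × Bool → L) → ℝ := fun a X =>
    (∑ x : Fin n × Bool, ((if typeAt flip_flip s T X x = a then 1 else 0) - typeLaw μ T a)) ^ 2
  have hQ : ∀ a X, Q a X = ((2 * n) * (freq (fun x => typeAt flip_flip s T X x) a -
      typeLaw μ T a)) ^ 2 := by
    intro a X
    simp only [Q, Finset.sum_sub_distrib, Finset.sum_boole, Finset.sum_const, Finset.card_univ,
      nsmul_eq_mul, freq, hcard]
    congr 1
    field_simp
  have hQint : ∀ a, Integrable (Q a) P := by
    intro a
    have hm : Measurable (Q a) := by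
      refine Measurable.pow_const (Finset.measurable_sum _ fun x _ => ?_) 2
      exact (Measurable.ite (measurableSet_typeAt flip_flip s hT a x) measurable_const
        measurable_const).sub_const _
    refine Integrable.of_bound hm.aestronglyMeasurable ((2 * n) ^ 2) (ae_of_all _ fun X => ?_)
    rw [hQ, Real.norm_eq_abs, abs_of_nonneg (sq_nonneg _), mul_pow]
    have : Nonempty (Fin n × Bool) := ⟨(0, true)⟩
    have h1 : freq (fun x => typeAt flip_flip s T X x) a ≤ 1 := by
      rw [← sum_freq fun x => typeAt flip_flip s T X x]
      exact Finset.single_le_sum (fun b _ => freq_nonneg _ b) (Finset.mem_univ a)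
    have h2 := freq_nonneg (fun x => typeAt flip_flip s T X x) a
    have h3 := typeLaw_nonneg μ T a
    have h4 := typeLaw_le_one μ T a
    refine mul_le_of_le_one_right (by positivity) ?_
    rw [sq_le_one_iff_abs_le_one, abs_le]
    constructor <;> linarith
  obtain ⟨hbint, hble⟩ := integral_badCount_le μ hT R s
  let Z : (Fin n × Bool → L) → ℝ := fun X => ∑ a, Q a X / (2 * n * δ) ^ 2 +
    (badCount R s fun x => typeAt flip_flip s T X x : ℝ) / (t * (2 * n))
  have hZ1 : Integrable (fun X => ∑ a, Q a X / (2 * n * δ) ^ 2) P :=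
    integrable_finsetSum _ fun a _ => (hQint a).div_const _
  have hZint : Integrable Z P := hZ1.add (hbint.div_const _)
  have hZle : ∫ X, Z X ∂P < 1 := by
    refine lt_of_le_of_lt ?_ h
    rw [integral_add hZ1 (hbint.div_const _), integral_finsetSum _ fun a _ => (hQint a).div_const _]
    refine add_le_add ?_ ?_
    · calc ∑ a, ∫ X, Q a X / (2 * n * δ) ^ 2 ∂P
          ≤ ∑ a : A, (F.card ^ 2 + 2 * defect flip_flip s F : ℝ) / (2 * n * δ ^ 2) := by
            refine Finset.sum_le_sum fun a _ => ?_
            rw [integral_div, div_le_iff₀ (by positivity)]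
            refine (integral_sq_count_le μ flip_flip s hT a).trans (le_of_eq ?_)
            rw [hcard]
            field_simp
        _ = _ := by rw [Finset.sum_const, Finset.card_univ, nsmul_eq_mul]
    · rw [integral_div, div_le_iff₀ (by positivity)]
      refine hble.trans (le_of_eq ?_)
      field_simp
  obtain ⟨X, hX⟩ := exists_le_integral hZint
  have hX1 : Z X < 1 := hX.trans_lt hZle
  have hb0 : 0 ≤ (badCount R s fun x => typeAt flip_flip s T X x : ℝ) / (t * (2 * n)) := by
    positivity
  have hQ0 : ∀ a, 0 ≤ Q a X / (2 * n * δ) ^ 2 := fun a => by rw [hQ]; positivity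
  refine ⟨fun x => typeAt flip_flip s T X x, fun a => ?_, ?_⟩
  · have h1 : Q a X / (2 * n * δ) ^ 2 ≤ 1 := by
      have := Finset.single_le_sum (fun b _ => hQ0 b) (Finset.mem_univ a)
      simp only [Z] at hX1
      linarith
    rw [hQ, ← div_pow, mul_div_mul_left _ _ (by positivity), sq_le_one_iff_abs_le_one, abs_div,
      abs_of_pos hδ, div_le_one hδ] at h1
    exact h1
  · have h1 : (badCount R s fun x => typeAt flip_flip s T X x : ℝ) / (t * (2 * n)) ≤ 1 := by
      have := Finset.sum_nonneg fun a (_ : a ∈ Finset.univ) => hQ0 a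
      simp only [Z] at hX1
      linarith
    rwa [div_le_one (by positivity)] at h1

open Classical in
theorem card_not_treeLike_mul_le (F : Finset (Vert d)) {l : ℕ}
    (hl : ∀ u ∈ enlarge F, ∀ v ∈ enlarge F, (word (v⁻¹ * u)).1.length ≤ l) {V : Type*} [Fintype V]
    [DecidableEq V] {τ : Equiv.Perm V} (h2 : ∀ x, τ (τ x) = x) (h1 : ∀ x, τ x ≠ x) (x : V) :
    ((Finset.univ : Finset (Fin d → Equiv.Perm V)).filter fun s => ¬ TreeLike h2 s F x).card *
      (Fintype.card V - l) ≤
      (enlarge F).card ^ 2 * l ^ 2 * Fintype.card (Fin d → Equiv.Perm V) := by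
  set M := Fintype.card (Fin d → Equiv.Perm V)
  -- Two words `u` and `v` lead from `x` to the same vertex exactly when `v⁻¹ * u` fixes `x`.
  let G : Vert d × Vert d → Finset (Fin d → Equiv.Perm V) := fun p =>
    Finset.univ.filter fun s => p.1 ≠ p.2 ∧ modelAct h2 s (p.2⁻¹ * p.1) x = x
  have hsub : (Finset.univ.filter fun s => ¬ TreeLike h2 s F x) ⊆
      (enlarge F ×ˢ enlarge F).biUnion G := by
    intro s hs
    have hs := (Finset.mem_filter.mp hs).2
    simp only [TreeLike, Set.InjOn, not_forall] at hs
    obtain ⟨u, hu, v, hv, huv, hne⟩ := hs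
    refine Finset.mem_biUnion.mpr ⟨(u, v), Finset.mem_product.mpr ⟨hu, hv⟩, ?_⟩
    simp only [G, Finset.mem_filter, Finset.mem_univ, true_and]
    refine ⟨hne, ?_⟩
    rw [map_mul, Equiv.Perm.mul_apply, huv, map_inv]
    simp
  have hG : ∀ p ∈ enlarge F ×ˢ enlarge F, (G p).card * (Fintype.card V - l) ≤ l ^ 2 * M := by
    rintro ⟨u, v⟩ hp
    obtain ⟨hu, hv⟩ := Finset.mem_product.mp hp
    by_cases hne : u = v
    · simp [G, hne]
    have hg : v⁻¹ * u ≠ 1 := fun h => hne (inv_mul_eq_one.mp h).symm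
    have hc := card_fixed_mul_le h2 h1 x hg
    have hlg := hl u hu v hv
    have hcard : (G (u, v)).card = {s : Fin d → Equiv.Perm V | modelAct h2 s (v⁻¹ * u) x = x}.ncard := by
      rw [← Set.ncard_coe_finset]
      congr 1
      ext s
      simp [G, hne]
    rw [hcard]
    calc _ ≤ _ := Nat.mul_le_mul_left _ (Nat.sub_le_sub_left hlg _)
      _ ≤ _ := hc
      _ ≤ l ^ 2 * M := Nat.mul_le_mul_right _ (Nat.pow_le_pow_left hlg 2)
  calc _ ≤ (∑ p ∈ enlarge F ×ˢ enlarge F, (G p).card) * (Fintype.card V - l) :=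
        Nat.mul_le_mul_right _ ((Finset.card_le_card hsub).trans Finset.card_biUnion_le)
    _ = ∑ p ∈ enlarge F ×ˢ enlarge F, (G p).card * (Fintype.card V - l) := Finset.sum_mul ..
    _ ≤ ∑ _p ∈ enlarge F ×ˢ enlarge F, l ^ 2 * M := Finset.sum_le_sum hG
    _ = _ := by rw [Finset.sum_const, Finset.card_product, smul_eq_mul]; ring

/-- At least half of the models have a bounded number of vertices that are not tree-like. -/
theorem exists_defect_bound (F : Finset (Vert d)) :
    ∃ C n₀ : ℕ, ∀ n, n₀ ≤ n → 0 < n →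
      Fintype.card (Fin d → Equiv.Perm (Fin n × Bool)) ≤
        2 * ((Finset.univ : Finset (Fin d → Equiv.Perm (Fin n × Bool))).filter fun s =>
          defect flip_flip s F ≤ C).card := by
  classical
  let l : ℕ := ((enlarge F) ×ˢ (enlarge F)).sup fun p => (word (p.2⁻¹ * p.1)).1.length
  have hl : ∀ u ∈ enlarge F, ∀ v ∈ enlarge F, (word (v⁻¹ * u)).1.length ≤ l := fun u hu v hv =>
    Finset.le_sup (f := fun p : Vert d × Vert d => (word (p.2⁻¹ * p.1)).1.length)
      (Finset.mem_product.mpr ⟨hu, hv⟩ : (u, v) ∈ _)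
  let K := (enlarge F).card ^ 2 * l ^ 2
  -- The mean defect is at most `2 * K`, so by Markov at most half of the models exceed twice that.
  -- The condition `l ≤ n` gives `n ≤ 2 * n - l` in the denominator.
  refine ⟨4 * K, l, fun n hn hn0 => ?_⟩
  set M := Fintype.card (Fin d → Equiv.Perm (Fin n × Bool))
  have hcard : Fintype.card (Fin n × Bool) = 2 * n := by simp [mul_comm]
  have hsum : ∑ s : Fin d → Equiv.Perm (Fin n × Bool), defect flip_flip s F =
      ∑ x : Fin n × Bool, ((Finset.univ : Finset (Fin d → Equiv.Perm (Fin n × Bool))).filter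
        fun s => ¬ TreeLike flip_flip s F x).card := by
    simp only [defect, Finset.card_filter]
    exact Finset.sum_comm
  have h1 : (∑ s : Fin d → Equiv.Perm (Fin n × Bool), defect flip_flip s F) * n ≤
      2 * n * (K * M) := by
    rw [hsum, Finset.sum_mul]
    calc _ ≤ ∑ _x : Fin n × Bool, K * M := by
          refine Finset.sum_le_sum fun x _ => ?_
          refine le_trans (Nat.mul_le_mul_left _ ?_)
            (card_not_treeLike_mul_le F hl flip_flip flip_ne x)
          rw [hcard]; omega
      _ = _ := by rw [Finset.sum_const, Finset.card_univ, hcard, smul_eq_mul]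
  have h2 : ∑ s : Fin d → Equiv.Perm (Fin n × Bool), defect flip_flip s F ≤ 2 * K * M := by
    refine Nat.le_of_mul_le_mul_right (le_trans h1 (le_of_eq ?_)) hn0
    ring
  set G := (Finset.univ : Finset (Fin d → Equiv.Perm (Fin n × Bool))).filter fun s =>
    defect flip_flip s F ≤ 4 * K
  set B := (Finset.univ : Finset (Fin d → Equiv.Perm (Fin n × Bool))).filter fun s =>
    ¬ defect flip_flip s F ≤ 4 * K
  have h3 : G.card + B.card = M := Finset.card_filter_add_card_filter_not _
  have h4 : B.card * (4 * K + 1) ≤ 2 * K * M := by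
    refine le_trans ?_ h2
    rw [← smul_eq_mul, ← Finset.sum_const]
    refine le_trans (Finset.sum_le_sum fun s hs => ?_)
      (Finset.sum_le_sum_of_subset (Finset.filter_subset _ _))
    have := (Finset.mem_filter.mp hs).2
    omega
  have h5 : 2 * B.card ≤ M := by
    by_contra hc
    push Not at hc
    nlinarith
  omega

theorem abs_pairMass_sub_le (R : A → A → Prop) [DecidableRel R] {p q : A → ℝ} {δ : ℝ}
    (hp : ∀ a, |p a| ≤ 1) (hq : ∀ a, |q a| ≤ 1) (h : ∀ a, |p a - q a| ≤ δ) :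
    pairMass R q - 2 * Fintype.card A ^ 2 * δ ≤ pairMass R p := by
  have hterm : ∀ a b, (if R a b then q a * q b else 0) - 2 * δ ≤ if R a b then p a * p b else 0 := by
    intro a b
    have hδ : 0 ≤ δ := (abs_nonneg _).trans (h a)
    split_ifs
    · have h1 : |(q a - p a) * q b| ≤ δ := by
        rw [abs_mul, abs_sub_comm]
        exact (mul_le_mul (h a) (hq b) (abs_nonneg _) hδ).trans (by linarith)
      have h2 : |p a * (q b - p b)| ≤ δ := by
        rw [abs_mul, abs_sub_comm]
        exact (mul_le_mul (hp a) (h b) (abs_nonneg _) zero_le_one).trans (by linarith)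
      have h3 := le_abs_self ((q a - p a) * q b)
      have h4 := le_abs_self (p a * (q b - p b))
      linarith
    · linarith
  have : ∑ a : A, ∑ b : A, ((if R a b then q a * q b else 0) - 2 * δ) ≤ pairMass R p :=
    Finset.sum_le_sum fun a _ => Finset.sum_le_sum fun b _ => hterm a b
  simp only [Finset.sum_sub_distrib, Finset.sum_const, Finset.card_univ, nsmul_eq_mul] at this
  refine le_trans (le_of_eq ?_) this
  rw [pairMass]
  ring

theorem tendsto_poly_mul_exp {c : ℝ} (hc : c < 0) (D : ℕ) :
    Tendsto (fun n : ℕ => (Real.exp 1 * (2 * n + 1)) ^ D * Real.exp (2 * n * c)) atTop (nhds 0) := by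
  have h1 := Real.tendsto_pow_mul_exp_neg_atTop_nhds_zero D
  have hlin : Tendsto (fun n : ℕ => (-c) * (2 * (n : ℝ) + 1)) atTop atTop := by
    refine Tendsto.const_mul_atTop (by linarith) ?_
    exact tendsto_atTop_add_const_right _ _
      (Tendsto.const_mul_atTop two_pos tendsto_natCast_atTop_atTop)
  have h2 := (h1.comp hlin).const_mul ((Real.exp 1 / (-c)) ^ D * Real.exp (-c))
  rw [mul_zero] at h2
  refine h2.congr fun n => ?_
  simp only [Function.comp]
  have hc' : -c ≠ 0 := by linarith
  rw [mul_pow, mul_pow, div_pow, show (2 : ℝ) * n * c = -c + -(-c * (2 * n + 1)) by ring,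
    Real.exp_add]
  field_simp

/-- The first moment bound for observables of independent labels on the tree. -/
theorem entropy_bound (hT : IsObservable F T) (R : A → A → Prop) [DecidableRel R]
    (hR : ∀ a b, R a b → R b a) (a₀ : A) {θ : ℝ} (hθ : 0 ≤ θ) {K : ℝ} (hK : 0 ≤ K) :
    d / 2 * (1 - Real.exp (-2 * θ)) * pairMass R (typeLaw μ T) ≤
      K * (1 - typeLaw μ T a₀) + Real.exp (-K) * Fintype.card A + θ * edgeMass μ R T := by
  classical
  set E := edgeMass μ R T with hE
  have hE0 : 0 ≤ E := Finset.sum_nonneg fun i _ => measureReal_nonneg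
  set q := 1 - typeLaw μ T a₀ with hq
  set m := (Fintype.card A : ℝ) with hm
  set ρ := d / 2 * (1 - Real.exp (-2 * θ)) with hρ
  have hρ0 : 0 ≤ ρ := by
    have : Real.exp (-2 * θ) ≤ 1 := Real.exp_le_one_iff.mpr (by linarith)
    have : 0 ≤ 1 - Real.exp (-2 * θ) := by linarith
    positivity
  -- If the exponent `c` per vertex of the union bound were negative, then for large `n` fewer than
  -- half of the models would carry a nearly typical colouring, although `exists_typical` provides
  -- one on at least half of them.
  have key : ∀ δ : ℝ, 0 < δ → 0 ≤ K * (q + δ) + Real.exp (-K) * m + θ * (E + δ) -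
      ρ * (pairMass R (typeLaw μ T) - 2 * m ^ 2 * δ) := by
    intro δ hδ
    by_contra hneg
    push Not at hneg
    set c := K * (q + δ) + Real.exp (-K) * m + θ * (E + δ) -
      ρ * (pairMass R (typeLaw μ T) - 2 * m ^ 2 * δ) with hc
    obtain ⟨C, n₀, hC⟩ := exists_defect_bound F
    have ev1 : ∀ᶠ n : ℕ in atTop, m * ((F.card ^ 2 + 2 * C : ℝ) / (2 * n * δ ^ 2)) +
        (E + d * C / (2 * n)) / (E + δ) < 1 := by
      have hlim : Tendsto (fun n : ℕ => m * ((F.card ^ 2 + 2 * C : ℝ) / (2 * n * δ ^ 2)) +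
        (E + d * C / (2 * n)) / (E + δ)) atTop (nhds (m * 0 + (E + 0) / (E + δ))) := by
        have hn : Tendsto (fun n : ℕ => 2 * (n : ℝ)) atTop atTop :=
          Tendsto.const_mul_atTop two_pos tendsto_natCast_atTop_atTop
        refine Tendsto.add (Tendsto.const_mul _ ?_) (Tendsto.div_const (Tendsto.const_add _ ?_) _)
        · exact Tendsto.const_div_atTop (hn.atTop_mul_const (by positivity)) _
        · exact Tendsto.const_div_atTop hn _
      refine (tendsto_order.mp hlim).2 1 ?_
      rw [mul_zero, zero_add, add_zero]
      exact (div_lt_one (by linarith)).mpr (by linarith)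
    have ev2 := (tendsto_order.mp (tendsto_poly_mul_exp hneg (Fintype.card A * d))).2 (1 / 2)
      (by norm_num)
    obtain ⟨n, ⟨⟨hn1, hn2⟩, hn3⟩, hn4⟩ :=
      (((ev1.and ev2).and (eventually_ge_atTop n₀)).and (eventually_ge_atTop 1)).exists
    have : NeZero n := ⟨by omega⟩
    have hnpos : (0 : ℝ) < n := by exact_mod_cast hn4
    have hne : Nonempty (Fin n × Bool) := ⟨(0, true)⟩
    have hcard : (Fintype.card (Fin n × Bool) : ℝ) = 2 * n := by simp [mul_comm]
    have hM := hC n hn3 hn4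
    set M := Fintype.card (Fin d → Equiv.Perm (Fin n × Bool)) with hMdef
    have hMpos : (0 : ℝ) < M := by exact_mod_cast Fintype.card_pos
    let Y : Finset (Fin n × Bool → A) := Finset.univ.filter fun y =>
      ∀ a, |freq y a - typeLaw μ T a| ≤ δ
    let bad : (Fin n × Bool → A) → Finset (Fin d → Equiv.Perm (Fin n × Bool)) := fun y =>
      Finset.univ.filter fun s => (badCount R s y : ℝ) ≤ (E + δ) * (2 * n)
    have hcover : (Finset.univ.filter fun s : Fin d → Equiv.Perm (Fin n × Bool) =>
        defect flip_flip s F ≤ C) ⊆ Y.biUnion bad := by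
      intro s hs
      have hs : (defect flip_flip s F : ℝ) ≤ C := by exact_mod_cast (Finset.mem_filter.mp hs).2
      have hEδ : 0 < E + δ := by linarith
      obtain ⟨y, hy1, hy2⟩ := exists_typical μ hT R s hδ hEδ (lt_of_le_of_lt (by gcongr) hn1)
      exact Finset.mem_biUnion.mpr ⟨y, by simpa [Y] using hy1, by simpa [bad] using hy2⟩
    -- The count uses only the frequency of `a₀`; the other frequencies enter through `pairMass` in
    -- `hbad`.
    have hYcard : (Y.card : ℝ) ≤ Real.exp (K * ((q + δ) * (2 * n)) + Real.exp (-K) * m * (2 * n)) := by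
      have h1 := card_few_le (V := Fin n × Bool) a₀ hK ((q + δ) * (2 * n))
      rw [hcard] at h1
      refine le_trans ?_ h1
      norm_cast
      refine Finset.card_le_card fun y hy => ?_
      have hy := (Finset.mem_filter.mp hy).2 a₀
      refine Finset.mem_filter.mpr ⟨Finset.mem_univ _, ?_⟩
      have h2 : ((Finset.univ.filter fun x => y x = a₀).card : ℝ) +
          (Finset.univ.filter fun x => ¬ y x = a₀).card = 2 * n := by
        rw [← hcard, ← Finset.card_univ (α := Fin n × Bool)]
        exact_mod_cast Finset.card_filter_add_card_filter_not (s := Finset.univ) fun x => y x = a₀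
      have h3 : ((Finset.univ.filter fun x => y x = a₀).card : ℝ) = 2 * n * freq y a₀ := by
        rw [freq, hcard]
        field_simp
      have h4 := (abs_le.mp hy).1
      push_cast
      have h5 : ((Finset.univ.filter fun x => ¬ y x = a₀).card : ℝ) = 2 * n * (1 - freq y a₀) := by
        linarith
      calc ((Finset.univ.filter fun x => ¬ y x = a₀).card : ℝ) = 2 * n * (1 - freq y a₀) := h5
        _ ≤ 2 * n * (q + δ) := by
          refine mul_le_mul_of_nonneg_left ?_ (by positivity)
          rw [hq]; linarith
        _ = _ := by ring
    have hbad : ∀ y ∈ Y, ((bad y).card : ℝ) ≤ M * (Real.exp 1 * (2 * n + 1)) ^ (Fintype.card A * d) *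
        Real.exp (θ * ((E + δ) * (2 * n)) -
          2 * n * (ρ * (pairMass R (typeLaw μ T) - 2 * m ^ 2 * δ))) := by
      intro y hy
      have hy := (Finset.mem_filter.mp hy).2
      refine (card_badCount_le R hR y hθ ((E + δ) * (2 * n))).trans ?_
      refine mul_le_mul_of_nonneg_left (Real.exp_le_exp.mpr ?_) (by positivity)
      refine sub_le_sub_left ?_ _
      have h1 := abs_pairMass_sub_le R (p := freq y) (q := typeLaw μ T) (δ := δ)
        (fun a => by
          rw [abs_of_nonneg (freq_nonneg y a), ← sum_freq y]
          exact Finset.single_le_sum (fun b _ => freq_nonneg _ b) (Finset.mem_univ a))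
        (fun a => by
          rw [abs_of_nonneg (typeLaw_nonneg μ T a)]; exact typeLaw_le_one μ T a) hy
      calc 2 * n * (ρ * (pairMass R (typeLaw μ T) - 2 * m ^ 2 * δ))
          ≤ 2 * n * (ρ * pairMass R (freq y)) := by gcongr
        _ = _ := by rw [hρ]; ring
    have hfin : (M : ℝ) ≤ 2 * (M * ((Real.exp 1 * (2 * n + 1)) ^ (Fintype.card A * d) *
        Real.exp (2 * n * c))) := by
      calc (M : ℝ) ≤ 2 * ((Y.biUnion bad).card : ℝ) := by
            exact_mod_cast hM.trans (Nat.mul_le_mul_left _ (Finset.card_le_card hcover))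
        _ ≤ 2 * ∑ y ∈ Y, ((bad y).card : ℝ) := by
            gcongr
            exact_mod_cast Finset.card_biUnion_le
        _ ≤ 2 * ((Y.card : ℝ) * (M * (Real.exp 1 * (2 * n + 1)) ^ (Fintype.card A * d) *
              Real.exp (θ * ((E + δ) * (2 * n)) -
                2 * n * (ρ * (pairMass R (typeLaw μ T) - 2 * m ^ 2 * δ))))) := by
            rw [← nsmul_eq_mul (Y.card)]
            gcongr
            exact Finset.sum_le_card_nsmul _ _ _ hbad
        _ ≤ 2 * (Real.exp (K * ((q + δ) * (2 * n)) + Real.exp (-K) * m * (2 * n)) *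
              (M * (Real.exp 1 * (2 * n + 1)) ^ (Fintype.card A * d) *
              Real.exp (θ * ((E + δ) * (2 * n)) -
                2 * n * (ρ * (pairMass R (typeLaw μ T) - 2 * m ^ 2 * δ))))) := by
            gcongr
        _ = _ := by
            have hexp : Real.exp (2 * n * c) =
                Real.exp (K * ((q + δ) * (2 * n)) + Real.exp (-K) * m * (2 * n)) *
                Real.exp (θ * ((E + δ) * (2 * n)) -
                  2 * n * (ρ * (pairMass R (typeLaw μ T) - 2 * m ^ 2 * δ))) := by
              rw [← Real.exp_add]
              congr 1
              rw [hc]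
              ring
            rw [hexp]
            ring
    nlinarith
  -- The errors in `key` amount to `B * δ`, so `δ = η / (B + 1)` suffices.
  refine le_of_forall_pos_le_add fun η hη => ?_
  set B := K + θ + 2 * ρ * m ^ 2 with hB
  have hB0 : 0 ≤ B := by positivity
  have h1 := key (η / (B + 1)) (by positivity)
  have h2 : B * (η / (B + 1)) ≤ η := by
    rw [mul_div_assoc', div_le_iff₀ (by positivity)]
    nlinarith
  rw [hB] at h2
  nlinarith

end Entropy

/-! ## The probability that two random sets intersect -/

section Intersection

/-- The sum of the monomials of degree `K + 1` in `a` and `b` that are divisible by `a * b`. -/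
def mixedSum (a b : ℝ) : ℕ → ℝ
  | 0 => 0
  | K + 1 => a * (mixedSum a b K + b ^ (K + 1))

theorem mixedSum_eq (a b : ℝ) (K : ℕ) :
    mixedSum a b K = ∑ i ∈ Finset.range K, a ^ (i + 1) * b ^ (K - i) := by
  induction K with
  | zero => rfl
  | succ K ih =>
    rw [Finset.sum_range_succ', mixedSum, ih, mul_add, Finset.mul_sum]
    congr 1
    · refine Finset.sum_congr rfl fun i _ => ?_
      rw [show K + 1 - (i + 1) = K - i by omega]
      ring
    · simp

/-- Chebyshev's sum inequality: `a ^ (i + 1)` decreases in `i` while `b ^ (K - i)` increases. -/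
theorem card_mul_mixedSum_le {a b : ℝ} (ha : 0 ≤ a) (ha1 : a ≤ 1) (hb : 0 ≤ b) (hb1 : b ≤ 1)
    (K : ℕ) : K * mixedSum a b K ≤
      (∑ i ∈ Finset.range K, a ^ (i + 1)) * ∑ i ∈ Finset.range K, b ^ (i + 1) := by
  have hanti : AntivaryOn (fun i => a ^ (i + 1)) (fun i => b ^ (K - i)) (Finset.range K) := by
    refine AntitoneOn.antivaryOn (fun i _ j _ hij => ?_) (fun i _ j _ hij => ?_)
    · exact pow_le_pow_of_le_one ha ha1 (by omega)
    · exact pow_le_pow_of_le_one hb hb1 (by omega)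
  have h := hanti.card_mul_sum_le_sum_mul_sum
  rw [Finset.card_range, ← mixedSum_eq] at h
  have hrefl : ∑ i ∈ Finset.range K, b ^ (K - i) = ∑ i ∈ Finset.range K, b ^ (i + 1) := by
    rw [← Finset.sum_range_reflect]
    refine Finset.sum_congr rfl fun i hi => ?_
    have := Finset.mem_range.mp hi
    congr 1
    omega
  rwa [hrefl] at h

/-- If `u` is the left-hand side, its successor is `a * u + (1 - a) * b ^ (K + 2)`, while the base
on the right is `a + (1 - a) * b`. The induction step therefore also needs `b ^ (K + 1) ≤ u`, which
is carried along. -/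
theorem pow_add_pow_sub_le {a b : ℝ} (ha : 0 ≤ a) (ha1 : a ≤ 1) (hb : 0 ≤ b) (hb1 : b ≤ 1) (K : ℕ) :
    a ^ (K + 1) + b ^ (K + 1) - mixedSum a b (K + 1) + mixedSum a b K ≤
      (a + b - a * b) ^ (K + 1) := by
  have hv : a + b - a * b = a + (1 - a) * b := by ring
  suffices h : b ^ (K + 1) ≤ a ^ (K + 1) + b ^ (K + 1) - mixedSum a b (K + 1) + mixedSum a b K ∧
      a ^ (K + 1) + b ^ (K + 1) - mixedSum a b (K + 1) + mixedSum a b K ≤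
        (a + b - a * b) ^ (K + 1) from h.2
  induction K with
  | zero =>
    simp only [mixedSum, zero_add, pow_one, add_zero]
    constructor <;> nlinarith
  | succ K ih =>
    set u := a ^ (K + 1) + b ^ (K + 1) - mixedSum a b (K + 1) + mixedSum a b K with hu
    have hrec : a ^ (K + 1 + 1) + b ^ (K + 1 + 1) - mixedSum a b (K + 1 + 1) + mixedSum a b (K + 1) =
        a * u + (1 - a) * b ^ (K + 1 + 1) := by
      rw [hu]
      simp only [mixedSum]
      ring
    rw [hrec]
    have hbK : 0 ≤ b ^ (K + 1) := by positivity
    constructor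
    · have h1 : b ^ (K + 1 + 1) ≤ b ^ (K + 1) := pow_le_pow_of_le_one hb hb1 (by omega)
      nlinarith [ih.1]
    · calc a * u + (1 - a) * b ^ (K + 1 + 1) = a * u + (1 - a) * b * b ^ (K + 1) := by ring
        _ ≤ a * u + (1 - a) * b * u := by
            have : 0 ≤ (1 - a) * b := mul_nonneg (by linarith) hb
            nlinarith [ih.1]
        _ = (a + b - a * b) * u := by ring
        _ ≤ (a + b - a * b) * (a + b - a * b) ^ (K + 1) := by
            refine mul_le_mul_of_nonneg_left ih.2 ?_
            nlinarith
        _ = _ := by ring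

/-- On summing `pow_add_pow_sub_le` the mixed terms telescope. -/
theorem sum_pow_ge {a b : ℝ} (ha : 0 ≤ a) (ha1 : a ≤ 1) (hb : 0 ≤ b) (hb1 : b ≤ 1) (K : ℕ) :
    ∑ i ∈ Finset.range K, a ^ (i + 1) + ∑ i ∈ Finset.range K, b ^ (i + 1) - mixedSum a b K ≤
      ∑ i ∈ Finset.range K, (a + b - a * b) ^ (i + 1) := by
  induction K with
  | zero => simp [mixedSum]
  | succ K ih =>
    rw [Finset.sum_range_succ, Finset.sum_range_succ, Finset.sum_range_succ]
    have := pow_add_pow_sub_le ha ha1 hb hb1 K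
    linarith

/-- The probability that a binomial random variable with parameters `k` and `w` is positive. -/
def hit (k : ℕ) (w : ℝ) : ℝ := 1 - (1 - w) ^ k

theorem hit_succ (K : ℕ) (w : ℝ) :
    hit (K + 1) w = w + w * ∑ i ∈ Finset.range K, (1 - w) ^ (i + 1) := by
  induction K with
  | zero => simp [hit]
  | succ K ih =>
    rw [Finset.sum_range_succ, mul_add, ← add_assoc, ← ih]
    simp only [hit]
    ring

/-- This is `sum_pow_ge` for `1 - w` and `1 - w'`, multiplied by `w * w'`. Every term on the left is
a product of a function of `w` and a function of `w'`, so its mean over independent `w` and `w'` is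
explicit. For `K = 0` the quotient is zero and equality holds. -/
theorem hit_mul_ge {w w' : ℝ} (h0 : 0 ≤ w) (h1 : w ≤ 1) (h0' : 0 ≤ w') (h1' : w' ≤ 1) (K : ℕ) :
    w' * hit (K + 1) w + w * hit (K + 1) w' - w * w' -
      (hit (K + 1) w - w) * (hit (K + 1) w' - w') / K ≤ hit (K + 1) (w * w') := by
  have e : (1 - w) + (1 - w') - (1 - w) * (1 - w') = 1 - w * w' := by ring
  have hs := sum_pow_ge (a := 1 - w) (b := 1 - w') (by linarith) (by linarith) (by linarith)
    (by linarith) K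
  have hm := card_mul_mixedSum_le (a := 1 - w) (b := 1 - w') (by linarith) (by linarith)
    (by linarith) (by linarith) K
  rw [e] at hs
  simp only [hit_succ]
  set S := ∑ i ∈ Finset.range K, (1 - w) ^ (i + 1)
  set S' := ∑ i ∈ Finset.range K, (1 - w') ^ (i + 1)
  set D := mixedSum (1 - w) (1 - w') K with hD
  have hDle : D ≤ S * S' / K := by
    rcases Nat.eq_zero_or_pos K with hK | hK
    · rw [hD, hK]; simp [mixedSum]
    · have : (0 : ℝ) < K := by exact_mod_cast hK
      rw [le_div_iff₀ this]
      linarith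
  have hww : 0 ≤ w * w' := mul_nonneg h0 h0'
  have h2 := mul_le_mul_of_nonneg_left hs hww
  have h3 := mul_le_mul_of_nonneg_left hDle hww
  have h4 : (w + w * S - w) * (w' + w' * S' - w') / K = w * w' * (S * S' / K) := by ring
  rw [h4]
  nlinarith

variable {k : ℕ}

/-- The probability that independent coins with bias `w` show the pattern `a`. -/
def coins (w : ℝ) (a : Fin k → Bool) : ℝ := ∏ j, if a j then w else 1 - w

/-- Two patterns meet if some coin shows heads in both. -/
def Meets (a b : Fin k → Bool) : Prop := ∃ j, a j = true ∧ b j = true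

instance : DecidableRel (Meets (k := k)) := fun _ _ => by unfold Meets; infer_instance

/-- In each position both coins show heads with probability `w * w'`, independently over the
positions. -/
theorem pairSum_coins (w w' : ℝ) :
    (∑ a : Fin k → Bool, ∑ b : Fin k → Bool, if Meets a b then coins w a * coins w' b else 0) =
      hit k (w * w') := by
  have h1 : (1 : ℝ) = ∑ a : Fin k → Bool, ∑ b : Fin k → Bool, coins w a * coins w' b := by
    rw [← Finset.sum_mul_sum]
    unfold coins
    have : ∀ v : ℝ, ∑ a : Fin k → Bool, ∏ j, (if a j then v else 1 - v) = 1 := by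
      intro v
      have := Finset.prod_univ_sum (fun _ : Fin k => (Finset.univ : Finset Bool))
        fun _ c => if c then v else 1 - v
      rw [Fintype.piFinset_univ] at this
      rw [← this]
      simp
    rw [this, this, one_mul]
  have h2 : (1 - w * w') ^ k = ∑ a : Fin k → Bool, ∑ b : Fin k → Bool,
      if Meets a b then 0 else coins w a * coins w' b := by
    have h3 := Finset.prod_univ_sum (fun _ : Fin k => (Finset.univ : Finset (Bool × Bool)))
      fun _ c => if c.1 = true ∧ c.2 = true then 0 else
        (if c.1 then w else 1 - w) * (if c.2 then w' else 1 - w')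
    rw [Fintype.piFinset_univ] at h3
    have h4 : ∏ _j : Fin k, ∑ c : Bool × Bool, (if c.1 = true ∧ c.2 = true then 0 else
        (if c.1 then w else 1 - w) * (if c.2 then w' else 1 - w')) = (1 - w * w') ^ k := by
      rw [Finset.prod_const, Finset.card_univ, Fintype.card_fin, Fintype.sum_prod_type]
      congr 1
      simp
      ring
    rw [← h4, h3, ← Fintype.sum_prod_type' (f := fun a b : Fin k → Bool =>
      if Meets a b then (0 : ℝ) else coins w a * coins w' b)]
    refine Fintype.sum_equiv (Equiv.arrowProdEquivProdArrow _ _ _) _ _ fun c => ?_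
    set e := Equiv.arrowProdEquivProdArrow (Fin k) (fun _ => Bool) (fun _ => Bool) c with he
    by_cases hc : ∃ j, (c j).1 = true ∧ (c j).2 = true
    · have hm : Meets e.1 e.2 := hc
      rw [if_pos hm]
      obtain ⟨j, hj⟩ := hc
      exact Finset.prod_eq_zero (Finset.mem_univ j) (if_pos hj)
    · have hm : ¬ Meets e.1 e.2 := hc
      rw [if_neg hm, coins, coins, ← Finset.prod_mul_distrib]
      refine Finset.prod_congr rfl fun j _ => ?_
      rw [if_neg fun h => hc ⟨j, h⟩]
      rfl
  rw [hit, h2]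
  nth_rewrite 1 [h1]
  rw [← Finset.sum_sub_distrib]
  refine Finset.sum_congr rfl fun a _ => ?_
  rw [← Finset.sum_sub_distrib]
  refine Finset.sum_congr rfl fun b _ => ?_
  split_ifs <;> ring

theorem coins_nonneg {w : ℝ} (h0 : 0 ≤ w) (h1 : w ≤ 1) (a : Fin k → Bool) : 0 ≤ coins w a :=
  Finset.prod_nonneg fun j _ => by split_ifs <;> linarith

theorem coins_le_one {w : ℝ} (h0 : 0 ≤ w) (h1 : w ≤ 1) (a : Fin k → Bool) : coins w a ≤ 1 :=
  Finset.prod_le_one (fun j _ => by split_ifs <;> linarith) fun j _ => by split_ifs <;> linarith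

theorem measurable_coins (a : Fin k → Bool) : Measurable fun w : ℝ => coins w a := by
  unfold coins
  refine Finset.measurable_prod _ fun j _ => ?_
  split_ifs <;> fun_prop

theorem coins_false (w : ℝ) : coins w (fun _ : Fin k => false) = 1 - hit k w := by
  simp [coins, hit]

variable {Z : Type*} [MeasurableSpace Z] (ρ : Measure Z) [IsProbabilityMeasure ρ]

/-- A lower bound for the probability that two independent random patterns with conditionally
independent entries meet. -/
theorem pairMass_coins_ge {K : ℕ} {W : Z → ℝ} (hW : Measurable W) (h0 : ∀ z, 0 ≤ W z)
    (h1 : ∀ z, W z ≤ 1) (π : (Fin (K + 1) → Bool) → ℝ) (hπ : ∀ a, π a = ∫ z, coins (W z) a ∂ρ) :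
    2 * (1 - π fun _ => false) * (∫ z, W z ∂ρ) - (∫ z, W z ∂ρ) ^ 2 -
      ((1 - π fun _ => false) - ∫ z, W z ∂ρ) ^ 2 / K ≤ pairMass Meets π := by
  have hbdd : ∀ {f : Z → ℝ}, Measurable f → (∀ z, 0 ≤ f z) → (∀ z, f z ≤ 1) → Integrable f ρ :=
    fun hf hf0 hf1 => Integrable.of_bound hf.aestronglyMeasurable 1 (ae_of_all _ fun z => by
      rw [Real.norm_eq_abs, abs_of_nonneg (hf0 z)]; exact hf1 z)
  have iW : Integrable W ρ := hbdd hW h0 h1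
  have iC : ∀ a : Fin (K + 1) → Bool, Integrable (fun z => coins (W z) a) ρ := fun a =>
    hbdd ((measurable_coins a).comp hW) (fun z => coins_nonneg (h0 z) (h1 z) a)
      fun z => coins_le_one (h0 z) (h1 z) a
  have iH : Integrable (fun z => hit (K + 1) (W z)) ρ := by
    have : (fun z => hit (K + 1) (W z)) =
        fun z => 1 - coins (W z) (fun _ : Fin (K + 1) => false) := by
      funext z; rw [coins_false]; ring
    rw [this]
    exact (integrable_const _).sub (iC _)
  have hq : 1 - π (fun _ => false) = ∫ z, hit (K + 1) (W z) ∂ρ := by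
    rw [hπ]
    simp_rw [coins_false]
    rw [integral_sub (integrable_const _) iH]
    simp
  rw [hq]
  set q := ∫ z, hit (K + 1) (W z) ∂ρ
  set x := ∫ z, W z ∂ρ
  have iCC : ∀ a b : Fin (K + 1) → Bool, Integrable (fun p : Z × Z =>
      if Meets a b then coins (W p.1) a * coins (W p.2) b else 0) (ρ.prod ρ) := by
    intro a b
    split_ifs
    · exact (iC a).mul_prod (iC b)
    · exact integrable_zero _ _ _
  have hβ : pairMass Meets π = ∫ p : Z × Z, hit (K + 1) (W p.1 * W p.2) ∂(ρ.prod ρ) := by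
    simp_rw [← pairSum_coins]
    rw [integral_finsetSum _ fun a _ => integrable_finsetSum _ fun b _ => iCC a b, pairMass]
    refine Finset.sum_congr rfl fun a _ => ?_
    rw [integral_finsetSum _ fun b _ => iCC a b]
    refine Finset.sum_congr rfl fun b _ => ?_
    split_ifs with hab
    · rw [integral_prod_mul (fun z => coins (W z) a) fun z => coins (W z) b, hπ, hπ]
    · simp
  have iβ : Integrable (fun p : Z × Z => hit (K + 1) (W p.1 * W p.2)) (ρ.prod ρ) := by
    simp_rw [← pairSum_coins]
    exact integrable_finsetSum _ fun a _ => integrable_finsetSum _ fun b _ => iCC a b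
  have i1 : Integrable (fun p : Z × Z => hit (K + 1) (W p.1) * W p.2) (ρ.prod ρ) := iH.mul_prod iW
  have i2 : Integrable (fun p : Z × Z => W p.1 * hit (K + 1) (W p.2)) (ρ.prod ρ) := iW.mul_prod iH
  have i3 : Integrable (fun p : Z × Z => W p.1 * W p.2) (ρ.prod ρ) := iW.mul_prod iW
  have i4 : Integrable (fun p : Z × Z => (hit (K + 1) (W p.1) - W p.1) *
      (hit (K + 1) (W p.2) - W p.2)) (ρ.prod ρ) := (iH.sub iW).mul_prod (iH.sub iW)
  have i12 : Integrable (fun p : Z × Z => hit (K + 1) (W p.1) * W p.2 +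
      W p.1 * hit (K + 1) (W p.2)) (ρ.prod ρ) := i1.add i2
  have i123 : Integrable (fun p : Z × Z => hit (K + 1) (W p.1) * W p.2 +
      W p.1 * hit (K + 1) (W p.2) - W p.1 * W p.2) (ρ.prod ρ) := i12.sub i3
  -- All products separate, so the bound of `hit_mul_ge` integrates to an expression in the two
  -- means `q` and `x` alone.
  have hlow : ∫ p : Z × Z, (hit (K + 1) (W p.1) * W p.2 + W p.1 * hit (K + 1) (W p.2) -
      W p.1 * W p.2 - (hit (K + 1) (W p.1) - W p.1) * (hit (K + 1) (W p.2) - W p.2) / K)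
        ∂(ρ.prod ρ) = q * x + x * q - x * x - (q - x) * (q - x) / K := by
    rw [integral_sub i123 (i4.div_const _), integral_sub i12 i3,
      integral_add i1 i2, integral_div,
      integral_prod_mul (fun z => hit (K + 1) (W z)) W, integral_prod_mul W fun z => hit (K + 1) (W z),
      integral_prod_mul W W, integral_prod_mul (fun z => hit (K + 1) (W z) - W z)
        fun z => hit (K + 1) (W z) - W z, integral_sub iH iW]
  rw [hβ]
  calc _ = q * x + x * q - x * x - (q - x) * (q - x) / K := by ring
    _ = _ := hlow.symm
    _ ≤ _ := by
      refine integral_mono (i123.sub (i4.div_const _)) iβ fun p => ?_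
      have := hit_mul_ge (h0 p.1) (h1 p.1) (h0 p.2) (h1 p.2) K
      simp only
      linarith

end Intersection

/-! ## Coupled copies of a percolation process -/

section Flip

variable {U J L : Type*} [MeasurableSpace L] (μ : Measure L) [IsProbabilityMeasure μ]

theorem iidLaw_map_comp {W : Type*} {a : U → W} (ha : Function.Injective a) :
    (iidLaw W μ).map (fun X u => X (a u)) = iidLaw U μ :=
  Measure.map_infinitePi_infinitePi_of_inj (P := fun _ : W => μ) ha

theorem iidLaw_map_map {L' : Type*} [MeasurableSpace L'] (μ' : Measure L') [IsProbabilityMeasure μ']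
    {f : L → L'} (hf : MeasurePreserving f μ μ') :
    MeasurePreserving (fun X (u : U) => f (X u)) (iidLaw U μ) (iidLaw U μ') := by
  refine ⟨by have := hf.measurable; fun_prop, ?_⟩
  unfold iidLaw
  rw [Measure.infinitePi_map_pi (μ := fun _ : U => μ) fun _ => hf.measurable]
  simp_rw [hf.map_eq]

theorem iidLaw_flip :
    MeasurePreserving (fun (Y : J → U → L) u j => Y j u) (iidLaw J (iidLaw U μ))
      (iidLaw U (iidLaw J μ)) := by
  have m1 : Measurable fun (Y : J → U → L) u j => Y j u := by fun_prop
  refine ⟨m1, ?_⟩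
  have e1 : (iidLaw (J × U) μ).map (MeasurableEquiv.curry J U L) = iidLaw J (iidLaw U μ) :=
    Measure.infinitePi_map_curry fun _ _ => μ
  have e2 : (iidLaw (U × J) μ).map (MeasurableEquiv.curry U J L) = iidLaw U (iidLaw J μ) :=
    Measure.infinitePi_map_curry fun _ _ => μ
  have e3 := iidLaw_map_comp μ (a := (Prod.swap : U × J → J × U)) Prod.swap_injective
  rw [← e1, ← e2, ← e3, Measure.map_map m1 (by fun_prop),
    Measure.map_map (by fun_prop) (by fun_prop)]
  rfl

theorem iidLaw_eq_pi [Fintype J] : iidLaw J μ = Measure.pi fun _ => μ :=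
  Measure.infinitePi_eq_pi _

/-- Separates the shared labels, indexed by `J`, from the private ones, indexed by `J'`, so that one
can condition on the former. -/
theorem iidLaw_split {J' : Type*} [Fintype J] [Fintype J'] :
    MeasurePreserving (fun (p : (J → U → L) × (J' → U → L)) u (j : J ⊕ J') =>
        Sum.elim (fun i => p.1 i u) (fun i => p.2 i u) j)
      ((iidLaw J (iidLaw U μ)).prod (iidLaw J' (iidLaw U μ))) (iidLaw U (iidLaw (J ⊕ J') μ)) := by
  have h1 := measurePreserving_sumPiEquivProdPi_symm (ι := J) (ι' := J')
    (fun _ : J ⊕ J' => iidLaw U μ)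
  rw [← iidLaw_eq_pi, ← iidLaw_eq_pi, ← iidLaw_eq_pi] at h1
  have h2 := (iidLaw_flip (U := U) (J := J ⊕ J') μ).comp h1
  convert h2 using 1
  funext p u j
  cases j <;> rfl

end Flip

/-! ### Copies that share a random part of their labels. -/

section Mix

variable {k : ℕ}

/-- The label used by the `j`-th copy: shared if the first entry is below `p`, private
otherwise. -/
noncomputable def mix (p : ℝ) (j : Fin k) (l : Bool ⊕ Fin k → I) : I :=
  if (l (Sum.inl false) : ℝ) < p then l (Sum.inl true) else l (Sum.inr j)

theorem measurableSet_lt_label {J : Type*} (i : J) (p : ℝ) :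
    MeasurableSet {l : J → I | (l i : ℝ) < p} :=
  measurableSet_lt (measurable_subtype_coe.comp (measurable_pi_apply i)) measurable_const

theorem measurable_mix (p : ℝ) (j : Fin k) : Measurable (mix p j) :=
  Measurable.ite (measurableSet_lt_label _ p) (measurable_pi_apply _) (measurable_pi_apply _)

theorem iidLaw_two {J L : Type*} [MeasurableSpace L] (μ : Measure L) [IsProbabilityMeasure μ]
    {i j : J} (hij : i ≠ j) {S S' : Set L} (hS : MeasurableSet S) (hS' : MeasurableSet S') :
    iidLaw J μ {l | l i ∈ S ∧ l j ∈ S'} = μ S * μ S' := by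
  have h := Measure.infinitePi_map_eval_prod (P := fun _ : J => μ) hij
  have h2 := congrArg (fun ν => ν (S ×ˢ S')) h
  simp only [Measure.prod_prod] at h2
  rw [Measure.map_apply (by fun_prop) (hS.prod hS')] at h2
  exact h2

/-- The selector is independent of both candidate labels, so the chosen one is uniform. Hence each
single copy has the law of the original process, whatever `p` is. -/
theorem measurePreserving_mix (p : ℝ) (j : Fin k) :
    MeasurePreserving (mix p j) (iidLaw (Bool ⊕ Fin k) (volume : Measure I)) volume := by
  refine ⟨measurable_mix p j, ?_⟩
  ext S hS
  rw [Measure.map_apply (measurable_mix p j) hS]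
  let D : Set I := {t | (t : ℝ) < p}
  have hD : MeasurableSet D := measurableSet_lt measurable_subtype_coe measurable_const
  have hunion : mix p j ⁻¹' S = {l | l (Sum.inl false) ∈ D ∧ l (Sum.inl true) ∈ S} ∪
      {l | l (Sum.inl false) ∈ Dᶜ ∧ l (Sum.inr j) ∈ S} := by
    ext l
    by_cases h : (l (Sum.inl false) : ℝ) < p
    · simp [mix, D, h, Set.mem_preimage]
    · simp [mix, D, h, not_lt.mp h, Set.mem_preimage]
  rw [hunion, measure_union, iidLaw_two _ (by simp) hD hS, iidLaw_two _ (by simp) hD.compl hS,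
    ← add_mul, measure_add_measure_compl hD, measure_univ, one_mul]
  · rw [Set.disjoint_left]
    exact fun l h1 h2 => h2.1 h1.1
  · have m1 : Measurable fun l : Bool ⊕ Fin k → I => l (Sum.inl false) := measurable_pi_apply _
    have m2 : Measurable fun l : Bool ⊕ Fin k → I => l (Sum.inr j) := measurable_pi_apply _
    exact (m1 hD.compl).inter (m2 hS)

variable {d : ℕ} {F : Finset (Vert d)} (B : Set (Vert d → I))

open Classical in
/-- The pattern of those among `k` coupled copies of the percolation `B` in which the root is
open. -/
noncomputable def pattern (k : ℕ) (p : ℝ) (X : Vert d → Bool ⊕ Fin k → I) (j : Fin k) : Bool :=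
  decide ((fun u => mix p j (X u)) ∈ B)

/-- The labels seen by a copy with private labels `c`. -/
noncomputable def mixed (p : ℝ) (z : Bool → Vert d → I) (c : Vert d → I) : Vert d → I :=
  fun u => if (z false u : ℝ) < p then z true u else c u

/-- The conditional probability that the root is open given the shared labels. -/
noncomputable def condOpen (p : ℝ) (z : Bool → Vert d → I) : ℝ :=
  (iidLaw (Vert d) (volume : Measure I)).real {c | mixed p z c ∈ B}

theorem measurable_mixed (p : ℝ) :
    Measurable fun q : (Bool → Vert d → I) × (Vert d → I) => mixed p q.1 q.2 := by
  refine measurable_pi_lambda _ fun u => Measurable.ite ?_ (by fun_prop) (by fun_prop)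
  exact measurableSet_lt (by fun_prop) measurable_const

variable {B} (hB : MeasurableSet B)

include hB

theorem measurableSet_mixed (p : ℝ) :
    MeasurableSet {q : (Bool → Vert d → I) × (Vert d → I) | mixed p q.1 q.2 ∈ B} :=
  measurable_mixed p hB

theorem measurable_condOpen (p : ℝ) : Measurable (condOpen B p) :=
  (measurable_measure_prodMk_left (ν := iidLaw (Vert d) (volume : Measure I))
    (measurableSet_mixed hB p)).ennreal_toReal

open Classical in
theorem isObservable_pattern (hloc : IsLocal F B) (p : ℝ) :
    IsObservable F (pattern B k p) := by
  refine ⟨fun a => ?_, fun X X' h => ?_⟩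
  · have : {X | pattern B k p X = a} =
        ⋂ j, {X | decide ((fun u => mix p j (X u)) ∈ B) = a j} := by
      ext X
      simp only [Set.mem_iInter]
      exact funext_iff
    rw [this]
    refine MeasurableSet.iInter fun j => ?_
    have hm : Measurable fun (X : Vert d → Bool ⊕ Fin k → I) u => mix p j (X u) :=
      measurable_pi_lambda _ fun u => (measurable_mix p j).comp (measurable_pi_apply u)
    cases h : a j with
    | true => simp only [decide_eq_true_eq]; exact hm hB
    | false => simp only [decide_eq_false_iff_not]; exact (hm hB).compl
  · funext j
    have := hloc (fun u => mix p j (X u)) (fun u => mix p j (X' u)) fun u hu => by rw [h u hu]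
    exact decide_eq_decide.mpr this

theorem prob_copy_open (p : ℝ) (j : Fin k) :
    (iidLaw (Vert d) (iidLaw (Bool ⊕ Fin k) (volume : Measure I))).real
      {X | (fun u => mix p j (X u)) ∈ B} = (iidLaw (Vert d) (volume : Measure I)).real B :=
  (iidLaw_map_map (U := Vert d) _ _ (measurePreserving_mix p j)).measureReal_preimage
    hB.nullMeasurableSet

/-- A union bound over the copy that is open at both ends. -/
theorem edgeMass_pattern_le (p : ℝ) :
    edgeMass (iidLaw (Bool ⊕ Fin k) (volume : Measure I)) Meets (pattern B k p) ≤
      k * ∑ i : Fin d, (iidLaw (Vert d) (volume : Measure I)).real {X | X ∈ B ∧ shift (gen i) X ∈ B} := by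
  rw [edgeMass, Finset.mul_sum]
  refine Finset.sum_le_sum fun i _ => ?_
  have hsub : {X | Meets (pattern B k p X) (pattern B k p (shift (gen i) X))} ⊆
      ⋃ j ∈ (Finset.univ : Finset (Fin k)), {X | (fun u => mix p j (X u)) ∈
        {X : Vert d → I | X ∈ B ∧ shift (gen i) X ∈ B}} := by
    rintro X ⟨j, h1, h2⟩
    simp only [pattern, decide_eq_true_eq] at h1 h2
    simp only [Set.mem_iUnion]
    exact ⟨j, Finset.mem_univ j, h1, h2⟩
  refine (measureReal_mono hsub (measure_ne_top _ _)).trans ((measureReal_biUnion_finset_le _ _).trans (le_of_eq ?_))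
  have hm : MeasurableSet {X : Vert d → I | X ∈ B ∧ shift (gen i) X ∈ B} :=
    hB.inter (measurable_shift _ hB)
  rw [Finset.sum_congr rfl fun j _ => prob_copy_open hm p j, Finset.sum_const, Finset.card_univ,
    Fintype.card_fin, nsmul_eq_mul]

theorem integral_condOpen (p : ℝ) :
    ∫ z, condOpen B p z ∂(iidLaw Bool (iidLaw (Vert d) (volume : Measure I))) =
      (iidLaw (Vert d) (volume : Measure I)).real B := by
  rw [← prob_copy_open hB p (0 : Fin 1)]
  have hmp := iidLaw_split (U := Vert d) (J := Bool) (J' := Fin 1) (volume : Measure I)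
  have hm : MeasurableSet {X : Vert d → Bool ⊕ Fin 1 → I | (fun u => mix p 0 (X u)) ∈ B} :=
    (iidLaw_map_map (U := Vert d) _ _ (measurePreserving_mix p (0 : Fin 1))).measurable hB
  rw [← hmp.measureReal_preimage hm.nullMeasurableSet, Measure.real,
    Measure.prod_apply (hmp.measurable hm), ← integral_toReal
    (measurable_measure_prodMk_left (hmp.measurable hm)).aemeasurable
    (ae_of_all _ fun z => measure_lt_top _ _)]
  refine integral_congr_ae (ae_of_all _ fun z => ?_)
  have hev : MeasurePreserving (fun c : Fin 1 → Vert d → I => c 0)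
      (iidLaw (Fin 1) (iidLaw (Vert d) (volume : Measure I))) (iidLaw (Vert d) volume) :=
    measurePreserving_eval_infinitePi (fun _ : Fin 1 => iidLaw (Vert d) (volume : Measure I)) 0
  have hms : MeasurableSet {c | mixed p z c ∈ B} :=
    (measurable_mixed p).comp measurable_prodMk_left hB
  exact (hev.measureReal_preimage hms.nullMeasurableSet).symm

-- Given the shared labels, the copies depend on separate families of private labels. They are then
-- independent coins with common bias `condOpen`.
open Classical in
theorem typeLaw_pattern (p : ℝ) (a : Fin k → Bool) (hloc : IsLocal F B) :
    typeLaw (iidLaw (Bool ⊕ Fin k) (volume : Measure I)) (pattern B k p) a =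
      ∫ z, coins (condOpen B p z) a ∂(iidLaw Bool (iidLaw (Vert d) (volume : Measure I))) := by
  have hmp := iidLaw_split (U := Vert d) (J := Bool) (J' := Fin k) (volume : Measure I)
  have hm := (isObservable_pattern (k := k) hB hloc p).measurable a
  rw [typeLaw, ← hmp.measureReal_preimage hm.nullMeasurableSet, Measure.real,
    Measure.prod_apply (hmp.measurable hm), ← integral_toReal
    (measurable_measure_prodMk_left (hmp.measurable hm)).aemeasurable
    (ae_of_all _ fun z => measure_lt_top _ _)]
  refine integral_congr_ae (ae_of_all _ fun z => ?_)
  have hms : MeasurableSet {c | mixed p z c ∈ B} :=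
    (measurable_mixed p).comp measurable_prodMk_left hB
  let D : Fin k → Set (Vert d → I) := fun j =>
    if a j then {c | mixed p z c ∈ B} else {c | mixed p z c ∈ B}ᶜ
  have hbox : Prod.mk z ⁻¹' ((fun (p : (Bool → Vert d → I) × (Fin k → Vert d → I)) u
      (j : Bool ⊕ Fin k) => Sum.elim (fun i => p.1 i u) (fun i => p.2 i u) j) ⁻¹'
        {X | pattern B k p X = a}) = Set.pi Set.univ D := by
    ext c
    change pattern B k p _ = a ↔ _
    rw [funext_iff, Set.mem_univ_pi]
    refine forall_congr' fun j => ?_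
    change decide (mixed p z (c j) ∈ B) = a j ↔ c j ∈ D j
    cases h : a j <;> simp [D, h]
  simp only [hbox]
  rw [iidLaw_eq_pi, Measure.pi_pi, ENNReal.toReal_prod, coins]
  refine Finset.prod_congr rfl fun j _ => ?_
  cases h : a j
  · simp only [D, h, Bool.false_eq_true, if_false]
    exact probReal_compl_eq_one_sub hms
  · simp only [D, h, if_true]
    rfl

theorem condOpen_zero (z : Bool → Vert d → I) :
    condOpen B 0 z = (iidLaw (Vert d) (volume : Measure I)).real B := by
  unfold condOpen
  congr 1
  ext c
  have : mixed 0 z c = c := by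
    funext u
    simp [mixed, (z false u).2.1]
  simp [this]

-- The value 2 lies above every label, the label 1 included, so here all copies coincide surely and
-- not just almost surely.
open Classical in
theorem condOpen_two (z : Bool → Vert d → I) :
    condOpen B 2 z = if z true ∈ B then 1 else 0 := by
  unfold condOpen
  have : ∀ c, mixed 2 z c = z true := by
    intro c
    funext u
    have : (z false u : ℝ) < 2 := lt_of_le_of_lt (z false u).2.2 (by norm_num)
    simp [mixed, this]
  simp only [this]
  split_ifs with h <;> simp [h]

theorem condOpen_mem (p : ℝ) (z : Bool → Vert d → I) : 0 ≤ condOpen B p z ∧ condOpen B p z ≤ 1 :=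
  ⟨measureReal_nonneg, measureReal_le_one⟩

theorem volume_label_Ico_le (p p' : ℝ) :
    (volume : Measure I) {t | p ≤ (t : ℝ) ∧ (t : ℝ) < p'} ≤ ENNReal.ofReal (p' - p) := by
  have h := (measurePreserving_subtype_coe (μa := (volume : Measure ℝ))
    (measurableSet_Icc (a := (0 : ℝ)) (b := 1))).measure_preimage
    (measurableSet_Ico (a := p) (b := p')).nullMeasurableSet
  calc (volume : Measure I) {t | p ≤ (t : ℝ) ∧ (t : ℝ) < p'}
      = (volume.restrict (Set.Icc (0 : ℝ) 1)) (Set.Ico p p') := h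
    _ ≤ volume (Set.Ico p p') := Measure.restrict_apply_le _ _
    _ = ENNReal.ofReal (p' - p) := Real.volume_Ico

/-- The pattern can change only if a selector at some vertex of `F` falls in `[p, p')`. This
supplies the continuity in `p` for the intermediate value theorem. -/
theorem abs_typeLaw_pattern_sub_le (hloc : IsLocal F B) (a : Fin k → Bool) {p p' : ℝ}
    (hp : p ≤ p') :
    |typeLaw (iidLaw (Bool ⊕ Fin k) (volume : Measure I)) (pattern B k p) a -
      typeLaw (iidLaw (Bool ⊕ Fin k) (volume : Measure I)) (pattern B k p') a| ≤
        F.card * (p' - p) := by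
  set Q := iidLaw (Vert d) (iidLaw (Bool ⊕ Fin k) (volume : Measure I))
  let N : Set (Vert d → Bool ⊕ Fin k → I) :=
    ⋃ u ∈ F, {X | p ≤ (X u (Sum.inl false) : ℝ) ∧ (X u (Sum.inl false) : ℝ) < p'}
  have hN : Q.real N ≤ F.card * (p' - p) := by
    refine (measureReal_biUnion_finset_le _ _).trans ?_
    rw [← nsmul_eq_mul]
    refine Finset.sum_le_card_nsmul _ _ _ fun u _ => ?_
    have e1 : MeasurePreserving (fun X : Vert d → Bool ⊕ Fin k → I => X u) Q _ :=
      measurePreserving_eval_infinitePi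
        (fun _ : Vert d => iidLaw (Bool ⊕ Fin k) (volume : Measure I)) u
    have e2 : MeasurePreserving (fun l : Bool ⊕ Fin k → I => l (Sum.inl false))
        (iidLaw (Bool ⊕ Fin k) (volume : Measure I)) _ :=
      measurePreserving_eval_infinitePi (fun _ : Bool ⊕ Fin k => (volume : Measure I)) (Sum.inl false)
    have hms : MeasurableSet {t : I | p ≤ (t : ℝ) ∧ (t : ℝ) < p'} :=
      (measurableSet_le measurable_const measurable_subtype_coe).inter
        (measurableSet_lt measurable_subtype_coe measurable_const)
    have e3 := (e2.comp e1).measure_preimage hms.nullMeasurableSet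
    have e4 : Q {X | p ≤ (X u (Sum.inl false) : ℝ) ∧ (X u (Sum.inl false) : ℝ) < p'} ≤
        ENNReal.ofReal (p' - p) := e3.le.trans (volume_label_Ico_le hB p p')
    exact ENNReal.toReal_le_of_le_ofReal (by linarith) e4
  have hsame : ∀ X ∉ N, pattern B k p X = pattern B k p' X := by
    intro X hX
    funext j
    have : ((fun u => mix p j (X u)) ∈ B ↔ (fun u => mix p' j (X u)) ∈ B) := by
      refine hloc _ _ fun u hu => ?_
      have hu' : ¬ (p ≤ (X u (Sum.inl false) : ℝ) ∧ (X u (Sum.inl false) : ℝ) < p') := fun h =>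
        hX (Set.mem_biUnion hu h)
      by_cases h1 : (X u (Sum.inl false) : ℝ) < p
      · simp only [mix]
        rw [if_pos h1, if_pos (h1.trans_le hp)]
      · have h2 : ¬ (X u (Sum.inl false) : ℝ) < p' := fun h => hu' ⟨not_lt.mp h1, h⟩
        simp only [mix]
        rw [if_neg h1, if_neg h2]
    exact decide_eq_decide.mpr this
  have hle : ∀ r r' : ℝ, (∀ X ∉ N, pattern B k r X = pattern B k r' X) →
      Q.real {X | pattern B k r X = a} ≤ Q.real {X | pattern B k r' X = a} + Q.real N := by
    intro r r' h
    refine (measureReal_mono (fun X hX => ?_)).trans (measureReal_union_le _ _)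
    by_cases hN : X ∈ N
    · exact Or.inr hN
    · exact Or.inl ((h X hN).symm.trans hX)
  have h1 := hle p p' hsame
  have h2 := hle p' p fun X hX => (hsame X hX).symm
  unfold typeLaw
  rw [abs_le]
  constructor <;> linarith

open Classical in
/-- The first moment bound for coupled copies of a finite-range percolation process. -/
theorem coupled_bound (hloc : IsLocal F B) (hd : 0 < d) {K : ℕ} {θ : ℝ} (hθ : 0 ≤ θ) {m : ℝ}
    (hm : 1 ≤ m) {x : ℝ} (hx : (iidLaw (Vert d) (volume : Measure I)).real B = x)
    (hmx : m * x ≤ hit (K + 1) x) :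
    d / 2 * (1 - Real.exp (-2 * θ)) * (x ^ 2 * (2 * m - 1 - (m - 1) ^ 2 / K)) ≤
      Real.log d * (m * x) + 2 ^ (K + 1) / d + θ * ((K + 1) *
        ∑ i : Fin d, (iidLaw (Vert d) (volume : Measure I)).real {X | X ∈ B ∧ shift (gen i) X ∈ B}) := by
  set lam := iidLaw (Bool ⊕ Fin (K + 1)) (volume : Measure I)
  set ρ := iidLaw Bool (iidLaw (Vert d) (volume : Measure I))
  let a₀ : Fin (K + 1) → Bool := fun _ => false
  let q : ℝ → ℝ := fun p => 1 - typeLaw lam (pattern B (K + 1) p) a₀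
  have hx0 : 0 ≤ x := hx ▸ measureReal_nonneg
  have hqint : ∀ p, q p = 1 - ∫ z, (1 - hit (K + 1) (condOpen B p z)) ∂ρ := by
    intro p
    simp only [q, lam, typeLaw_pattern hB p a₀ hloc, a₀, coins_false]
    rfl
  have hq0 : q 0 = hit (K + 1) x := by
    rw [hqint]
    simp [condOpen_zero hB, hx]
  have hq2 : q 2 = x := by
    rw [hqint, ← hx, ← integral_condOpen hB 2]
    have : ∀ z : Bool → Vert d → I, 1 - hit (K + 1) (condOpen B 2 z) = 1 - condOpen B 2 z := by
      intro z
      rw [condOpen_two hB]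
      split_ifs <;> simp [hit]
    simp_rw [this]
    rw [integral_sub (integrable_const _)]
    · simp [ρ]
    · exact Integrable.of_bound (measurable_condOpen hB 2).aestronglyMeasurable 1
        (ae_of_all _ fun z => by
          rw [Real.norm_eq_abs, abs_of_nonneg (condOpen_mem hB 2 z).1]
          exact (condOpen_mem hB 2 z).2)
  have hlip : LipschitzWith (F.card : NNReal) q := by
    refine LipschitzWith.of_dist_le_mul fun p p' => ?_
    rw [Real.dist_eq, Real.dist_eq]
    rcases le_total p p' with h | h
    · have := abs_typeLaw_pattern_sub_le hB hloc a₀ h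
      rw [abs_sub_comm p, abs_of_nonneg (sub_nonneg.mpr h), abs_sub_comm]
      simpa [q] using this
    · have := abs_typeLaw_pattern_sub_le hB hloc a₀ h
      rw [abs_of_nonneg (sub_nonneg.mpr h)]
      simpa [q] using this
  -- The probability `q p` that some copy is open moves continuously from `hit (K + 1) x` for
  -- independent copies to `x` for identical ones.
  obtain ⟨p, -, hp⟩ : m * x ∈ q '' Set.Icc 0 2 := by
    refine intermediate_value_Icc' (by norm_num) hlip.continuous.continuousOn ⟨?_, ?_⟩
    · rw [hq2]; nlinarith
    · rw [hq0]; exact hmx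
  -- The parameter `log d` turns the entropy error into `2 ^ (K + 1) / d`.
  have hent := entropy_bound lam (isObservable_pattern (k := K + 1) hB hloc p) Meets
    (fun a b ⟨j, h1, h2⟩ => ⟨j, h2, h1⟩) a₀ hθ (K := Real.log d)
    (Real.log_nonneg (by exact_mod_cast hd))
  have hpair := pairMass_coins_ge ρ (K := K) (measurable_condOpen hB p)
    (fun z => (condOpen_mem hB p z).1) (fun z => (condOpen_mem hB p z).2)
    (typeLaw lam (pattern B (K + 1) p)) fun a => typeLaw_pattern hB p a hloc
  rw [integral_condOpen hB p, hx] at hpair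
  have hqp : 1 - typeLaw lam (pattern B (K + 1) p) a₀ = m * x := hp
  rw [hqp] at hent
  change 2 * (1 - typeLaw lam (pattern B (K + 1) p) a₀) * x - _ -
    ((1 - typeLaw lam (pattern B (K + 1) p) a₀) - x) ^ 2 / K ≤ _ at hpair
  rw [hqp] at hpair
  have hedge := edgeMass_pattern_le (k := K + 1) hB p
  have hd' : (0 : ℝ) < d := by exact_mod_cast hd
  have hexp : Real.exp (-2 * θ) ≤ 1 := Real.exp_le_one_iff.mpr (by linarith)
  have hρ : 0 ≤ d / 2 * (1 - Real.exp (-2 * θ)) := mul_nonneg (by positivity) (by linarith)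
  have h1 : x ^ 2 * (2 * m - 1 - (m - 1) ^ 2 / K) =
      2 * (m * x) * x - x ^ 2 - (m * x - x) ^ 2 / K := by ring
  rw [h1]
  have h2 : Real.exp (-Real.log d) * Fintype.card (Fin (K + 1) → Bool) = 2 ^ (K + 1) / d := by
    rw [Real.exp_neg, Real.exp_log hd']
    simp
    ring
  rw [h2] at hent
  have h3 := mul_le_mul_of_nonneg_left hpair hρ
  have h4 := mul_le_mul_of_nonneg_left hedge hθ
  push_cast at h4
  linarith

end Mix

/-! ## The asymptotic density bound for finite-range processes -/

/-- Bernoulli's inequality gives `hit (K + 1) x ≥ (K + 1) * x / (1 + (K + 1) * x)`. This suffices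
because `m * x` and `m * x * ((K + 1) * x)` are both at most `(K + 1) * x / 2`. -/
theorem hit_ge_mul {K : ℕ} {m x : ℝ} (hm : 1 ≤ m) (hK : 2 * m ≤ K + 1) (hx0 : 0 ≤ x) (hx1 : x ≤ 1)
    (hx : x ≤ 1 / (2 * m)) : m * x ≤ hit (K + 1) x := by
  have h1 : (1 + (K + 1) * x) * (1 - x) ^ (K + 1) ≤ 1 := by
    have hb : 1 + ((K + 1 : ℕ) : ℝ) * x ≤ (1 + x) ^ (K + 1) :=
      one_add_mul_le_pow (by linarith) (K + 1)
    push_cast at hb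
    have h0 : 0 ≤ (1 - x) ^ (K + 1) := pow_nonneg (by linarith) _
    calc (1 + (K + 1) * x) * (1 - x) ^ (K + 1) ≤ (1 + x) ^ (K + 1) * (1 - x) ^ (K + 1) := by gcongr
      _ = (1 - x ^ 2) ^ (K + 1) := by rw [← mul_pow]; congr 1; ring
      _ ≤ 1 := pow_le_one₀ (by nlinarith) (by nlinarith)
  have h2 : x * (2 * m) ≤ 1 := by rwa [le_div_iff₀ (by linarith)] at hx
  set y := (1 - x) ^ (K + 1)
  have hk : (0 : ℝ) < K + 1 := by positivity
  have h3 : (m * x) * (1 + (K + 1) * x) ≤ (K + 1) * x := by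
    have e1 : (m * x) * ((K + 1) * x) ≤ 1 / 2 * ((K + 1) * x) :=
      mul_le_mul_of_nonneg_right (by linarith) (by positivity)
    have e2 : (2 * m) * x ≤ (K + 1) * x := mul_le_mul_of_nonneg_right hK hx0
    linarith
  have h4 : 0 < 1 + (K + 1) * x := by positivity
  have h5 : (m * x) * (1 + (K + 1) * x) ≤ (1 - y) * (1 + (K + 1) * x) := by nlinarith
  exact le_of_mul_le_mul_right h5 h4

theorem eventually_log_bounds (C δ : ℝ) (hδ : 0 < δ) :
    ∀ᶠ d : ℕ in atTop, C < Real.log d ∧ 4 * (Real.log d + 5) / d ≤ δ := by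
  have h1 : Tendsto (fun d : ℕ => Real.log d) atTop atTop :=
    Real.tendsto_log_atTop.comp tendsto_natCast_atTop_atTop
  have h2 : Tendsto (fun d : ℕ => Real.log d / d) atTop (nhds 0) := by
    have := (Real.tendsto_pow_log_div_mul_add_atTop 1 0 1 one_ne_zero).comp
      (tendsto_natCast_atTop_atTop (R := ℝ))
    refine this.congr fun d => ?_
    simp
  have h3 : Tendsto (fun d : ℕ => (5 : ℝ) / d) atTop (nhds 0) :=
    tendsto_const_div_atTop_nhds_zero_nat 5
  have h4 : Tendsto (fun d : ℕ => 4 * (Real.log d / d + 5 / d)) atTop (nhds (4 * (0 + 0))) :=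
    (h2.add h3).const_mul 4
  have h5 : ∀ᶠ d : ℕ in atTop, 4 * (Real.log d / d + 5 / d) < δ :=
    (tendsto_order.mp h4).2 δ (by simpa using hδ)
  filter_upwards [h1.eventually_gt_atTop C, h5] with d hd1 hd2
  refine ⟨hd1, le_trans (le_of_eq ?_) hd2.le⟩
  ring

/-- Finite-range percolation processes in which an open vertex has at most three open neighbours on
average have density at most `(1 + ε) log d / d`. -/
theorem finiteRange_bound {ε : ℝ} (hε : 0 < ε) :
    ∀ᶠ d : ℕ in atTop, ∀ (F : Finset (Vert d)) (B : Set (Vert d → I)), MeasurableSet B →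
      IsLocal F B →
      ∑ i : Fin d, (iidLaw (Vert d) (volume : Measure I)).real {X | X ∈ B ∧ shift (gen i) X ∈ B} ≤
        3 * (iidLaw (Vert d) (volume : Measure I)).real B →
      (iidLaw (Vert d) (volume : Measure I)).real B ≤ (1 + ε) * (Real.log d / d) := by
  -- The total loss allowed is the factor `κ = 1 - 3 * γ ≤ (1 - γ) * (1 - 2 * γ)`. The factor `1 -
  -- γ` pays for `exp (-2 * θ)`, and `1 - 2 * γ` pays for replacing `2 * m` by `2 * m - 4`.
  set κ := (1 + ε / 2) / (1 + ε) with hκ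
  have hκ1 : κ < 1 := by rw [hκ, div_lt_one (by linarith)]; linarith
  have hκ0 : 0 < κ := by positivity
  set γ := (1 - κ) / 3 with hγ
  have hγ0 : 0 < γ := by rw [hγ]; linarith
  have hγ1 : γ ≤ 1 / 3 := by rw [hγ]; linarith
  set m := 1 / γ with hm
  have hmγ : m * γ = 1 := by rw [hm]; field_simp
  have hm3 : 3 ≤ m := by rw [hm, le_div_iff₀ hγ0]; linarith
  -- This is `K ≥ m ^ 2`, which makes the correction `(m - 1) ^ 2 / K` at most 1.
  obtain ⟨K, hK⟩ := exists_nat_ge (m / γ)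
  have hKm : m * m ≤ K := by
    have : m / γ = m * m := by rw [hm]; field_simp
    linarith
  have hK0 : (0 : ℝ) < K := by nlinarith
  have hm0 : 0 < m := by linarith
  obtain ⟨θ, hθ⟩ : ∃ θ : ℝ, θ = m := ⟨m, rfl⟩
  have hθ0 : 0 < θ := hθ ▸ hm0
  have hexp : Real.exp (-2 * θ) ≤ γ := by
    rw [show -2 * θ = -(2 * θ) by ring, Real.exp_neg]
    refine inv_le_of_inv_le₀ hγ0 ?_
    rw [← one_div, ← hm, ← hθ]
    have := Real.add_one_le_exp (2 * θ)
    linarith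
  clear_value m γ κ
  set C := (2 : ℝ) ^ (K + 1) + 3 * θ * (K + 1) with hC
  have hC0 : 0 < C := by positivity
  filter_upwards [eventually_log_bounds (max 1 (2 * C / ε)) (1 / (2 * m)) (by positivity),
    eventually_ge_atTop 1] with d hd hd1 F B hB hloc hη
  obtain ⟨hlog, hsmall⟩ := hd
  have hl1 : 1 < Real.log d := (le_max_left _ _).trans_lt hlog
  have hlC : 2 * C / ε < Real.log d := (le_max_right _ _).trans_lt hlog
  have hd0 : (0 : ℝ) < d := by exact_mod_cast hd1
  by_contra hcon
  push Not at hcon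
  set x := (iidLaw (Vert d) (volume : Measure I)).real B with hx
  set η := ∑ i : Fin d, (iidLaw (Vert d) (volume : Measure I)).real
    {X | X ∈ B ∧ shift (gen i) X ∈ B} with hηdef
  have hx1 : x ≤ 1 := measureReal_le_one
  clear_value x η
  have hdx : (1 + ε) * Real.log d < d * x := by
    rw [mul_div_assoc', div_lt_iff₀ hd0] at hcon
    linarith
  have hdx1 : 1 < d * x := by nlinarith
  have hx0 : 0 < x := by
    by_contra h
    push Not at h
    nlinarith
  -- Errors of order `1 / d` can thus be charged to `x`.
  have hinv : 1 / (d : ℝ) ≤ x := by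
    rw [div_le_iff₀ hd0]
    linarith
  -- A single copy gives a bound of order `log d / d` with a worse constant. This smallness is what
  -- lets independent copies reach the union density `m * x`. The quotient by `K = 0` is harmless
  -- because `m = 1`.
  have hxsmall : x ≤ 1 / (2 * m) := by
    refine le_trans ?_ hsmall
    have h1 := coupled_bound hB hloc hd1 (K := 0) (θ := 1) zero_le_one (m := 1) le_rfl hx.symm
      (by simp [hit])
    rw [← hηdef] at h1
    have he : Real.exp (-2 * 1) ≤ 1 / 2 := by
      rw [show (-2 * 1 : ℝ) = -2 by norm_num, Real.exp_neg]
      have := Real.add_one_le_exp (2 : ℝ)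
      refine inv_le_of_inv_le₀ (by norm_num) ?_
      linarith
    norm_num at h1
    have h2 : d / 2 * (1 / 2) * x ^ 2 ≤ Real.log d * x + 2 / d + η := by
      refine le_trans ?_ h1
      norm_num at he
      gcongr
      linarith
    have h3 : (2 : ℝ) / d ≤ 2 * x := by
      have : (2 : ℝ) / d = 2 * (1 / d) := by ring
      rw [this]
      linarith
    rw [le_div_iff₀ hd0]
    have h4 : x * (x * d) ≤ x * (4 * (Real.log d + 5)) := by nlinarith
    exact le_of_mul_le_mul_left h4 hx0
  have hmx : m * x ≤ hit (K + 1) x := hit_ge_mul (by linarith) (by nlinarith only [hKm, hm3]) hx0.le hx1 hxsmall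
  have h1 := coupled_bound hB hloc hd1 (K := K) (θ := θ) (by linarith) (m := m) (by linarith)
    hx.symm hmx
  rw [← hηdef] at h1
  have h2 : (2 : ℝ) ^ (K + 1) / d ≤ 2 ^ (K + 1) * x := by
    have : (2 : ℝ) ^ (K + 1) / d = 2 ^ (K + 1) * (1 / d) := by ring
    rw [this]
    gcongr
  have h3 : θ * ((K + 1) * η) ≤ 3 * θ * (K + 1) * x := by
    have : θ * ((K + 1) * η) ≤ θ * ((K + 1) * (3 * x)) := by gcongr
    linarith
  have h4 : (m - 1) ^ 2 / K ≤ 1 := by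
    rw [div_le_one hK0]
    calc (m - 1) ^ 2 = m * m - 2 * m + 1 := by ring
      _ ≤ K := by linarith only [hKm, hm3]
  have h5 : d / 2 * (1 - γ) * (x ^ 2 * (2 * m * (1 - 2 * γ))) ≤
      d / 2 * (1 - Real.exp (-2 * θ)) * (x ^ 2 * (2 * m - 1 - (m - 1) ^ 2 / K)) := by
    have : 2 * m * (1 - 2 * γ) = 2 * m - 4 := by linear_combination (-4) * hmγ
    rw [this]
    have e0 : 0 ≤ 2 * m - 4 := by linarith
    have e1 : 2 * m - 4 ≤ 2 * m - 1 - (m - 1) ^ 2 / K := by linarith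
    have e2 : (d : ℝ) / 2 * (1 - γ) ≤ d / 2 * (1 - Real.exp (-2 * θ)) :=
      mul_le_mul_of_nonneg_left (by linarith) (by positivity)
    have e3 : 0 ≤ (d : ℝ) / 2 * (1 - γ) := mul_nonneg (by positivity) (by linarith)
    exact mul_le_mul e2 (mul_le_mul_of_nonneg_left e1 (sq_nonneg x))
      (mul_nonneg (sq_nonneg x) e0) (e3.trans e2)
  have h6 : κ ≤ (1 - γ) * (1 - 2 * γ) := by
    have e1 : κ = 1 - 3 * γ := by rw [hγ]; ring
    have e2 : (1 - γ) * (1 - 2 * γ) = 1 - 3 * γ + 2 * γ ^ 2 := by ring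
    rw [e1, e2]
    exact le_add_of_nonneg_right (by positivity)
  have h7 : d * x * m * κ ≤ Real.log d * m + C := by
    have h8 : x * (d * x * m * κ) ≤ x * (Real.log d * m + C) := by
      calc x * (d * x * m * κ) = d * x ^ 2 * m * κ := by ring
        _ ≤ d * x ^ 2 * m * ((1 - γ) * (1 - 2 * γ)) := by gcongr
        _ = d / 2 * (1 - γ) * (x ^ 2 * (2 * m * (1 - 2 * γ))) := by ring
        _ ≤ _ := h5
        _ ≤ _ := h1
        _ ≤ Real.log d * (m * x) + 2 ^ (K + 1) * x + 3 * θ * (K + 1) * x := by linarith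
        _ = x * (Real.log d * m + C) := by rw [hC]; ring
    exact le_of_mul_le_mul_left h8 hx0
  have h9 : (1 + ε / 2) * Real.log d * m ≤ d * x * m * κ := by
    have : (1 + ε / 2) = (1 + ε) * κ := by rw [hκ]; field_simp
    rw [this]
    calc (1 + ε) * κ * Real.log d * m = ((1 + ε) * Real.log d) * (m * κ) := by ring
      _ ≤ (d * x) * (m * κ) := by gcongr
      _ = _ := by ring
  have h10 : 2 * C < Real.log d * ε := by rwa [div_lt_iff₀ hε] at hlC
  have h11 : Real.log d * ε * 1 ≤ Real.log d * ε * m :=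
    mul_le_mul_of_nonneg_left (by linarith only [hm3]) (by positivity)
  linarith only [h7, h9, h10, h11]

/-! ## Finite clusters have average degree at most two -/

section Clusters

variable {d : ℕ}

theorem word_injective : Function.Injective (word (d := d)) := fun g h e => by
  rw [← prod_word g, ← prod_word h, e]

instance : Countable (Vert d) := word_injective.countable

/-- A finite vertex set without proper nonempty subsets that are closed under adjacency in it. -/
def IsConn (C : Finset (Vert d)) : Prop :=
  ∀ S ⊆ C, S.Nonempty → (∀ v ∈ S, ∀ i : Fin d, gen i * v ∈ C → gen i * v ∈ S) → S = C

/-- The number of neighbours of `v` in `C`. -/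
noncomputable def degIn (C : Finset (Vert d)) (v : Vert d) : ℕ := by
  classical exact (Finset.univ.filter fun i : Fin d => gen i * v ∈ C).card

/-- A vertex has at most one neighbour with a shorter word, given by deleting its first letter. So
at most `C.card` ordered adjacent pairs descend, and reversal matches the ascending ones with these.
-/
theorem sum_degIn_le (C : Finset (Vert d)) : ∑ v ∈ C, degIn C v ≤ 2 * C.card := by
  classical
  let E : Finset (Vert d × Fin d) := (C ×ˢ Finset.univ).filter fun p => gen p.2 * p.1 ∈ C
  have hE : ∑ v ∈ C, degIn C v = E.card := by
    simp only [E, degIn, Finset.card_filter, Finset.sum_product]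
  let D : Finset (Vert d × Fin d) := E.filter fun p =>
    (word (gen p.2 * p.1)).1.length < (word p.1).1.length
  have hD : D.card ≤ C.card := by
    refine Finset.card_le_card_of_injOn Prod.fst ?_ ?_
    · intro p hp
      simp only [D, E, Finset.coe_filter, Finset.mem_filter, Finset.mem_product] at hp
      exact hp.1.1.1
    · rintro ⟨v, i⟩ hp ⟨w, j⟩ hq (rfl : v = w)
      simp only [D, Finset.coe_filter] at hp hq
      have key : ∀ k : Fin d, (word (gen k * v)).1.length < (word v).1.length →
          (word v).1.head? = some k := by
        intro k hk
        rw [word_gen_mul] at hk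
        rcases letter_length k (word v) with h | h
        · omega
        · exact h.1
      have := (key i hp.2).symm.trans (key j hq.2)
      rw [Option.some.inj this]
  have hD' : (E.filter fun p => ¬ (word (gen p.2 * p.1)).1.length < (word p.1).1.length).card ≤
      D.card := by
    refine Finset.card_le_card_of_injOn (fun p => (gen p.2 * p.1, p.2)) ?_ ?_
    · rintro ⟨v, i⟩ hp
      simp only [E, Finset.coe_filter, Finset.mem_filter, Finset.mem_product] at hp
      have h1 : (word v).1.length < (word (gen i * v)).1.length := by
        have h := hp.2
        simp only [word_gen_mul] at h ⊢
        rcases letter_length i (word v) with h' | h' <;> omega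
      refine Finset.mem_filter.mpr ⟨Finset.mem_filter.mpr
        ⟨Finset.mem_product.mpr ⟨hp.1.2, Finset.mem_univ _⟩, ?_⟩, ?_⟩
      · change gen i * (gen i * v) ∈ C
        rw [gen_mul_gen_mul]
        exact hp.1.1.1
      · change (word (gen i * (gen i * v))).1.length < _
        rwa [gen_mul_gen_mul]
    · rintro ⟨v, i⟩ - ⟨w, j⟩ - h
      simp only [Prod.mk.injEq] at h
      obtain ⟨h, rfl⟩ := h
      rw [mul_left_cancel h]
  have := Finset.card_filter_add_card_filter_not (s := E)
    (fun p => (word (gen p.2 * p.1)).1.length < (word p.1).1.length)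
  rw [hE]
  change D.card + _ = _ at this
  omega

/-! ### Mass transport over finite clusters. -/

/-- Right translates of finite sets of vertices. -/
noncomputable def translate (g : Vert d) (C : Finset (Vert d)) : Finset (Vert d) :=
  C.map (Equiv.mulRight g).toEmbedding

theorem mem_translate {g v : Vert d} {C : Finset (Vert d)} :
    v ∈ translate g C ↔ v * g⁻¹ ∈ C := by
  simp only [translate, Finset.mem_map_equiv]
  rfl

theorem translate_translate (g h : Vert d) (C : Finset (Vert d)) :
    translate h (translate g C) = translate (g * h) C := by
  ext v
  simp [mem_translate, mul_assoc]

theorem translate_one (C : Finset (Vert d)) : translate 1 C = C := by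
  ext v
  simp [mem_translate]

theorem card_translate (g : Vert d) (C : Finset (Vert d)) : (translate g C).card = C.card :=
  Finset.card_map _

theorem degIn_translate (g v : Vert d) (C : Finset (Vert d)) :
    degIn (translate g C) v = degIn C (v * g⁻¹) := by
  simp only [degIn, mem_translate, mul_assoc]

theorem IsConn.translate {C : Finset (Vert d)} (h : IsConn C) (g : Vert d) :
    IsConn (translate g C) := by
  intro S hS hne hcl
  have h1 : FIID.translate g⁻¹ S = C := by
    refine h _ ?_ ?_ ?_
    · intro v hv
      have := hS (mem_translate.mp hv)
      rw [mem_translate] at this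
      simpa using this
    · obtain ⟨v, hv⟩ := hne
      exact ⟨v * g⁻¹, mem_translate.mpr (by simpa using hv)⟩
    · intro v hv i hi
      rw [mem_translate, mul_assoc]
      refine hcl _ (mem_translate.mp hv) i ?_
      rw [mem_translate]
      simpa [mul_assoc] using hi
  rw [← h1, translate_translate, inv_mul_cancel, translate_one]

theorem isConn_translate_iff {C : Finset (Vert d)} (g : Vert d) :
    IsConn (translate g C) ↔ IsConn C := by
  refine ⟨fun h => ?_, fun h => h.translate g⟩
  have := h.translate g⁻¹
  rwa [translate_translate, mul_inv_cancel, translate_one] at this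

/-- The event that `C` is a union of clusters of the process given by the event `B`. -/
def clusterEvent (B : Set (Vert d → I)) (C : Finset (Vert d)) : Set (Vert d → I) :=
  {X | ∀ v ∈ C, shift v X ∈ B ∧ ∀ i : Fin d, gen i * v ∉ C → shift (gen i * v) X ∉ B}

theorem shift_shift {L : Type*} (v g : Vert d) (X : Vert d → L) :
    shift v (shift g X) = shift (v * g) X := by
  funext u
  simp [shift, mul_assoc]

theorem shift_one {L : Type*} (X : Vert d → L) : shift (1 : Vert d) X = X := by
  funext u
  simp [shift]

theorem measurableSet_clusterEvent {B : Set (Vert d → I)} (hB : MeasurableSet B)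
    (C : Finset (Vert d)) : MeasurableSet (clusterEvent B C) := by
  have : clusterEvent B C = ⋂ v ∈ C, (shift v ⁻¹' B ∩
      ⋂ i : Fin d, {X | gen i * v ∉ C → shift (gen i * v) X ∉ B}) := by
    ext X
    simp only [clusterEvent, Set.mem_iInter, Set.mem_inter_iff, Set.mem_preimage]
    rfl
  rw [this]
  refine Finset.measurableSet_biInter _ fun v _ => (measurable_shift v hB).inter
    (MeasurableSet.iInter fun i => ?_)
  by_cases h : gen i * v ∈ C
  · simp [h]
  · simp only [h, not_false_eq_true, forall_const]
    exact (measurable_shift _ hB).compl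

theorem clusterEvent_translate (B : Set (Vert d → I)) (C : Finset (Vert d)) (g : Vert d) :
    clusterEvent B (translate g C) = shift g ⁻¹' clusterEvent B C := by
  ext X
  simp only [clusterEvent]
  constructor
  · intro h v hv
    have := h (v * g) (mem_translate.mpr (by simpa using hv))
    refine ⟨by rw [shift_shift]; exact this.1, fun i hi => ?_⟩
    rw [shift_shift, mul_assoc]
    exact this.2 i (by rw [mem_translate]; simpa [mul_assoc] using hi)
  · intro h v hv
    have := h (v * g⁻¹) (mem_translate.mp hv)
    rw [shift_shift] at this
    refine ⟨by simpa using this.1, fun i hi => ?_⟩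
    have h2 := this.2 i (by rw [mem_translate] at hi; simpa [mul_assoc] using hi)
    rw [shift_shift] at h2
    simpa [mul_assoc] using h2

theorem iidLaw_shift (g : Vert d) {S : Set (Vert d → I)} (hS : MeasurableSet S) :
    iidLaw (Vert d) (volume : Measure I) (shift g ⁻¹' S) = iidLaw (Vert d) volume S := by
  have h := iidLaw_map_comp (volume : Measure I) (a := fun u : Vert d => u * g)
    (mul_left_injective g)
  conv_rhs => rw [← h]
  exact (Measure.map_apply (measurable_shift g) hS).symm

/-- The intersection is closed under adjacency within each set: a step that stays in one and leaves
the other would end at a vertex both open and not open. -/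
theorem eq_of_mem_clusterEvent {B : Set (Vert d → I)} {C C' : Finset (Vert d)} (hC : IsConn C)
    (hC' : IsConn C') (h1 : 1 ∈ C) (h1' : 1 ∈ C') {X : Vert d → I} (hX : X ∈ clusterEvent B C)
    (hX' : X ∈ clusterEvent B C') : C = C' := by
  classical
  have e1 : C ∩ C' = C := by
    refine hC _ Finset.inter_subset_left ⟨1, Finset.mem_inter.mpr ⟨h1, h1'⟩⟩ fun v hv i hi => ?_
    rw [Finset.mem_inter] at hv ⊢
    refine ⟨hi, ?_⟩
    by_contra hcon
    exact (hX' v hv.2).2 i hcon (hX _ hi).1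
  have e2 : C ∩ C' = C' := by
    refine hC' _ Finset.inter_subset_right ⟨1, Finset.mem_inter.mpr ⟨h1, h1'⟩⟩ fun v hv i hi => ?_
    rw [Finset.mem_inter] at hv ⊢
    refine ⟨?_, hi⟩
    by_contra hcon
    exact (hX v hv.1).2 i hcon (hX' _ hi).1
  exact e1.symm.trans e2

open Classical in
/-- The probability that `C` is the cluster of the root. -/
noncomputable def clusterProb (B : Set (Vert d → I)) (C : Finset (Vert d)) : ENNReal :=
  if 1 ∈ C ∧ IsConn C then iidLaw (Vert d) (volume : Measure I) (clusterEvent B C) else 0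

theorem tsum_clusterProb_le {B : Set (Vert d → I)} (hB : MeasurableSet B) :
    ∑' C, clusterProb B C ≤ iidLaw (Vert d) (volume : Measure I) B := by
  classical
  let E : Finset (Vert d) → Set (Vert d → I) := fun C =>
    if 1 ∈ C ∧ IsConn C then clusterEvent B C else ∅
  have hE : ∀ C, clusterProb B C = iidLaw (Vert d) (volume : Measure I) (E C) := by
    intro C
    simp only [clusterProb, E]
    split_ifs <;> simp
  simp_rw [hE]
  rw [← measure_iUnion]
  · refine measure_mono (Set.iUnion_subset fun C X hX => ?_)
    simp only [E] at hX
    split_ifs at hX with h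
    · have := (hX 1 h.1).1
      rwa [shift_one] at this
    · exact hX.elim
  · intro C C' hne
    refine Set.disjoint_left.mpr fun X hX hX' => hne ?_
    simp only [E] at hX hX'
    split_ifs at hX hX' with h h'
    · exact eq_of_mem_clusterEvent h.2 h'.2 h.1 h'.1 hX hX'
    all_goals first | exact hX.elim | exact hX'.elim
  · intro C
    simp only [E]
    split_ifs
    · exact measurableSet_clusterEvent hB C
    · exact MeasurableSet.empty

theorem clusterProb_translate {B : Set (Vert d → I)} (hB : MeasurableSet B) {C : Finset (Vert d)}
    {v : Vert d} (hv : v ∈ C) (h1 : 1 ∈ C) :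
    clusterProb B (translate v⁻¹ C) = clusterProb B C := by
  have h : 1 ∈ translate v⁻¹ C := mem_translate.mpr (by simpa using hv)
  classical
  have hiff : (1 ∈ translate v⁻¹ C ∧ IsConn (translate v⁻¹ C)) ↔ (1 ∈ C ∧ IsConn C) := by
    rw [isConn_translate_iff]
    exact and_congr_left fun _ => iff_of_true h h1
  simp only [clusterProb, clusterEvent_translate, iidLaw_shift _ (measurableSet_clusterEvent hB C)]
  exact if_congr hiff rfl rfl

/-- Moving the root to a uniform vertex of its cluster. -/
noncomputable def reroot : Equiv.Perm (Finset (Vert d) × Vert d) :=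
  Function.Involutive.toPerm (fun p => (translate p.2⁻¹ p.1, p.2⁻¹)) fun p => by
    simp [translate_translate, translate_one]

/-- Mass transport: spread the weight of each cluster evenly over its vertices. By translation
invariance `reroot` trades the degree at the root for the degree at a uniform vertex of the cluster,
and these average to at most two by `sum_degIn_le`. -/
theorem tsum_clusterProb_mul_degIn {B : Set (Vert d → I)} (hB : MeasurableSet B) :
    ∑' C, clusterProb B C * degIn C 1 ≤ 2 * ∑' C, clusterProb B C := by
  classical
  have zero : ∀ C : Finset (Vert d), 1 ∉ C → clusterProb B C = 0 := fun C h => by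
    simp [clusterProb, h]
  let w : Finset (Vert d) → ENNReal := fun C => clusterProb B C * (C.card : ENNReal)⁻¹
  have hw : ∀ C : Finset (Vert d), w C * C.card = clusterProb B C := by
    intro C
    by_cases h : 1 ∈ C
    · have hc : (C.card : ENNReal) ≠ 0 := by
        exact_mod_cast (Finset.card_pos.mpr ⟨1, h⟩).ne'
      simp only [w]
      rw [mul_assoc, ENNReal.inv_mul_cancel hc (ENNReal.natCast_ne_top _), mul_one]
    · simp [w, zero C h]
  let f : Finset (Vert d) × Vert d → ENNReal := fun p => if p.2 ∈ p.1 then w p.1 * degIn p.1 1 else 0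
  let f' : Finset (Vert d) × Vert d → ENNReal :=
    fun p => if p.2 ∈ p.1 then w p.1 * degIn p.1 p.2 else 0
  have hff : ∀ p, f (reroot p) = f' p := by
    rintro ⟨C, v⟩
    change f (translate v⁻¹ C, v⁻¹) = f' (C, v)
    simp only [f, f', mem_translate, w, card_translate, degIn_translate, inv_inv, one_mul,
      inv_mul_cancel]
    by_cases h1 : 1 ∈ C
    · by_cases hv : v ∈ C
      · simp [h1, hv, clusterProb_translate hB hv h1]
      · have : clusterProb B (translate v⁻¹ C) = 0 := zero _ (by simpa [mem_translate] using hv)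
        simp [hv, this]
    · simp [h1, zero C h1]
  have hfib : ∀ (C : Finset (Vert d)) (k : Vert d → ENNReal),
      ∑' v, (if v ∈ C then k v else 0) = ∑ v ∈ C, k v := by
    intro C k
    rw [tsum_eq_sum (s := C) (fun v hv => by simp [hv])]
    exact Finset.sum_congr rfl fun v hv => by simp [hv]
  calc ∑' C, clusterProb B C * degIn C 1 = ∑' C, ∑' v, f (C, v) := by
        refine tsum_congr fun C => ?_
        simp only [f]
        rw [hfib C fun _ => w C * degIn C 1, Finset.sum_const, nsmul_eq_mul, ← hw C]
        ring
    _ = ∑' p, f p := (ENNReal.tsum_prod (f := fun C v => f (C, v))).symm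
    _ = ∑' p, f' p := by
        rw [← Equiv.tsum_eq reroot f]
        exact tsum_congr hff
    _ = ∑' C, ∑' v, f' (C, v) := ENNReal.tsum_prod (f := fun C v => f' (C, v))
    _ ≤ ∑' C, 2 * clusterProb B C := by
        refine ENNReal.tsum_le_tsum fun C => ?_
        simp only [f']
        rw [hfib C fun v => w C * degIn C v, ← Finset.mul_sum, ← hw C]
        calc w C * ∑ v ∈ C, (degIn C v : ENNReal) ≤ w C * (2 * C.card) := by
              gcongr
              exact_mod_cast sum_degIn_le C
          _ = 2 * (w C * C.card) := by ring
    _ = 2 * ∑' C, clusterProb B C := ENNReal.tsum_mul_left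

/-- If all clusters are finite, then an open vertex has at most two open neighbours on average. -/
theorem sum_neighbors_le {B : Set (Vert d → I)} (hB : MeasurableSet B)
    (hfin : ∀ᵐ X ∂(iidLaw (Vert d) (volume : Measure I)), X ∈ B →
      ∃ C : Finset (Vert d), 1 ∈ C ∧ IsConn C ∧ X ∈ clusterEvent B C) :
    ∑ i : Fin d, (iidLaw (Vert d) (volume : Measure I)).real {X | X ∈ B ∧ shift (gen i) X ∈ B} ≤
      2 * (iidLaw (Vert d) (volume : Measure I)).real B := by
  classical
  have h1 : ∀ i : Fin d, iidLaw (Vert d) (volume : Measure I) {X | X ∈ B ∧ shift (gen i) X ∈ B} ≤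
      ∑' C, clusterProb B C * if gen i ∈ C then 1 else 0 := by
    intro i
    let E : Finset (Vert d) → Set (Vert d → I) := fun C =>
      if (1 ∈ C ∧ IsConn C) ∧ gen i ∈ C then clusterEvent B C else ∅
    have hE : ∀ C, iidLaw (Vert d) (volume : Measure I) (E C) =
        clusterProb B C * if gen i ∈ C then 1 else 0 := by
      intro C
      by_cases ha : 1 ∈ C ∧ IsConn C <;> by_cases hb : gen i ∈ C <;> simp [E, clusterProb, ha, hb]
    calc _ ≤ iidLaw (Vert d) (volume : Measure I) (⋃ C, E C) := by
          refine measure_mono_ae ?_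
          filter_upwards [hfin] with X hX hXB
          obtain ⟨C, hC1, hC, hXC⟩ := hX hXB.1
          have hi : gen i ∈ C := by
            by_contra hcon
            have := (hXC 1 hC1).2 i (by simpa using hcon)
            rw [mul_one] at this
            exact this hXB.2
          refine Set.mem_iUnion.mpr ⟨C, ?_⟩
          simp only [E, hC1, hC, hi, and_self, if_true]
          exact hXC
      _ ≤ ∑' C, iidLaw (Vert d) (volume : Measure I) (E C) := measure_iUnion_le _
      _ = _ := tsum_congr hE
  have h2 : ∑ i : Fin d, iidLaw (Vert d) (volume : Measure I) {X | X ∈ B ∧ shift (gen i) X ∈ B} ≤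
      2 * iidLaw (Vert d) (volume : Measure I) B := by
    calc _ ≤ ∑ i : Fin d, ∑' C, clusterProb B C * (if gen i ∈ C then 1 else 0) :=
          Finset.sum_le_sum fun i _ => h1 i
      _ = ∑' C, ∑ i : Fin d, clusterProb B C * (if gen i ∈ C then 1 else 0) :=
          (Summable.tsum_finsetSum fun _ _ => ENNReal.summable).symm
      _ = ∑' C, clusterProb B C * degIn C 1 := by
          refine tsum_congr fun C => ?_
          rw [← Finset.mul_sum]
          congr 1
          simp [degIn]
      _ ≤ 2 * ∑' C, clusterProb B C := tsum_clusterProb_mul_degIn hB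
      _ ≤ _ := by gcongr; exact tsum_clusterProb_le hB
  have h3 := ENNReal.toReal_mono (by finiteness) h2
  rw [ENNReal.toReal_sum (fun i _ => by finiteness), ENNReal.toReal_mul] at h3
  simpa [Measure.real] using h3

/-- A finite connected component of the open subgraph that contains the root. -/
theorem exists_cluster {B : Set (Vert d → I)} {X : Vert d → I} (hX : X ∈ B)
    (hfin : ∀ C : ((tree d).induce {v | shift v X ∈ B}).ConnectedComponent, C.supp.Finite) :
    ∃ C : Finset (Vert d), 1 ∈ C ∧ IsConn C ∧ X ∈ clusterEvent B C := by
  classical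
  set O : Set (Vert d) := {v | shift v X ∈ B} with hO
  have h1 : (1 : Vert d) ∈ O := by
    change shift 1 X ∈ B
    rwa [shift_one]
  set G := (tree d).induce O with hG
  set K := G.connectedComponentMk ⟨1, h1⟩ with hK
  have hf : (Subtype.val '' K.supp).Finite := (hfin K).image _
  have hmem : ∀ v, v ∈ hf.toFinset ↔ ∃ h : v ∈ O, (⟨v, h⟩ : O) ∈ K.supp := by
    intro v
    simp
  refine ⟨hf.toFinset, (hmem 1).mpr ⟨h1, rfl⟩, ?_, ?_⟩
  · intro S hS hne hcl
    refine Finset.Subset.antisymm hS fun v hv => ?_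
    obtain ⟨s, hs⟩ := hne
    obtain ⟨hsO, hsK⟩ := (hmem s).mp (hS hs)
    obtain ⟨hvO, hvK⟩ := (hmem v).mp hv
    have hr : G.Reachable ⟨s, hsO⟩ ⟨v, hvO⟩ :=
      SimpleGraph.ConnectedComponent.exact (hsK.trans hvK.symm)
    rw [SimpleGraph.reachable_iff_reflTransGen] at hr
    suffices ∀ w : O, Relation.ReflTransGen G.Adj ⟨s, hsO⟩ w → w ∈ K.supp ∧ w.1 ∈ S from
      (this _ hr).2
    intro w hw
    induction hw with
    | refl => exact ⟨hsK, hs⟩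
    | @tail b c _ hbc ih =>
      have hc : c ∈ K.supp := by
        have := SimpleGraph.ConnectedComponent.sound hbc.reachable
        exact this.symm.trans ih.1
      obtain ⟨i, hi⟩ : ∃ i, c.1 = gen i * b.1 := hbc
      refine ⟨hc, ?_⟩
      rw [hi]
      refine hcl _ ih.2 i ?_
      rw [← hi]
      exact (hmem _).mpr ⟨c.2, hc⟩
  · intro v hv
    obtain ⟨hvO, hvK⟩ := (hmem v).mp hv
    refine ⟨hvO, fun i hi hcon => hi ((hmem _).mpr ⟨hcon, ?_⟩)⟩
    have hadj : G.Adj ⟨v, hvO⟩ ⟨gen i * v, hcon⟩ := ⟨i, rfl⟩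
    exact (SimpleGraph.ConnectedComponent.sound hadj.reachable).symm.trans hvK

end Clusters

/-! ## From finite clusters to finite range -/

/-- Cylinder sets form a ring that generates the product σ-algebra, so they are dense in measure. -/
theorem exists_isLocal_symmDiff_lt {U : Type*} {B : Set (U → I)} (hB : MeasurableSet B) {δ : ℝ}
    (hδ : 0 < δ) : ∃ (F : Finset U) (B' : Set (U → I)), MeasurableSet B' ∧ IsLocal F B' ∧
      (iidLaw U (volume : Measure I)).real (symmDiff B' B) < δ := by
  have hring : IsSetRing (measurableCylinders fun _ : U => I) :=
    ⟨empty_mem_measurableCylinders _, fun _ _ hs ht => union_mem_measurableCylinders hs ht,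
      fun _ _ hs ht => sdiff_mem_measurableCylinders hs ht⟩
  obtain ⟨B', hB', h⟩ := exists_measure_symmDiff_lt_of_generateFrom_isSetRing
    (μ := iidLaw U (volume : Measure I)) hring
    ⟨{Set.univ}, Set.countable_singleton _,
      Set.singleton_subset_iff.mpr (univ_mem_measurableCylinders _), by simp⟩
    generateFrom_measurableCylinders.symm hB (ENNReal.ofReal_pos.mpr hδ)
  obtain ⟨F, S, hS, rfl⟩ := (mem_measurableCylinders _).mp hB'
  refine ⟨F, _, MeasurableSet.cylinder F hS, fun X X' hX => ?_, ?_⟩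
  · rw [mem_cylinder, mem_cylinder]
    have : F.restrict X = F.restrict X' := by
      funext u
      exact hX u u.2
    rw [this]
  · exact (ENNReal.lt_ofReal_iff_toReal_lt (by finiteness)).mp h

theorem neighbors_bound {ε : ℝ} (hε : 0 < ε) :
    ∀ᶠ d : ℕ in atTop, ∀ B : Set (Vert d → I), MeasurableSet B →
      ∑ i : Fin d, (iidLaw (Vert d) (volume : Measure I)).real {X | X ∈ B ∧ shift (gen i) X ∈ B} ≤
        2 * (iidLaw (Vert d) (volume : Measure I)).real B →
      (iidLaw (Vert d) (volume : Measure I)).real B ≤ (1 + ε) * (Real.log d / d) := by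
  filter_upwards [finiteRange_bound hε] with d hd B hB hη
  set ν := iidLaw (Vert d) (volume : Measure I) with hν
  have hR : 0 ≤ (1 + ε) * (Real.log d / d) := by
    have := Real.log_natCast_nonneg d
    positivity
  rcases (measureReal_nonneg (μ := ν) (s := B)).eq_or_lt with h0 | h0
  · rwa [← h0]
  refine le_of_forall_pos_le_add fun δ hδ => ?_
  -- An error `t` costs `t` in the density and at most `2 * d * t` in the sum over neighbours.
  -- Passing from the constant 2 to 3 thus requires `(2 * d + 3) * t` to be at most the density,
  -- which is why the null case was set aside.
  obtain ⟨F, B', hB', hloc, hlt⟩ := exists_isLocal_symmDiff_lt hB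
    (δ := min δ (ν.real B / (2 * d + 3))) (lt_min hδ (by positivity))
  rw [← hν] at hlt
  set t := ν.real (symmDiff B' B) with ht
  have hD : MeasurableSet (symmDiff B' B) := hB'.symmDiff hB
  have ht1 : t ≤ δ := hlt.le.trans (min_le_left _ _)
  have ht2 : (2 * d + 3) * t ≤ ν.real B := by
    have := hlt.le.trans (min_le_right _ _)
    rw [le_div_iff₀ (by positivity)] at this
    linarith
  have hx : ν.real B ≤ ν.real B' + t := by
    refine (measureReal_mono ?_).trans (measureReal_union_le B' (symmDiff B' B))
    intro X hX
    by_cases h : X ∈ B'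
    · exact Or.inl h
    · exact Or.inr (Or.inr ⟨hX, h⟩)
  have hsum : ∑ i : Fin d, ν.real {X | X ∈ B' ∧ shift (gen i) X ∈ B'} ≤
      ∑ i : Fin d, (ν.real {X | X ∈ B ∧ shift (gen i) X ∈ B} + (t + t)) := by
    refine Finset.sum_le_sum fun i _ => ?_
    have hsh : ν.real (shift (gen i) ⁻¹' symmDiff B' B) = t := by
      rw [ht, Measure.real, Measure.real, hν, iidLaw_shift _ hD]
    calc ν.real {X | X ∈ B' ∧ shift (gen i) X ∈ B'}
        ≤ ν.real ({X | X ∈ B ∧ shift (gen i) X ∈ B} ∪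
          (symmDiff B' B ∪ shift (gen i) ⁻¹' symmDiff B' B)) := by
          refine measureReal_mono ?_
          rintro X ⟨h1, h2⟩
          by_cases h3 : X ∈ B
          · by_cases h4 : shift (gen i) X ∈ B
            · exact Or.inl ⟨h3, h4⟩
            · exact Or.inr (Or.inr (Or.inl ⟨h2, h4⟩))
          · exact Or.inr (Or.inl (Or.inl ⟨h1, h3⟩))
      _ ≤ _ := (measureReal_union_le _ _).trans
          (add_le_add le_rfl ((measureReal_union_le _ _).trans (by rw [hsh])))
  rw [Finset.sum_add_distrib, Finset.sum_const, Finset.card_univ, Fintype.card_fin,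
    nsmul_eq_mul] at hsum
  have := hd F B' hB' hloc (by linarith)
  linarith

theorem IsRandomLabelling.map_eq {d : ℕ} {Ω : Type*} [MeasurableSpace Ω] {P : Measure Ω}
    {X : Vert d → Ω → I} (h : IsRandomLabelling P X) :
    P.map (fun ω v => X v ω) = iidLaw (Vert d) (volume : Measure I) := by
  rw [h.indep.map_fun_eq_infinitePi_map h.measurable]
  simp only [h.uniform]
  rfl

theorem relabel_toRoot {d : ℕ} (v : Vert d) (ω : Vert d → I) :
    relabel (toRoot v) ω = shift v ω := by
  funext u
  change ω ((Equiv.mulRight v⁻¹).symm u) = ω (u * v)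
  simp

/-- The density of a factor of iid with finite clusters is the probability of an event of random
labellings for which an open vertex has at most two open neighbours on average. -/
theorem exists_event {d : ℕ} {Ω : Type*} [MeasurableSpace Ω] {P : Measure Ω}
    {Y : Vert d → Ω → Fin 2} (hY : IsFIID P Y) (hfin : HasFiniteClusters P Y) :
    ∃ B : Set (Vert d → I), MeasurableSet B ∧
      density P Y = (iidLaw (Vert d) (volume : Measure I)).real B ∧
      ∑ i : Fin d, (iidLaw (Vert d) (volume : Measure I)).real {X | X ∈ B ∧ shift (gen i) X ∈ B} ≤
        2 * (iidLaw (Vert d) (volume : Measure I)).real B := by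
  obtain ⟨f, X, hf, hX, hYf⟩ := hY
  have hXm : Measurable fun ω v => X v ω := measurable_pi_iff.mpr hX.measurable
  have hB : MeasurableSet {ω | f ω = 1} := hf.measurable (measurableSet_singleton 1)
  have hYB : ∀ v ω, Y v ω = 1 ↔ shift v (fun u => X u ω) ∈ {ω | f ω = 1} := by
    intro v ω
    rw [hYf, relabel_toRoot]
    rfl
  refine ⟨{ω | f ω = 1}, hB, ?_, sum_neighbors_le hB ?_⟩
  · rw [density, ← hX.map_eq, map_measureReal_apply hXm hB]
    congr 1
    ext ω
    refine (hYB (root d) ω).trans ?_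
    rw [root, shift_one]
    rfl
  · rw [← hX.map_eq, ae_map_iff hXm.aemeasurable]
    · filter_upwards [hfin] with ω hω hωB
      refine exists_cluster hωB ?_
      have : {v | Y v ω = 1} = {v | shift v (fun u => X u ω) ∈ {ω | f ω = 1}} := by
        ext v
        exact hYB v ω
      rwa [this] at hω
    -- Transferring the almost sure statement to the law of the labels needs a measurable event;
    -- this one involves only countably many finite sets `C`.
    · have : {X : Vert d → I | X ∈ {ω | f ω = 1} → ∃ C : Finset (Vert d), 1 ∈ C ∧ IsConn C ∧
          X ∈ clusterEvent {ω | f ω = 1} C} =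
          {ω | f ω = 1}ᶜ ∪ ⋃ (C : Finset (Vert d)) (_ : 1 ∈ C ∧ IsConn C),
            clusterEvent {ω | f ω = 1} C := by
        ext X
        simp only [Set.mem_union, Set.mem_compl_iff, Set.mem_iUnion, exists_prop, and_assoc]
        exact imp_iff_not_or
      rw [this]
      exact hB.compl.union (MeasurableSet.iUnion fun C => MeasurableSet.iUnion fun _ =>
        measurableSet_clusterEvent hB C)

end FIID

theorem corollary2 {Ω : ℕ → Type*} [∀ d, MeasurableSpace (Ω d)]
    (P : ∀ d, Measure (Ω d)) [∀ d, IsProbabilityMeasure (P d)]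
    (Y : ∀ d, FIID.Vert d → Ω d → Fin 2)
    (hY : ∀ d, FIID.IsFIID (P d) (Y d))
    (hfin : ∀ d, FIID.HasFiniteClusters (P d) (Y d)) :
    limsup (fun d : ℕ =>
      ((FIID.density (P d) (Y d) / (Real.log d / d) : ℝ) : EReal)) atTop ≤ 1 := by
  have key : ∀ ε : ℝ, 0 < ε → limsup (fun d : ℕ =>
      ((FIID.density (P d) (Y d) / (Real.log d / d) : ℝ) : EReal)) atTop ≤ ((1 + ε : ℝ) : EReal) := by
    intro ε hε
    refine limsup_le_of_le (by isBoundedDefault) ?_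
    -- For `d ≥ 2` the denominator `log d / d` is positive.
    filter_upwards [FIID.neighbors_bound hε, eventually_ge_atTop 2] with d hd hd2
    obtain ⟨B, hB, hden, hη⟩ := FIID.exists_event (hY d) (hfin d)
    have h2 : (1 : ℝ) < d := by exact_mod_cast hd2
    have hpos : 0 < Real.log d / d := div_pos (Real.log_pos h2) (by linarith)
    rw [EReal.coe_le_coe_iff, div_le_iff₀ hpos, hden]
    exact hd B hB hη
  refine EReal.le_of_forall_lt_iff_le.mp fun z hz => ?_
  have hz1 : 1 < z := by exact_mod_cast hz
  have := key (z - 1) (by linarith)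
  rwa [add_sub_cancel] at this
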